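/- Let $k$ be an algebraically closed field of characteristic $0$, let $X$ be a non-empty smooth quasi-projective surface over $k$, and let $n\ge 1$ be an integer. For a zero-dimensional closed subscheme $\xi\subset X$ of length $n$ (that is, $\dim_k\Gamma(\xi,\mathcal O_\xi)=n$) and a point $p\in\xi$, let $$b_2(\mathcal O_{\xi,p})=\dim_{k(p)}\operatorname{Hom}_{\mathcal O_{X,p}}\bigl(k(p),\mathcal O_{\xi,p}\bigr)$$ be the dimension of the socle of $\mathcal O_{\xi,p}$. Then: (1) for all such $\xi$ and $p$, $$b_2(\mathcal O_{\xi,p})\le\left\lfloor\frac{\sqrt{1+8n}-1}{2}\right\rfloor;$$ (2) this bound is optimal: there are a zero-dimensional closed subscheme $\xi\subset X$ of length $n$ and a point $p\in\xi$ for which equality holds; (3) let $X^{[n]}$ be the Hilbert scheme of $n$ points on $X$, which represents, on the category of $k$-schemes locally of finite type, the functor sending $T$ to the set of closed subschemes $W\subset X\times_k T$ that are finite and locally free of rank $n$ over $T$, and let $Z^n\subset X\times_k X^{[n]}$ be its universal family. For every closed point $\zeta\in Z^n$, the Samuel multiplicity $\mu$ of the Noetherian local ring $(\mathcal O_{Z^n,\zeta},\mathfrak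 m)$, namely $$\mu=\lim_{t\to\infty}\frac{d!\,\operatorname{length}(\mathcal O_{Z^n,\zeta}/\mathfrak m^{t})}{t^{d}},\qquad d=\dim\mathcal O_{Z^n,\zeta},$$ satisfies $\mu\le n$. -/

import Mathlib

open CategoryTheory CategoryTheory.Limits AlgebraicGeometry

universe u

noncomputable section

/-- For a local ring `R` and a ring homomorphism `φ : R → A`, the dimension of the socle
`Hom_R(κ(R), A)` over the residue field `κ(R)`. The scalars act on this `R`-module through the
surjection `R → κ(R)`, so its dimension over `κ(R)` is its length over `R` (an element of
`ℕ∞`, with no junk value). -/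
def socleDim {R A : Type u} [CommRing R] [IsLocalRing R] [CommRing A] (φ : R →+* A) : ℕ∞ :=
  letI : Algebra R A := φ.toAlgebra
  Module.length R (IsLocalRing.ResidueField R →ₗ[R] A)

/-- The real number `μ` is the Samuel multiplicity of the Noetherian local ring `(R, 𝔪)`:
if `d = dim R`, then `d! * length (R / 𝔪 ^ t) / t ^ d` tends to `μ` as `t → ∞`.
(All the lengths are finite since `R` is Noetherian.) -/
def HasSamuelMultiplicity (R : Type u) [CommRing R] [IsLocalRing R] (μ : ℝ) : Prop :=
  IsNoetherianRing R ∧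
  ∃ d : ℕ, ringKrullDim R = d ∧
    Filter.Tendsto
      (fun t : ℕ => (d.factorial : ℝ) *
        ((Module.length R (R ⧸ IsLocalRing.maximalIdeal R ^ t)).toNat : ℝ) / (t : ℝ) ^ d)
      Filter.atTop (nhds μ)

section

attribute [local instance] MvPolynomial.gradedAlgebra

variable {k : Type u} [Field k]

/-- Projective space `ℙ^N` over the field `k`, as the `Proj` of `k[x_0, …, x_N]`. -/
abbrev projSpace (k : Type u) [Field k] (N : ℕ) : Scheme.{u} :=
  Proj (MvPolynomial.homogeneousSubmodule (Fin (N + 1)) k)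

/-- The structure morphism `ℙ^N → Spec k`. -/
def projSpaceHom (k : Type u) [Field k] (N : ℕ) : projSpace k N ⟶ Spec (.of k) :=
  Proj.toSpecZero (MvPolynomial.homogeneousSubmodule (Fin (N + 1)) k) ≫
    Spec.map (CommRingCat.ofHom
      (algebraMap k (MvPolynomial.homogeneousSubmodule (Fin (N + 1)) k 0)))

/-- A `k`-scheme is quasi-projective if it is a locally closed subscheme of some `ℙ^N`. -/
def IsQuasiProjective {X : Scheme.{u}} (f : X ⟶ Spec (.of k)) : Prop :=
  ∃ (N : ℕ) (j : X ⟶ projSpace k N), IsImmersion j ∧ j ≫ projSpaceHom k N = f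

/-- `i : ξ → X` is a zero-dimensional closed subscheme of length `n` of the `k`-scheme `X`:
`ξ` is finite over `k` and `dim_k Γ(ξ, 𝒪_ξ) = n`. -/
def IsClosedSubschemeOfLength {X : Scheme.{u}} (f : X ⟶ Spec (.of k)) (n : ℕ)
    {ξ : Scheme.{u}} (i : ξ ⟶ X) : Prop :=
  IsClosedImmersion i ∧ IsFinite (i ≫ f) ∧
    letI : Algebra k Γ(ξ, ⊤) :=
      ((Scheme.ΓSpecIso (.of k)).inv ≫ (i ≫ f).appTop).hom.toAlgebra
    Module.finrank k Γ(ξ, ⊤) = n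

/-- `b_2(𝒪_{ξ,p})`: the dimension of the socle `Hom_{𝒪_{X,p}}(k(p), 𝒪_{ξ,p})` of the closed
subscheme `i : ξ → X` at the point `p` of `ξ`. -/
def socleDimAt {X ξ : Scheme.{u}} (i : ξ ⟶ X) (p : ξ) : ℕ∞ :=
  socleDim (i.stalkMap p).hom

/-- A flat family over the `k`-scheme `T` of length-`n` closed subschemes of the `k`-scheme `X`:
morphisms `q : W → X` and `π : W → T` over `k` that make `W` a closed subscheme of `X ×_k T`,
with `π` finite and locally free of rank `n`. -/
structure IsFamily {X : Scheme.{u}} (f : X ⟶ Spec (.of k)) (n : ℕ)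
    {T W : Scheme.{u}} (t : T ⟶ Spec (.of k)) (q : W ⟶ X) (π : W ⟶ T) : Prop where
  comm : q ≫ f = π ≫ t
  isClosedImmersion : IsClosedImmersion (pullback.lift q π comm)
  isFinite : IsFinite π
  flat : Flat π
  locallyOfFinitePresentation : LocallyOfFinitePresentation π
  rank : ∀ s : T, π.finrank s = n

/-- `h : H → Spec k` is the Hilbert scheme of `n` points on the `k`-scheme `X`, with universal
family `Z ⊆ X ×_k H` given by the projections `q : Z → X` and `π : Z → H`: in the category of
`k`-schemes locally of finite type, `(H, Z)` represents the functor that sends `T` to the set of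
flat families over `T` of length-`n` closed subschemes of `X`. That is, each family `W ⊆ X ×_k T`
is the pullback, as a subscheme of `X ×_k T`, of `Z` along a unique `k`-morphism `T → H`. -/
structure IsHilbertScheme {X : Scheme.{u}} (f : X ⟶ Spec (.of k)) (n : ℕ)
    {H Z : Scheme.{u}} (h : H ⟶ Spec (.of k)) (q : Z ⟶ X) (π : Z ⟶ H) : Prop where
  locallyOfFiniteType : LocallyOfFiniteType h
  isFamily : IsFamily f n h q π
  existsUnique : ∀ {T W : Scheme.{u}} (t : T ⟶ Spec (.of k)) (q' : W ⟶ X) (π' : W ⟶ T),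
    LocallyOfFiniteType t → IsFamily f n t q' π' →
      ∃! φ : T ⟶ H, φ ≫ h = t ∧ ∃ g : W ⟶ Z, g ≫ q = q' ∧ IsPullback g π' π φ

end

end

/-!
A point of `ξ` with socle of dimension `r` forces `ξ` to have length at least `r * (r + 1) / 2`:
if the ideal of `ξ` has order `m` at the point, then the local ring of `ξ` surjects onto
`k[x, y] / (x, y) ^ m`, which gives `m * (m + 1) / 2 ≤ n`, while the quotient by a general linear
form has dimension at most `m` and bounds the dimension of the socle. Monomial ideals whose
staircase has `r` corners attain the bound.

For the multiplicity, flat families of subschemes over local Artinian bases extend along small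
extensions: a length-`n` algebra generated by two elements is a pair of commuting matrices with a
cyclic vector, and the obstruction `[X, A] + [B, Y] = Z` is solvable because `Z` is orthogonal,
under the trace pairing, to the centraliser of the pair. Hence the local rings of the Hilbert scheme
`H` surject onto truncated polynomial rings in as many variables as the dimension `N` of the
cotangent space, so that `N ≤ dim`. As `Z` is locally free of rank `n` over `H`, the length of
`𝒪_Z / 𝔪 ^ t` is at most `n` times the number of monomials of degree less than `t` in `N` variables,
and this length is a polynomial in `t` for large `t`.
-/

noncomputable section

section Nilpotent

variable {B : Type*} [CommRing B]

theorem ideal_le_of_le_sup_sq_of_isNilpotent {I J : Ideal B} (hI : IsNilpotent I)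
    (h : I ≤ J ⊔ I ^ 2) : I ≤ J := by
  have le_sup_pow (m : ℕ) : I ≤ J ⊔ I ^ (m + 1) := by
    induction m with
    | zero => simp
    | succ m ih =>
      refine ih.trans (sup_le le_sup_left ?_)
      calc I ^ (m + 1) = I ^ m * I := pow_succ _ _
        _ ≤ I ^ m * (J ⊔ I ^ 2) := Ideal.mul_mono_right h
        _ = I ^ m * J ⊔ I ^ m * I ^ 2 := Ideal.mul_sup _ _ _
        _ ≤ J ⊔ I ^ (m + 1 + 1) := sup_le_sup Ideal.mul_le_right (by rw [← pow_add])
  obtain ⟨n, hn⟩ := hI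
  simpa [pow_succ, hn] using le_sup_pow n

theorem exists_sub_mem_pow_succ_of_mem_span {k : Type*} [CommSemiring k] [Algebra k B]
    {S : Subalgebra k B} {I : Ideal B} {m : ℕ} (hm : ∀ b, ∃ s ∈ S, b - s ∈ I ^ m) {x : B}
    (hx : x ∈ Ideal.span ((S : Set B) ∩ I)) : ∃ s ∈ S, x - s ∈ I ^ (m + 1) := by
  induction hx using Submodule.closure_induction with
  | zero => exact ⟨0, zero_mem _, by simp⟩
  | add x y _ _ hx hy =>
    obtain ⟨s, hs, hxs⟩ := hx
    obtain ⟨t, ht, hyt⟩ := hy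
    exact ⟨s + t, add_mem hs ht, by rw [add_sub_add_comm]; exact add_mem hxs hyt⟩
  | smul_mem c x hx =>
    obtain ⟨s, hs, hcs⟩ := hm c
    refine ⟨s * x, mul_mem hs hx.1, ?_⟩
    rw [smul_eq_mul, ← sub_mul, pow_succ]
    exact Ideal.mul_mem_mul hcs hx.2

theorem subalgebra_eq_top_of_isNilpotent {k : Type*} [CommSemiring k] [Algebra k B]
    (S : Subalgebra k B) {I : Ideal B} (hI : IsNilpotent I) (hS : ∀ b, ∃ s ∈ S, b - s ∈ I)
    (hgen : I ≤ Ideal.span ((S : Set B) ∩ I) ⊔ I ^ 2) : S = ⊤ := by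
  have hspan := ideal_le_of_le_sup_sq_of_isNilpotent hI hgen
  have approx (m : ℕ) : ∀ b, ∃ s ∈ S, b - s ∈ I ^ m := by
    induction m with
    | zero => exact fun b => ⟨0, zero_mem _, by simp⟩
    | succ m ih =>
      intro b
      obtain ⟨s, hs, hbs⟩ := hS b
      obtain ⟨t, ht, hst⟩ := exists_sub_mem_pow_succ_of_mem_span ih (hspan hbs)
      exact ⟨s + t, add_mem hs ht, by rwa [sub_sub] at hst⟩
  obtain ⟨n, hn⟩ := hI
  refine eq_top_iff.2 fun b _ => ?_
  obtain ⟨s, hs, hbs⟩ := approx n b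
  rw [hn] at hbs
  rwa [sub_eq_zero.1 (show b - s = 0 from hbs)]

theorem isLocalRing_of_ker_le_nilradical {K : Type*} [CommRing K] [IsLocalRing K] (f : B →+* K)
    (hf : Function.Surjective f) (hker : RingHom.ker f ≤ nilradical B) : IsLocalRing B := by
  have : IsLocalHom f := by
    refine ⟨fun a ha => ?_⟩
    obtain ⟨b, hb⟩ := hf ↑ha.unit⁻¹
    have hab : IsNilpotent (a * b - 1) := hker (by simp [RingHom.mem_ker, hb])
    exact isUnit_of_mul_isUnit_left (by simpa using hab.isUnit_add_one)
  exact RingHom.domain_isLocalRing f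

end Nilpotent

theorem mem_adjoin_image_iff {R T A B : Type*} [CommRing R] [CommRing T] [Ring A] [Ring B]
    [Algebra R A] [Algebra T B] {f : R →+* T} (hf : Function.Surjective f) {p : A →+* B}
    (hp : ∀ r, p (algebraMap R A r) = algebraMap T B (f r)) {s : Set A} {b : B} :
    b ∈ Algebra.adjoin T (p '' s) ↔ ∃ a ∈ Algebra.adjoin R s, p a = b := by
  have hrange : p '' Set.range (algebraMap R A) = Set.range (algebraMap T B) := by
    rw [← Set.range_comp, ← hf.range_comp]
    exact congrArg Set.range (funext hp)
  simp only [Algebra.mem_adjoin_iff, ← hrange, ← Set.image_union, ← RingHom.map_closure,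
    Subring.mem_map]

namespace TruncAlg

open MvPolynomial

/-- The ideal of a polynomial ring generated by the monomials with exponents outside `S`. -/
def ideal (k : Type*) [CommRing k] {σ : Type*} (S : Finset (σ →₀ ℕ)) : Ideal (MvPolynomial σ k) :=
  Ideal.span ((fun s => monomial s (1 : k)) '' {s | s ∉ S})

variable {k : Type*} [CommRing k] {σ : Type*} {S S' : Finset (σ →₀ ℕ)}

theorem mem_ideal (hS : IsLowerSet (S : Set (σ →₀ ℕ))) {p : MvPolynomial σ k} :
    p ∈ ideal k S ↔ ∀ s ∈ S, coeff s p = 0 := by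
  rw [ideal, mem_ideal_span_monomial_image]
  constructor
  · intro h s hs
    by_contra hc
    obtain ⟨t, ht, hts⟩ := h s (mem_support_iff.2 hc)
    exact ht (hS hts hs)
  · intro h s hs
    exact ⟨s, fun hs' => mem_support_iff.1 hs (h s hs'), le_rfl⟩

theorem ideal_anti (h : S ⊆ S') : ideal k S' ≤ ideal k S :=
  Ideal.span_mono (Set.image_mono fun _ hs hs' => hs (h hs'))

theorem idealOfVars_pow_le_ideal {t : ℕ} (hS : ∀ s ∈ S, s.degree < t) :
    idealOfVars σ k ^ t ≤ ideal k S := by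
  rw [pow_idealOfVars_eq_span]
  refine Ideal.span_mono (Set.image_mono fun s hs hsS => (hS s hsS).ne hs)

theorem ideal_le_idealOfVars (h0 : (0 : σ →₀ ℕ) ∈ S) : ideal k S ≤ idealOfVars σ k := by
  classical
  rw [ideal, Ideal.span_le]
  rintro _ ⟨s, hs, rfl⟩
  have hs0 : s ≠ 0 := fun h => hs (h ▸ h0)
  rw [SetLike.mem_coe, ← pow_one (idealOfVars σ k), mem_pow_idealOfVars_iff']
  intro t ht
  rw [(Finsupp.degree_eq_zero_iff t).1 (Nat.lt_one_iff.1 ht), coeff_monomial, if_neg hs0]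

theorem ker_aeval_zero :
    RingHom.ker (aeval fun _ => 0 : MvPolynomial σ k →ₐ[k] k) = idealOfVars σ k := by
  ext p
  have hdeg (t : σ →₀ ℕ) : t.degree < 1 ↔ t = 0 := by
    rw [Nat.lt_one_iff, Finsupp.degree_eq_zero_iff]
  rw [← pow_one (idealOfVars σ k), mem_pow_idealOfVars_iff', RingHom.mem_ker,
    ← Pi.zero_def, aeval_zero]
  simp [hdeg, constantCoeff_eq]

end TruncAlg

/-- The truncated polynomial ring with exponents in a finite set `S` (in practice a lower set): the
quotient of the polynomial ring by all monomials with exponents outside `S`. -/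
def TruncAlg (k : Type*) [CommRing k] {σ : Type*} (S : Finset (σ →₀ ℕ)) : Type _ :=
  MvPolynomial σ k ⧸ TruncAlg.ideal k S

instance (k : Type*) [CommRing k] {σ : Type*} (S : Finset (σ →₀ ℕ)) : CommRing (TruncAlg k S) :=
  inferInstanceAs (CommRing (MvPolynomial σ k ⧸ TruncAlg.ideal k S))

instance (k : Type*) [CommRing k] {σ : Type*} (S : Finset (σ →₀ ℕ)) : Algebra k (TruncAlg k S) :=
  inferInstanceAs (Algebra k (MvPolynomial σ k ⧸ TruncAlg.ideal k S))

namespace TruncAlg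

open MvPolynomial

variable {k : Type*} [CommRing k] {σ : Type*} {S S' : Finset (σ →₀ ℕ)}

/-- The quotient map from polynomials to truncated polynomials. -/
def mk (k : Type*) [CommRing k] {σ : Type*} (S : Finset (σ →₀ ℕ)) :
    MvPolynomial σ k →ₐ[k] TruncAlg k S :=
  Ideal.Quotient.mkₐ k (ideal k S)

theorem mk_surjective : Function.Surjective (mk k S) :=
  Ideal.Quotient.mk_surjective

theorem mk_eq_zero_iff {p : MvPolynomial σ k} : mk k S p = 0 ↔ p ∈ ideal k S :=
  Ideal.Quotient.eq_zero_iff_mem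

theorem ker_mk : RingHom.ker (mk k S) = ideal k S :=
  Ideal.ext fun _ => mk_eq_zero_iff

/-- The class of a monomial in the truncated polynomial ring. -/
def mono (k : Type*) [CommRing k] {σ : Type*} (S : Finset (σ →₀ ℕ)) (s : σ →₀ ℕ) :
    TruncAlg k S :=
  mk k S (monomial s 1)

theorem mono_eq_zero {s : σ →₀ ℕ} (hs : s ∉ S) : mono k S s = 0 :=
  mk_eq_zero_iff.2 (Ideal.subset_span ⟨s, hs, rfl⟩)

theorem mono_add (s t : σ →₀ ℕ) : mono k S (s + t) = mono k S s * mono k S t := by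
  rw [mono, mono, mono, ← map_mul, monomial_mul, one_mul]

/-- The coefficients of a polynomial along the exponents in `S`. -/
def coeffs (k : Type*) [CommRing k] {σ : Type*} (S : Finset (σ →₀ ℕ)) :
    MvPolynomial σ k →ₗ[k] (S → k) :=
  LinearMap.pi fun s => lcoeff k s.1

theorem coeffs_surjective : Function.Surjective (coeffs k S) := by
  classical
  intro g
  refine ⟨∑ s : S, monomial s.1 (g s), funext fun t => ?_⟩
  have hst (s : S) : s.1 = t.1 ↔ s = t := Subtype.ext_iff.symm
  simp [coeffs, coeff_monomial, hst]

theorem ker_coeffs (hS : IsLowerSet (S : Set (σ →₀ ℕ))) :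
    LinearMap.ker (coeffs k S) = (ideal k S).restrictScalars k := by
  ext p
  rw [LinearMap.mem_ker, Submodule.restrictScalars_mem, mem_ideal hS, funext_iff, Subtype.forall]
  rfl

/-- The coefficients of an element of `TruncAlg k S` along the exponents in `S`. -/
def coeffEquiv (hS : IsLowerSet (S : Set (σ →₀ ℕ))) : TruncAlg k S ≃ₗ[k] (S → k) :=
  ((Submodule.Quotient.restrictScalarsEquiv k (ideal k S)).symm ≪≫ₗ
    Submodule.quotEquivOfEq _ _ (ker_coeffs hS).symm ≪≫ₗ
    (coeffs k S).quotKerEquivOfSurjective coeffs_surjective :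
      (MvPolynomial σ k ⧸ ideal k S) ≃ₗ[k] (S → k))

theorem coeffEquiv_mono [DecidableEq σ] (hS : IsLowerSet (S : Set (σ →₀ ℕ))) (s : S) :
    coeffEquiv hS (mono k S s.1) = Pi.single s 1 := by
  ext t
  change coeff t.1 (monomial s.1 (1 : k)) = _
  simp only [coeff_monomial, Pi.single_apply, eq_comm (a := t), Subtype.ext_iff]

theorem finite (hS : IsLowerSet (S : Set (σ →₀ ℕ))) : Module.Finite k (TruncAlg k S) :=
  Module.Finite.equiv (coeffEquiv hS).symm

theorem finrank [Nontrivial k] (hS : IsLowerSet (S : Set (σ →₀ ℕ))) :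
    Module.finrank k (TruncAlg k S) = S.card := by
  rw [(coeffEquiv hS).finrank_eq]; simp

theorem mono_linearIndependent (hS : IsLowerSet (S : Set (σ →₀ ℕ))) :
    LinearIndependent k fun s : S => mono k S s.1 := by
  classical
  refine LinearIndependent.of_comp (coeffEquiv hS).toLinearMap ?_
  convert! (Pi.basisFun k S).linearIndependent using 1
  ext1 s
  simp [coeffEquiv_mono hS]

theorem adjoin_range_mono_single_eq_top :
    Algebra.adjoin k (Set.range fun i => mono k S (.single i 1)) = ⊤ := by
  have h := congrArg (Subalgebra.map (mk k S)) (adjoin_range_X (R := k) (σ := σ))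
  rwa [AlgHom.map_adjoin, ← Set.range_comp, Algebra.map_top,
    (AlgHom.range_eq_top _).2 mk_surjective] at h

/-- The projection between truncated polynomial rings for an inclusion of exponent sets. -/
def proj (h : S ⊆ S') : TruncAlg k S' →ₐ[k] TruncAlg k S :=
  (Ideal.Quotient.factorₐ k (ideal_anti (k := k) h) :
    (MvPolynomial σ k ⧸ ideal k S') →ₐ[k] MvPolynomial σ k ⧸ ideal k S)

theorem proj_mk (h : S ⊆ S') (p : MvPolynomial σ k) :
    proj h (mk k S' p) = mk k S p := rfl

theorem proj_surjective (h : S ⊆ S') : Function.Surjective (proj (k := k) h) :=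
  Ideal.Quotient.factor_surjective (ideal_anti h)

theorem proj_self : proj (k := k) (subset_refl S) = AlgHom.id k _ := by
  refine AlgHom.ext fun a => ?_
  obtain ⟨p, rfl⟩ := mk_surjective a
  exact proj_mk _ p

theorem proj_comp_proj {S'' : Finset (σ →₀ ℕ)} (h : S ⊆ S') (h' : S' ⊆ S'') :
    (proj (k := k) h).comp (proj h') = proj (h.trans h') := by
  refine AlgHom.ext fun a => ?_
  obtain ⟨p, rfl⟩ := mk_surjective a
  rw [AlgHom.comp_apply, proj_mk, proj_mk, proj_mk]

theorem exists_smul_mono_of_proj_eq_zero [DecidableEq σ] {s : σ →₀ ℕ}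
    (hS : IsLowerSet (S : Set (σ →₀ ℕ)))
    (hS' : IsLowerSet ((insert s S : Finset (σ →₀ ℕ)) : Set (σ →₀ ℕ)))
    {a : TruncAlg k (insert s S)} (ha : proj (Finset.subset_insert s S) a = 0) :
    ∃ c : k, a = c • mono k (insert s S) s := by
  obtain ⟨p, rfl⟩ := mk_surjective a
  rw [proj_mk, mk_eq_zero_iff, mem_ideal hS] at ha
  refine ⟨coeff s p, ?_⟩
  rw [mono, ← map_smul, ← sub_eq_zero, ← map_sub, mk_eq_zero_iff, mem_ideal hS']
  intro t ht
  rw [coeff_sub, coeff_smul, coeff_monomial]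
  split_ifs with hst
  · simp [hst]
  · simp [ha t ((Finset.mem_insert.1 ht).resolve_left (Ne.symm hst))]

/-- The augmentation of `TruncAlg k S`, sending all variables to `0`. -/
def aug (h0 : (0 : σ →₀ ℕ) ∈ S) : TruncAlg k S →ₐ[k] k :=
  (Ideal.Quotient.liftₐ _ (aeval fun _ => (0 : k)) fun _ hp =>
    ker_aeval_zero.ge (ideal_le_idealOfVars h0 hp) : (MvPolynomial σ k ⧸ ideal k S) →ₐ[k] k)

theorem aug_mk (h0 : (0 : σ →₀ ℕ) ∈ S) (p : MvPolynomial σ k) :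
    aug h0 (mk k S p) = aeval (fun _ => (0 : k)) p := rfl

theorem aug_proj (h0 : (0 : σ →₀ ℕ) ∈ S) (h : S ⊆ S') (a : TruncAlg k S') :
    aug h0 (proj h a) = aug (h h0) a := by
  obtain ⟨p, rfl⟩ := mk_surjective a
  rw [proj_mk, aug_mk, aug_mk]

theorem aug_surjective (h0 : (0 : σ →₀ ℕ) ∈ S) : Function.Surjective (aug (k := k) h0) :=
  fun c => ⟨algebraMap _ _ c, (aug h0).commutes c⟩

theorem ker_aug (h0 : (0 : σ →₀ ℕ) ∈ S) :
    RingHom.ker (aug (k := k) h0) = (idealOfVars σ k).map (mk k S) := by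
  ext a
  obtain ⟨p, rfl⟩ := mk_surjective a
  rw [RingHom.mem_ker, aug_mk, ← RingHom.mem_ker, ker_aeval_zero, Ideal.mem_map_iff_of_surjective _
    mk_surjective]
  refine ⟨fun hp => ⟨p, hp, rfl⟩, fun ⟨q, hq, hqp⟩ => ?_⟩
  have hsub : p - q ∈ ideal k S := mk_eq_zero_iff.1 (by rw [map_sub, hqp, sub_self])
  simpa using add_mem (ideal_le_idealOfVars h0 hsub) hq

theorem ker_aug_eq_span (h0 : (0 : σ →₀ ℕ) ∈ S) :
    RingHom.ker (aug (k := k) h0) = Ideal.span (Set.range fun i => mono k S (.single i 1)) := by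
  rw [ker_aug, idealOfVars, Ideal.map_span, ← Set.range_comp]
  rfl

theorem aug_mono (h0 : (0 : σ →₀ ℕ) ∈ S) {s : σ →₀ ℕ} (hs : s ≠ 0) : aug h0 (mono k S s) = 0 := by
  classical
  rw [mono, aug_mk, ← Pi.zero_def, aeval_zero, constantCoeff_eq, coeff_monomial, if_neg hs,
    map_zero]

theorem ker_aug_pow_eq_bot (h0 : (0 : σ →₀ ℕ) ∈ S) {t : ℕ} (hS : ∀ s ∈ S, s.degree < t) :
    RingHom.ker (aug (k := k) h0) ^ t = ⊥ := by
  rw [ker_aug, ← Ideal.map_pow, Ideal.map_eq_bot_iff_le_ker, ker_mk]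
  exact idealOfVars_pow_le_ideal hS

theorem isNilpotent_ker_aug (h0 : (0 : σ →₀ ℕ) ∈ S) :
    IsNilpotent (RingHom.ker (aug (k := k) h0)) :=
  ⟨S.sup Finsupp.degree + 1,
    ker_aug_pow_eq_bot h0 fun _ hs => Nat.lt_succ_of_le (Finset.le_sup (f := Finsupp.degree) hs)⟩

theorem isLocalRing [IsLocalRing k] (h0 : (0 : σ →₀ ℕ) ∈ S) : IsLocalRing (TruncAlg k S) := by
  obtain ⟨n, hn⟩ := isNilpotent_ker_aug (k := k) h0
  refine isLocalRing_of_ker_le_nilradical (aug h0).toRingHom (aug_surjective h0) fun a ha => ⟨n, ?_⟩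
  simpa [hn] using Ideal.pow_mem_pow (show a ∈ RingHom.ker (aug h0) from ha) n

theorem mul_mono_eq_zero_of_aug_eq_zero {s : σ →₀ ℕ} (h0 : (0 : σ →₀ ℕ) ∈ S)
    (hs : ∀ t ∈ S, s ≤ t → t = s) {a : TruncAlg k S} (ha : aug h0 a = 0) :
    a * mono k S s = 0 := by
  have ha' : a ∈ Ideal.span (Set.range fun i => mono k S (.single i 1)) :=
    (ker_aug_eq_span h0).le ha
  clear ha
  induction ha' using Submodule.closure_induction with
  | zero => exact zero_mul _
  | add x y _ _ hx hy => rw [add_mul, hx, hy, add_zero]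
  | smul_mem c x hx =>
    obtain ⟨i, rfl⟩ := hx
    rw [smul_eq_mul, mul_assoc, ← mono_add, mono_eq_zero, mul_zero]
    exact fun h => by simpa using hs _ h le_add_self

end TruncAlg

section Cotangent

open TensorProduct KaehlerDifferential

variable {k : Type*} [CommRing k] {A : Type*} [CommRing A] [Algebra k A]

theorem smul_cotangent_ker (ε : A →ₐ[k] k) (a : A) (x : (RingHom.ker ε).Cotangent) :
    a • x = ε a • x := by
  have hmem : a - algebraMap k A (ε a) ∈ RingHom.ker ε := by simp [RingHom.mem_ker]
  rw [← algebraMap_smul A (ε a), ← sub_eq_zero, ← sub_smul]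
  exact Ideal.Cotangent.smul_eq_zero_of_mem hmem x

/-- The `k`-linear map `a ↦ a - ε a` from `A` to the cotangent space `ker ε / ker ε ^ 2` at a
`k`-point `ε`. -/
def toCotangent (ε : A →ₐ[k] k) : A →ₗ[k] (RingHom.ker ε).Cotangent :=
  ((RingHom.ker ε).toCotangent.restrictScalars k).comp
    (LinearMap.codRestrict ((RingHom.ker ε).restrictScalars k)
      (LinearMap.id - (Algebra.linearMap k A).comp ε.toLinearMap) fun a => by
        simp [RingHom.mem_ker])

theorem toCotangent_apply_coe (ε : A →ₐ[k] k) (x : RingHom.ker ε) :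
    toCotangent ε x = (RingHom.ker ε).toCotangent x := by
  refine congrArg (RingHom.ker ε).toCotangent (Subtype.ext ?_)
  change (x : A) - algebraMap k A (ε x) = x
  rw [RingHom.mem_ker.1 x.2, map_zero, sub_zero]

theorem toCotangent_algebraMap (ε : A →ₐ[k] k) (c : k) :
    toCotangent ε (algebraMap k A c) = 0 := by
  refine ((RingHom.ker ε).toCotangent_eq_zero _).2 ?_
  change algebraMap k A c - algebraMap k A (ε (algebraMap k A c)) ∈ _
  simp

theorem toCotangent_mul (ε : A →ₐ[k] k) (a b : A) :
    toCotangent ε (a * b) = ε a • toCotangent ε b + ε b • toCotangent ε a := by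
  rw [← algebraMap_smul A (ε a), ← algebraMap_smul A (ε b)]
  refine (Ideal.toCotangent_eq _).2 ?_
  change (a * b - algebraMap k A (ε (a * b))) - (algebraMap k A (ε a) * (b - algebraMap k A (ε b)) +
    algebraMap k A (ε b) * (a - algebraMap k A (ε a))) ∈ _
  have hprod : (a - algebraMap k A (ε a)) * (b - algebraMap k A (ε b)) ∈ RingHom.ker ε ^ 2 := by
    rw [pow_two]
    exact Ideal.mul_mem_mul (by simp [RingHom.mem_ker]) (by simp [RingHom.mem_ker])
  convert! hprod using 1
  rw [map_mul, map_mul]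
  ring

theorem exists_cotangent_generators {σ : Type*} {ε : A →ₐ[k] k}
    (b : Module.Basis σ k (RingHom.ker ε).Cotangent) :
    ∃ y : σ → A, (∀ i, ε (y i) = 0) ∧ (∀ i, toCotangent ε (y i) = b i) ∧
      RingHom.ker ε ≤ Ideal.span (Set.range y) ⊔ RingHom.ker ε ^ 2 := by
  choose y hy using fun i => (RingHom.ker ε).toCotangent_surjective (b i)
  refine ⟨fun i => y i, fun i => (y i).2, fun i => by rw [toCotangent_apply_coe, hy],
    fun a ha => ?_⟩
  have hspan : (RingHom.ker ε).toCotangent ⟨a, ha⟩ ∈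
      Submodule.span A (Set.range ((RingHom.ker ε).toCotangent ∘ y)) := by
    rw [show (RingHom.ker ε).toCotangent ∘ y = b from funext hy]
    exact Submodule.span_le_restrictScalars k A _ (b.mem_span _)
  rw [Set.range_comp, Submodule.span_image] at hspan
  obtain ⟨x, hx, hxa⟩ := hspan
  have hx' : (x : A) ∈ Ideal.span (Set.range fun i => (y i : A)) := by
    have := Submodule.mem_map_of_mem (f := (RingHom.ker ε).subtype) hx
    rwa [Submodule.map_span, ← Set.range_comp] at this
  rw [← add_sub_cancel (x : A) a]
  exact add_mem (Ideal.mem_sup_left hx') (Ideal.mem_sup_right ((Ideal.toCotangent_eq _).1 hxa.symm))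

end Cotangent

section Kaehler

open TensorProduct KaehlerDifferential

universe v

variable {k A : Type v} [CommRing k] [CommRing A] [Algebra k A]

theorem kerCotangentToTensor_bijective_of_isScalarTower [Algebra A k] [IsScalarTower k A k] :
    Function.Bijective (kerCotangentToTensor k A k) := by
  have hsurj : Function.Surjective (algebraMap A k) := fun c =>
    ⟨algebraMap k A c, (IsScalarTower.algebraMap_apply k A k c).symm⟩
  obtain ⟨l, hl⟩ := (retractionKerCotangentToTensorEquivSection (R := k) hsurj).symm
    ⟨Algebra.ofId k _, Subsingleton.elim _ _⟩
  refine ⟨Function.LeftInverse.injective (g := l) (LinearMap.congr_fun hl), fun x => ?_⟩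
  exact (exact_kerCotangentToTensor_mapBaseChange k A k hsurj x).1 (Subsingleton.elim _ _)

/-- The basis of the cotangent space at a `k`-point induced by a basis of the Kähler
differentials. -/
def cotangentBasisOfKaehler {σ : Type*} (b : Module.Basis σ A (Ω[A⁄k])) (ε : A →ₐ[k] k) :
    Module.Basis σ k (RingHom.ker ε).Cotangent :=
  letI : Algebra A k := ε.toAlgebra
  haveI : IsScalarTower k A k := .of_algebraMap_eq fun c => (ε.commutes c).symm
  (b.baseChange k).map (LinearEquiv.ofBijective ((kerCotangentToTensor k A k).restrictScalars k)
    kerCotangentToTensor_bijective_of_isScalarTower).symm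

end Kaehler

namespace TruncAlg

open MvPolynomial

variable {k : Type*} [CommRing k] {σ : Type*} [Finite σ]

/-- The exponents of degree less than `t`. -/
def degLT (σ : Type*) [Finite σ] (t : ℕ) : Finset (σ →₀ ℕ) :=
  (Finsupp.finite_of_degree_lt (σ := σ) t).toFinset

theorem mem_degLT {t : ℕ} {s : σ →₀ ℕ} : s ∈ degLT σ t ↔ s.degree < t :=
  Set.Finite.mem_toFinset _

theorem isLowerSet_degLT (t : ℕ) : IsLowerSet (degLT σ t : Set (σ →₀ ℕ)) := fun _ _ hba ha =>
  mem_degLT.2 ((Finsupp.degree_mono hba).trans_lt (mem_degLT.1 ha))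

theorem zero_mem_degLT {t : ℕ} (ht : 0 < t) : (0 : σ →₀ ℕ) ∈ degLT σ t := by
  rw [mem_degLT]; simpa

theorem ker_proj_degLT_le {S : Finset (σ →₀ ℕ)} {t : ℕ} (ht : 0 < t) (h : degLT σ t ⊆ S) :
    RingHom.ker (proj (k := k) h) ≤ RingHom.ker (aug (k := k) (h (zero_mem_degLT ht))) ^ t := by
  intro a ha
  obtain ⟨p, rfl⟩ := mk_surjective a
  rw [RingHom.mem_ker, proj_mk, mk_eq_zero_iff, mem_ideal (isLowerSet_degLT t)] at ha
  rw [ker_aug, ← Ideal.map_pow]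
  exact Ideal.mem_map_of_mem _ ((mem_pow_idealOfVars_iff' _ _).2 fun s hs => ha s (mem_degLT.2 hs))

end TruncAlg

theorem exists_mem_sdiff_isLowerSet_erase {α : Type*} [PartialOrder α] [DecidableEq α]
    {S₁ S : Finset α} (hS₁ : IsLowerSet (S₁ : Set α)) (hS : IsLowerSet (S : Set α))
    (h : S₁ ⊂ S) :
    ∃ s ∈ S, S₁ ⊆ S.erase s ∧ IsLowerSet (S.erase s : Set α) := by
  obtain ⟨s, hs⟩ := (S \ S₁).exists_maximal (Finset.sdiff_nonempty.2 h.2)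
  have hs' := Finset.mem_sdiff.1 hs.prop
  refine ⟨s, hs'.1, fun t ht => Finset.mem_erase.2 ⟨fun hts => hs'.2 (hts ▸ ht), h.1 ht⟩, ?_⟩
  intro a b hba ha
  rw [Finset.mem_coe, Finset.mem_erase] at ha ⊢
  refine ⟨?_, hS hba ha.2⟩
  rintro rfl
  have ha' : a ∈ S \ S₁ := Finset.mem_sdiff.2 ⟨ha.2, fun h' => hs'.2 (hS₁ hba h')⟩
  exact ha.1 (hs.eq_of_ge ha' hba)

/-- A `k`-algebra `A` lifts truncations in the variables `σ` if all its homomorphisms to truncated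
polynomial rings lift along the projections that forget one monomial. It is the part of formal
smoothness that passes to the Hilbert scheme. -/
def LiftsTrunc (k : Type*) [CommRing k] (A : Type*) [CommRing A] [Algebra k A] (σ : Type*)
    [DecidableEq σ] : Prop :=
  ∀ (S : Finset (σ →₀ ℕ)) (s : σ →₀ ℕ), 0 ∈ S → IsLowerSet (S : Set (σ →₀ ℕ)) →
    IsLowerSet ((insert s S : Finset (σ →₀ ℕ)) : Set (σ →₀ ℕ)) → s ∉ S →
    ∀ φ : A →ₐ[k] TruncAlg k S, ∃ φ' : A →ₐ[k] TruncAlg k (insert s S),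
      (TruncAlg.proj (Finset.subset_insert s S)).comp φ' = φ

namespace LiftsTrunc

open TruncAlg

variable {k : Type*} [CommRing k] {A : Type*} [CommRing A] [Algebra k A] {σ : Type*}
  [DecidableEq σ]

theorem exists_lift (hA : LiftsTrunc k A σ) {S₁ : Finset (σ →₀ ℕ)}
    (hS₁ : IsLowerSet (S₁ : Set (σ →₀ ℕ))) (h0 : 0 ∈ S₁) (φ₁ : A →ₐ[k] TruncAlg k S₁)
    {S : Finset (σ →₀ ℕ)} (hS : IsLowerSet (S : Set (σ →₀ ℕ))) (h : S₁ ⊆ S) :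
    ∃ φ : A →ₐ[k] TruncAlg k S, (proj h).comp φ = φ₁ := by
  induction S using Finset.strongInduction with
  | H S ih =>
    obtain rfl | hne := h.eq_or_ssubset
    · exact ⟨φ₁, by rw [proj_self, AlgHom.id_comp]⟩
    obtain ⟨s, hs, hsub, hlow⟩ := exists_mem_sdiff_isLowerSet_erase hS₁ hS hne
    obtain ⟨φ, hφ⟩ := ih (S.erase s) (Finset.erase_ssubset hs) hlow hsub
    have hins : insert s (S.erase s) = S := Finset.insert_erase hs
    obtain ⟨φ', rfl⟩ := hA (S.erase s) s (hsub h0) hlow (by rwa [hins]) (by simp) φ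
    refine ⟨(proj hins.ge).comp φ', ?_⟩
    rw [← hφ, ← AlgHom.comp_assoc, ← AlgHom.comp_assoc, proj_comp_proj, proj_comp_proj]

end LiftsTrunc

section FirstOrder

open TruncAlg

variable {k : Type*} [CommRing k] {A : Type*} [CommRing A] [Algebra k A] {σ : Type*} [Finite σ]
  {ε : A →ₐ[k] k}

/-- The linear part of `firstOrderHom`. -/
def firstOrderLinear (b : Module.Basis σ k (RingHom.ker ε).Cotangent) :
    A →ₗ[k] TruncAlg k (degLT σ 2) :=
  (b.constr k fun i => mono k (degLT σ 2) (.single i 1)).comp (toCotangent ε)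

theorem aug_firstOrderLinear (b : Module.Basis σ k (RingHom.ker ε).Cotangent) (a : A) :
    aug (zero_mem_degLT two_pos) (firstOrderLinear b a) = 0 := by
  have hcomp : (aug (zero_mem_degLT two_pos)).toLinearMap ∘ₗ
      b.constr k (fun i => mono k (degLT σ 2) (.single i 1)) = 0 :=
    b.ext fun i => by simp [aug_mono]
  exact LinearMap.congr_fun hcomp (toCotangent ε a)

/-- The homomorphism sending `a` to `ε a` plus the linear form with the coordinates of its class in
the cotangent space. -/
def firstOrderHom (b : Module.Basis σ k (RingHom.ker ε).Cotangent) :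
    A →ₐ[k] TruncAlg k (degLT σ 2) :=
  AlgHom.ofLinearMap
    ((Algebra.linearMap k (TruncAlg k (degLT σ 2))).comp ε.toLinearMap + firstOrderLinear b)
    (by
      have h1 : toCotangent ε 1 = 0 := by simpa using toCotangent_algebraMap ε 1
      simp [firstOrderLinear, h1])
    (by
      intro x y
      have hxy : firstOrderLinear b x * firstOrderLinear b y = 0 := by
        have hmem := Ideal.mul_mem_mul (RingHom.mem_ker.2 (aug_firstOrderLinear b x))
          (RingHom.mem_ker.2 (aug_firstOrderLinear b y))
        rwa [← pow_two, ker_aug_pow_eq_bot _ fun s hs => mem_degLT.1 hs] at hmem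
      have hmul : firstOrderLinear b (x * y) =
          ε x • firstOrderLinear b y + ε y • firstOrderLinear b x := by
        simp only [firstOrderLinear, LinearMap.comp_apply, toCotangent_mul, map_add, map_smul]
      simp only [LinearMap.add_apply, LinearMap.comp_apply, AlgHom.toLinearMap_apply, map_mul, hmul,
        Algebra.linearMap_apply]
      rw [add_mul, mul_add, mul_add, hxy, Algebra.smul_def, Algebra.smul_def]
      ring)

theorem firstOrderHom_apply (b : Module.Basis σ k (RingHom.ker ε).Cotangent) (a : A) :
    firstOrderHom b a = algebraMap k _ (ε a) + firstOrderLinear b a := rfl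

theorem aug_firstOrderHom (b : Module.Basis σ k (RingHom.ker ε).Cotangent) (a : A) :
    aug (zero_mem_degLT two_pos) (firstOrderHom b a) = ε a := by
  rw [firstOrderHom_apply, map_add, aug_firstOrderLinear, add_zero, AlgHom.commutes]
  rfl

theorem firstOrderHom_surjective (b : Module.Basis σ k (RingHom.ker ε).Cotangent) :
    Function.Surjective (firstOrderHom b) := by
  obtain ⟨y, hy, hyb, -⟩ := exists_cotangent_generators b
  rw [← AlgHom.range_eq_top, eq_top_iff, ← adjoin_range_mono_single_eq_top, Algebra.adjoin_le_iff]
  rintro _ ⟨i, rfl⟩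
  exact ⟨y i, by simp [firstOrderHom_apply, firstOrderLinear, hy, hyb]⟩

theorem surjective_of_proj_comp_surjective {S : Finset (σ →₀ ℕ)} {t : ℕ} (ht : 2 ≤ t)
    (h : degLT σ t ⊆ S) {φ : A →ₐ[k] TruncAlg k S}
    (hφ : Function.Surjective ((proj h).comp φ)) : Function.Surjective φ := by
  have h0 : (0 : σ →₀ ℕ) ∈ S := h (zero_mem_degLT (two_pos.trans_le ht))
  have hker := (ker_proj_degLT_le (k := k) (two_pos.trans_le ht) h).trans
    (Ideal.pow_le_pow_right ht)
  have approx (x : TruncAlg k S) : ∃ a, x - φ a ∈ RingHom.ker (aug (k := k) h0) ^ 2 := by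
    obtain ⟨a, ha⟩ := hφ (proj h x)
    exact ⟨a, hker (by rw [RingHom.mem_ker, map_sub, ← ha, AlgHom.comp_apply, sub_self])⟩
  rw [← AlgHom.range_eq_top]
  refine subalgebra_eq_top_of_isNilpotent _ (isNilpotent_ker_aug h0) (fun x => ?_) fun x hx => ?_
  · obtain ⟨a, ha⟩ := approx x
    exact ⟨φ a, ⟨a, rfl⟩, Ideal.pow_le_self two_ne_zero ha⟩
  · obtain ⟨a, ha⟩ := approx x
    have hφa : φ a ∈ RingHom.ker (aug (k := k) h0) := by
      simpa using sub_mem hx (Ideal.pow_le_self two_ne_zero ha)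
    rw [← add_sub_cancel (φ a) x]
    have hspan :
        φ a ∈ Ideal.span ((φ.range : Set (TruncAlg k S)) ∩ RingHom.ker (aug (k := k) h0)) :=
      Ideal.subset_span ⟨⟨a, rfl⟩, hφa⟩
    exact add_mem (Ideal.mem_sup_left hspan) (Ideal.mem_sup_right ha)

theorem LiftsTrunc.exists_surjective [DecidableEq σ] (hA : LiftsTrunc k A σ)
    (b : Module.Basis σ k (RingHom.ker ε).Cotangent) {S : Finset (σ →₀ ℕ)}
    (hS : IsLowerSet (S : Set (σ →₀ ℕ))) (h0 : 0 ∈ S) :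
    ∃ φ : A →ₐ[k] TruncAlg k S, Function.Surjective φ ∧ ∀ a, aug h0 (φ a) = ε a := by
  have hU : IsLowerSet ((S ∪ degLT σ 2 : Finset (σ →₀ ℕ)) : Set (σ →₀ ℕ)) := by
    rw [Finset.coe_union]; exact hS.union (isLowerSet_degLT 2)
  have hSU : S ⊆ S ∪ degLT σ 2 := Finset.subset_union_left
  have hdU : degLT σ 2 ⊆ S ∪ degLT σ 2 := Finset.subset_union_right
  obtain ⟨φ, hφ⟩ := hA.exists_lift (isLowerSet_degLT 2) (zero_mem_degLT two_pos)
    (firstOrderHom b) hU hdU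
  have hsurj : Function.Surjective φ :=
    surjective_of_proj_comp_surjective le_rfl hdU (hφ ▸ firstOrderHom_surjective b)
  refine ⟨(proj hSU).comp φ, (proj_surjective hSU).comp hsurj, fun a => ?_⟩
  rw [AlgHom.comp_apply, aug_proj, ← aug_proj (zero_mem_degLT two_pos) hdU,
    ← AlgHom.comp_apply (proj hdU), hφ, aug_firstOrderHom]

end FirstOrder

section CommutingMatrices

open Matrix

section MatrixAlgebra

variable {R T m : Type*} [CommRing R] [CommRing T] [Fintype m] [DecidableEq m]

theorem mem_adjoin_image_mapMatrix_iff {f : R →+* T} (hf : Function.Surjective f)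
    {s : Set (Matrix m m R)} {M : Matrix m m T} :
    M ∈ Algebra.adjoin T (f.mapMatrix '' s) ↔ ∃ N ∈ Algebra.adjoin R s, f.mapMatrix N = M := by
  refine mem_adjoin_image_iff hf fun r => ?_
  ext i j
  simp [Matrix.algebraMap_matrix_apply, apply_ite f]

omit [DecidableEq m] in
theorem exists_eq_trace_mul (f : Matrix m m R →ₗ[R] R) :
    ∃ Z : Matrix m m R, ∀ M, f M = (Z * M).trace := by
  classical
  refine ⟨Matrix.of fun i j => f (Matrix.single j i 1), fun M => ?_⟩
  conv_lhs => rw [Matrix.matrix_eq_sum_single M]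
  simp only [map_sum, Matrix.trace, Matrix.diag_apply, Matrix.mul_apply, Matrix.of_apply]
  rw [Finset.sum_comm]
  refine Finset.sum_congr rfl fun i _ => Finset.sum_congr rfl fun j _ => ?_
  have hsingle : Matrix.single j i (M j i) = M j i • Matrix.single j i 1 := by
    rw [Matrix.smul_single, smul_eq_mul, mul_one]
  rw [hsingle, map_smul, smul_eq_mul, mul_comm]

/-- A cyclic vector `v` of an algebra `S` of matrices: `v` generates the column vectors as an
`S`-module. -/
def IsCyclicVector (S : Subalgebra R (Matrix m m R)) (v : m → R) : Prop :=
  ∀ w, ∃ M ∈ S, M *ᵥ v = w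

namespace IsCyclicVector

variable {S : Subalgebra R (Matrix m m R)} {v : m → R}

theorem eq_of_mulVec_eq (hv : IsCyclicVector S v) {M N : Matrix m m R}
    (hM : M ∈ Subalgebra.centralizer R (S : Set (Matrix m m R)))
    (hN : N ∈ Subalgebra.centralizer R (S : Set (Matrix m m R))) (h : M *ᵥ v = N *ᵥ v) :
    M = N := by
  refine Matrix.mulVec_injective (funext fun w => ?_)
  obtain ⟨B, hB, rfl⟩ := hv w
  rw [Matrix.mulVec_mulVec, Matrix.mulVec_mulVec, ← Subalgebra.mem_centralizer_iff R |>.1 hM B hB,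
    ← Subalgebra.mem_centralizer_iff R |>.1 hN B hB, ← Matrix.mulVec_mulVec,
    ← Matrix.mulVec_mulVec, h]

theorem centralizer_le (hv : IsCyclicVector S v)
    (hS : S ≤ Subalgebra.centralizer R (S : Set (Matrix m m R))) :
    Subalgebra.centralizer R (S : Set (Matrix m m R)) ≤ S := by
  intro Z hZ
  obtain ⟨M, hM, hMv⟩ := hv (Z *ᵥ v)
  exact hv.eq_of_mulVec_eq (hS hM) hZ hMv ▸ hM

/-- The evaluation `M ↦ M v` of a commutative algebra of matrices at a cyclic vector. -/
def evalEquiv (hv : IsCyclicVector S v)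
    (hS : S ≤ Subalgebra.centralizer R (S : Set (Matrix m m R))) : S ≃ₗ[R] (m → R) :=
  LinearEquiv.ofBijective (((Matrix.mulVecBilin R R).flip v).comp S.val.toLinearMap)
    ⟨fun M N h => Subtype.ext (hv.eq_of_mulVec_eq (hS M.2) (hS N.2) h),
      fun w => let ⟨M, hM, h⟩ := hv w; ⟨⟨M, hM⟩, h⟩⟩

theorem evalEquiv_apply (hv : IsCyclicVector S v)
    (hS : S ≤ Subalgebra.centralizer R (S : Set (Matrix m m R))) (M : S) :
    hv.evalEquiv hS M = (M : Matrix m m R) *ᵥ v := rfl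

theorem map {s : Set (Matrix m m R)} (hv : IsCyclicVector (Algebra.adjoin R s) v) {f : R →+* T}
    (hf : Function.Surjective f) :
    IsCyclicVector (Algebra.adjoin T (f.mapMatrix '' s)) (f ∘ v) := by
  intro w
  choose g hg using hf
  obtain ⟨M, hM, hMv⟩ := hv (g ∘ w)
  refine ⟨f.mapMatrix M, (mem_adjoin_image_mapMatrix_iff fun t => ⟨g t, hg t⟩).2 ⟨M, hM, rfl⟩, ?_⟩
  ext i
  rw [RingHom.mapMatrix_apply, ← RingHom.map_mulVec, hMv, Function.comp_apply, hg]

theorem of_map {s : Set (Matrix m m R)} {f : R →+* T} (hf : Function.Surjective f)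
    (hker : RingHom.ker f ≤ Ideal.jacobson ⊥)
    (hv : IsCyclicVector (Algebra.adjoin T (f.mapMatrix '' s)) (f ∘ v)) :
    IsCyclicVector (Algebra.adjoin R s) v := by
  let N : Submodule R (m → R) :=
    (Subalgebra.toSubmodule (Algebra.adjoin R s)).map ((Matrix.mulVecBilin R R).flip v)
  suffices h : ⊤ ≤ N from fun w => h (Submodule.mem_top : w ∈ ⊤)
  refine Submodule.le_of_le_smul_of_le_jacobson_bot Module.Finite.fg_top hker fun w _ => ?_
  obtain ⟨_, hfM, hMv⟩ := hv (f ∘ w)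
  obtain ⟨M, hM, rfl⟩ := (mem_adjoin_image_mapMatrix_iff hf).1 hfM
  have hdiff : w - M *ᵥ v ∈ RingHom.ker f • (⊤ : Submodule R (m → R)) := by
    rw [pi_eq_sum_univ' (w - M *ᵥ v)]
    refine sum_mem fun i _ => Submodule.smul_mem_smul ?_ trivial
    rw [RingHom.mem_ker, Pi.sub_apply, map_sub, RingHom.map_mulVec, sub_eq_zero]
    exact (congrFun hMv i).symm
  rw [← add_sub_cancel (M *ᵥ v) w]
  exact Submodule.add_mem_sup ⟨M, hM, rfl⟩ hdiff

end IsCyclicVector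

theorem adjoin_image_leftMulMatrix {C : Type*} [CommRing C] [Algebra R C] (b : Module.Basis m R C)
    {s : Set C} (hs : Algebra.adjoin R s = ⊤) :
    Algebra.adjoin R (Algebra.leftMulMatrix b '' s) = (Algebra.leftMulMatrix b).range := by
  rw [← AlgHom.map_adjoin, hs, Algebra.map_top]

theorem isCyclicVector_range_leftMulMatrix {C : Type*} [CommRing C] [Algebra R C]
    (b : Module.Basis m R C) :
    IsCyclicVector (Algebra.leftMulMatrix b).range (b.equivFun 1) := fun w =>
  ⟨_, ⟨b.equivFun.symm w, rfl⟩, (Algebra.leftMulMatrix_mulVec_repr b _ 1).trans <| by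
    rw [mul_one, ← Module.Basis.equivFun_apply, LinearEquiv.apply_symm_apply]⟩

theorem exists_ringHom_leftMulMatrix_eq {C : Type*} [CommRing C] [Algebra T C]
    (b : Module.Basis m T C) {f : R →+* T} {S : Subalgebra R (Matrix m m R)}
    (hS : ∀ M ∈ S, f.mapMatrix M ∈ (Algebra.leftMulMatrix b).range) :
    ∃ p : S →+* C, ∀ M : S, Algebra.leftMulMatrix b (p M) = f.mapMatrix (M : Matrix m m R) := by
  let e := AlgEquiv.ofInjective _ (Algebra.leftMulMatrix_injective b)
  let q : S →+* (Algebra.leftMulMatrix b).range :=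
    (f.mapMatrix.comp (S.val : S →+* Matrix m m R)).codRestrict _ fun M => hS M M.2
  exact ⟨(e.symm : _ →+* C).comp q, fun M => congrArg Subtype.val (e.apply_symm_apply (q M))⟩

theorem adjoin_pair_le_span_pow_mul_pow {A : Type*} [Ring A] [Algebra R A] {x y : A}
    (h : Commute x y) : Subalgebra.toSubmodule (Algebra.adjoin R {x, y}) ≤
      Submodule.span R (Set.range fun n : ℕ × ℕ => x ^ n.1 * y ^ n.2) := by
  rw [Algebra.adjoin_eq_span]
  refine Submodule.span_mono fun M hM => ?_
  induction hM using Submonoid.closure_induction with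
  | mem z hz =>
    rcases hz with rfl | rfl
    · exact ⟨(1, 0), by simp⟩
    · exact ⟨(0, 1), by simp⟩
  | one => exact ⟨0, by simp⟩
  | mul _ _ _ _ hx hy =>
    obtain ⟨⟨a, b⟩, rfl⟩ := hx
    obtain ⟨⟨a', b'⟩, rfl⟩ := hy
    exact ⟨(a + a', b + b'), by simp [pow_add, (h.symm.pow_pow b a').mul_mul_mul_comm]⟩

theorem adjoin_pair_le_centralizer {A : Type*} [Ring A] [Algebra R A] {x y : A}
    (h : Commute x y) : Algebra.adjoin R {x, y} ≤
      Subalgebra.centralizer R (Algebra.adjoin R {x, y} : Set A) := by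
  have := Algebra.isMulCommutative_adjoin R (s := {x, y}) (by
    rintro _ (rfl | rfl) _ (rfl | rfl)
    exacts [rfl, h.eq, h.eq.symm, rfl])
  exact fun a ha b hb => setLike_mul_comm hb ha

omit [DecidableEq m] in
theorem trace_mul_commutator (Z A Y : Matrix m m R) :
    (Z * (A * Y - Y * A)).trace = ((Y * Z - Z * Y) * A).trace := by
  simp only [mul_sub, sub_mul, Matrix.trace_sub, mul_assoc, Matrix.trace_mul_comm Y]

end MatrixAlgebra

/-- The map `(A, B) ↦ [A, y] + [x, B]` has image orthogonal, for the trace form, to the commutant of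
`{x, y}`; a cyclic vector makes that commutant equal to the algebra generated by `x` and `y`. -/
theorem exists_commutator_add_commutator_eq {k m : Type*} [Field k] [Fintype m] [DecidableEq m]
    {x y c : Matrix m m k} (hxy : Commute x y) {v : m → k}
    (hv : IsCyclicVector (Algebra.adjoin k {x, y}) v)
    (hc : ∀ M ∈ Algebra.adjoin k {x, y}, (M * c).trace = 0) :
    ∃ A B : Matrix m m k, (A * y - y * A) + (x * B - B * x) = c := by
  let L : Matrix m m k × Matrix m m k →ₗ[k] Matrix m m k :=
    (LinearMap.mulRight k y - LinearMap.mulLeft k y).coprod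
      (LinearMap.mulLeft k x - LinearMap.mulRight k x)
  suffices h : c ∈ LinearMap.range L from let ⟨⟨A, B⟩, h⟩ := h; ⟨A, B, h⟩
  by_contra hcL
  obtain ⟨f, hfc, hf⟩ := Submodule.exists_le_ker_of_notMem hcL
  obtain ⟨Z, hZ⟩ := exists_eq_trace_mul f
  have hL (A B : Matrix m m k) : (Z * ((A * y - y * A) + (x * B - B * x))).trace = 0 :=
    (hZ _).symm.trans (hf ⟨(A, B), rfl⟩)
  have hZy : y * Z = Z * y := sub_eq_zero.1 <| Matrix.ext_iff_trace_mul_right.2 fun A => by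
    simpa [trace_mul_commutator] using hL A 0
  have hZx : x * Z = Z * x := sub_eq_zero.1 <| Matrix.ext_iff_trace_mul_right.2 fun B => by
    rw [← trace_mul_commutator, ← neg_sub, mul_neg, Matrix.trace_neg, zero_mul, Matrix.trace_zero]
    simpa using hL 0 B
  have hZmem : Z ∈ Algebra.adjoin k {x, y} := by
    have hZ' : Z ∈ Subalgebra.centralizer k {x, y} := by
      rintro _ (rfl | rfl)
      exacts [hZx, hZy]
    exact hv.centralizer_le (adjoin_pair_le_centralizer hxy) fun M hM =>
      (Algebra.adjoin_le_centralizer_centralizer k _ hM Z hZ').symm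
  exact hfc (by rw [hZ, hc Z hZmem])

end CommutingMatrices

section SmallExtensions

open Matrix

/-- A small extension `R' → R` of augmented `k`-algebras: the kernel is spanned over `k` by an
element `e` that is killed by the augmentation ideal. -/
structure SmallExtension (k : Type*) [Field k] (R' R : Type*) [CommRing R'] [CommRing R]
    [Algebra k R'] [Algebra k R] where
  π : R' →ₐ[k] R
  surjective : Function.Surjective π
  ε : R →ₐ[k] k
  e : R'
  π_e : π e = 0
  exists_smul : ∀ a, π a = 0 → ∃ c : k, a = c • e
  mul_e : ∀ a, ε (π a) = 0 → a * e = 0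

namespace SmallExtension

variable {k R' R : Type*} [Field k] [CommRing R'] [CommRing R] [Algebra k R'] [Algebra k R]

/-- The augmentation of the larger algebra `R'` of a small extension. -/
def aug (E : SmallExtension k R' R) : R' →ₐ[k] k := E.ε.comp E.π

variable (E : SmallExtension k R' R)

theorem aug_e : E.aug E.e = 0 := by rw [aug, AlgHom.comp_apply, E.π_e, map_zero]

theorem mul_e_eq_aug_smul (a : R') : a * E.e = E.aug a • E.e := by
  have h := E.mul_e (a - algebraMap k R' (E.aug a)) (by simp [aug])
  rwa [sub_mul, sub_eq_zero, ← Algebra.smul_def] at h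

theorem ker_le_nilradical : RingHom.ker (E.π : R' →+* R) ≤ nilradical R' := by
  intro a ha
  obtain ⟨c, rfl⟩ := E.exists_smul a ha
  refine mem_nilradical.2 ⟨2, ?_⟩
  rw [smul_pow, pow_two E.e, E.mul_e_eq_aug_smul, E.aug_e, zero_smul, smul_zero]

theorem ker_le_jacobson_bot : RingHom.ker (E.π : R' →+* R) ≤ Ideal.jacobson ⊥ := by
  rw [Ideal.jacobson_bot]
  exact E.ker_le_nilradical.trans (nilradical_le_jacobson R')

section Matrix

variable {m : Type*}

/-- The embedding `c ↦ c ⊗ e` of matrices over `k` into matrices over `R'`, whose image is the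
kernel of reduction to `R`. -/
def incl (m : Type*) : Matrix m m k →ₗ[k] Matrix m m R' :=
  (LinearMap.toSpanSingleton k R' E.e).mapMatrix

theorem incl_apply (c : Matrix m m k) (i j : m) : E.incl m c i j = c i j • E.e := rfl

theorem map_incl (c : Matrix m m k) : (E.incl m c).map E.π = 0 := by
  ext; simp [incl_apply, E.π_e]

theorem exists_eq_incl {M : Matrix m m R'} (hM : M.map E.π = 0) : ∃ c, M = E.incl m c := by
  choose c hc using fun i j => E.exists_smul (M i j) (congrFun (congrFun hM i) j)
  exact ⟨Matrix.of c, Matrix.ext hc⟩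

theorem trace_incl [Fintype m] (c : Matrix m m k) : (E.incl m c).trace = c.trace • E.e := by
  simp [Matrix.trace, incl_apply, Finset.sum_smul]

variable [Fintype m] [DecidableEq m]

theorem mul_incl (M : Matrix m m R') (c : Matrix m m k) :
    M * E.incl m c = E.incl m (E.aug.mapMatrix M * c) := by
  ext i j
  simp [Matrix.mul_apply, incl_apply, Finset.sum_smul, E.mul_e_eq_aug_smul, smul_smul, mul_comm]

theorem incl_mul (c : Matrix m m k) (M : Matrix m m R') :
    E.incl m c * M = E.incl m (c * E.aug.mapMatrix M) := by
  ext i j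
  simp [Matrix.mul_apply, incl_apply, Finset.sum_smul, mul_comm E.e, E.mul_e_eq_aug_smul,
    smul_smul]

omit [DecidableEq m] in
theorem incl_mul_incl (c d : Matrix m m k) : E.incl m c * E.incl m d = 0 := by
  classical
  have h : E.aug.mapMatrix (E.incl m c) = 0 := by ext; simp [incl_apply, E.aug_e]
  rw [mul_incl, h, zero_mul, map_zero]

variable {E}

theorem trace_mul_commutator_pow {X Y : Matrix m m R'} {c : Matrix m m k}
    (hc : X * Y - Y * X = E.incl m c) (n : ℕ) {M : Matrix m m R'}
    (hM : Commute (E.aug.mapMatrix M) (E.aug.mapMatrix Y)) :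
    (M * (X * Y ^ (n + 1) - Y ^ (n + 1) * X)).trace =
      ((n + 1) * (E.aug.mapMatrix M * E.aug.mapMatrix Y ^ n * c).trace) • E.e := by
  induction n generalizing M with
  | zero => simp [hc, mul_incl, trace_incl]
  | succ n ih =>
    have hsplit : M * (X * Y ^ (n + 1 + 1) - Y ^ (n + 1 + 1) * X) =
        M * (X * Y - Y * X) * Y ^ (n + 1) + (M * Y) * (X * Y ^ (n + 1) - Y ^ (n + 1) * X) := by
      rw [pow_succ' Y (n + 1)]
      noncomm_ring
    have hcycle : (E.aug.mapMatrix M * c * E.aug.mapMatrix Y ^ (n + 1)).trace =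
        (E.aug.mapMatrix M * E.aug.mapMatrix Y ^ (n + 1) * c).trace := by
      rw [Matrix.trace_mul_comm, ← mul_assoc, (hM.pow_right (n + 1)).eq]
    rw [hsplit, Matrix.trace_add, ih (by rw [map_mul]; exact hM.mul_left rfl), hc, mul_incl,
      incl_mul, trace_incl, map_pow, hcycle, map_mul,
      mul_assoc (E.aug.mapMatrix M) (E.aug.mapMatrix Y), ← pow_succ', ← add_smul]
    congr 1
    push_cast
    ring

/-- Since `tr (X ^ i [X, Y ^ (j + 1)]) = 0`, the trace against each monomial vanishes up to the
factor `j + 1`, which is where characteristic zero enters. -/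
theorem trace_mul_eq_zero_of_commutator_eq_incl [CharZero k] (he : E.e ≠ 0) {X Y : Matrix m m R'}
    {c : Matrix m m k} (hc : X * Y - Y * X = E.incl m c)
    (hXY : Commute (E.aug.mapMatrix X) (E.aug.mapMatrix Y)) {M : Matrix m m k}
    (hM : M ∈ Algebra.adjoin k {E.aug.mapMatrix X, E.aug.mapMatrix Y}) : (M * c).trace = 0 := by
  have hmono (i j : ℕ) : (E.aug.mapMatrix X ^ i * E.aug.mapMatrix Y ^ j * c).trace = 0 := by
    have hzero : (X ^ i * (X * Y ^ (j + 1) - Y ^ (j + 1) * X)).trace = 0 := by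
      rw [mul_sub, Matrix.trace_sub, ← mul_assoc, ← mul_assoc, Matrix.trace_mul_comm _ X,
        ← mul_assoc, ← pow_succ, ← pow_succ', sub_self]
    rw [trace_mul_commutator_pow hc j (by rw [map_pow]; exact hXY.pow_left i), map_pow] at hzero
    exact (mul_eq_zero.1 ((smul_eq_zero.1 hzero).resolve_right he)).resolve_left
      (Nat.cast_add_one_ne_zero j)
  replace hM := adjoin_pair_le_span_pow_mul_pow hXY hM
  induction hM using Submodule.span_induction with
  | mem _ h => obtain ⟨n, rfl⟩ := h; exact hmono n.1 n.2
  | zero => rw [zero_mul, Matrix.trace_zero]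
  | add A B _ _ hA hB => rw [add_mul, Matrix.trace_add, hA, hB, add_zero]
  | smul a A _ hA => rw [Matrix.smul_mul, Matrix.trace_smul, hA, smul_zero]

variable (E)

theorem exists_commute_lift [CharZero k] {X Y : Matrix m m R} (hXY : Commute X Y) {v : m → k}
    (hv : IsCyclicVector (Algebra.adjoin k {E.ε.mapMatrix X, E.ε.mapMatrix Y}) v) :
    ∃ X' Y' : Matrix m m R', Commute X' Y' ∧ E.π.mapMatrix X' = X ∧ E.π.mapMatrix Y' = Y := by
  have hsurj (M : Matrix m m R) : ∃ M' : Matrix m m R', E.π.mapMatrix M' = M := by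
    choose s hs using E.surjective
    exact ⟨M.map s, by ext; simp [hs]⟩
  obtain ⟨X, rfl⟩ := hsurj X
  obtain ⟨Y, rfl⟩ := hsurj Y
  obtain ⟨c, hc⟩ := E.exists_eq_incl (M := X * Y - Y * X) (by
    rw [← AlgHom.mapMatrix_apply, map_sub, map_mul, map_mul, hXY.eq, sub_self])
  rcases eq_or_ne E.e 0 with he | he
  · refine ⟨X, Y, sub_eq_zero.1 (hc.trans ?_), rfl, rfl⟩
    ext; simp [incl_apply, he]
  have hxy : Commute (E.aug.mapMatrix X) (E.aug.mapMatrix Y) := hXY.map E.ε.mapMatrix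
  obtain ⟨A, B, hAB⟩ := exists_commutator_add_commutator_eq (c := -c) hxy hv fun M hM => by
    rw [mul_neg, Matrix.trace_neg, trace_mul_eq_zero_of_commutator_eq_incl he hc hxy hM, neg_zero]
  have hmap (M : Matrix m m R') (c : Matrix m m k) :
      E.π.mapMatrix (M + E.incl m c) = E.π.mapMatrix M := by
    rw [map_add, AlgHom.mapMatrix_apply _ (E.incl m c), map_incl, add_zero]
  refine ⟨X + E.incl m A, Y + E.incl m B, sub_eq_zero.1 ?_, hmap X A, hmap Y B⟩
  calc _ = (X * Y - Y * X) + ((E.incl m A * Y - Y * E.incl m A) +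
          (X * E.incl m B - E.incl m B * X)) +
          (E.incl m A * E.incl m B - E.incl m B * E.incl m A) := by noncomm_ring
    _ = 0 := by
      rw [incl_mul_incl, incl_mul_incl, sub_zero, add_zero, mul_incl, mul_incl, incl_mul, incl_mul,
        ← map_sub, ← map_sub, ← map_add, hAB, hc, map_neg, add_neg_cancel]

end Matrix

section Algebra

variable {R' R C : Type u} [CommRing R'] [CommRing R] [CommRing C] [Algebra R C]

variable {k : Type*} [Field k] [Algebra k R'] [Algebra k R] (E : SmallExtension k R' R)

theorem exists_eq_e_smul {m : Type*} [Fintype m] [DecidableEq m]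
    {S : Subalgebra R' (Matrix m m R')} {v : m → R'} (hv : IsCyclicVector S v)
    (hS : S ≤ Subalgebra.centralizer R' (S : Set (Matrix m m R'))) {M : S}
    (hM : E.π.mapMatrix (M : Matrix m m R') = 0) : ∃ N : S, M = E.e • N := by
  obtain ⟨c, hc⟩ := E.exists_eq_incl hM
  obtain ⟨N, hN⟩ := (hv.evalEquiv hS).surjective (c.map (algebraMap k R') *ᵥ v)
  refine ⟨N, (hv.evalEquiv hS).injective ?_⟩
  rw [map_smul, hN, IsCyclicVector.evalEquiv_apply, hc, ← Matrix.smul_mulVec]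
  congr 1
  ext i j
  simp [incl_apply, Algebra.smul_def, mul_comm]

/-- Multiplication by `x` and by `y` are commuting matrices over `R` with the coordinates of `1` as
a cyclic vector. -/
theorem exists_commute_lift_leftMulMatrix [CharZero k] {m : Type*} [Fintype m] [DecidableEq m]
    (b : Module.Basis m R C) {x y : C} (hxy : Algebra.adjoin R {x, y} = ⊤) :
    ∃ (X Y : Matrix m m R') (v : m → R'), Commute X Y ∧
      IsCyclicVector (Algebra.adjoin R' {X, Y}) v ∧
      Algebra.adjoin R ((E.π : R' →+* R).mapMatrix '' {X, Y}) =
        (Algebra.leftMulMatrix b).range := by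
  have hgen := adjoin_image_leftMulMatrix b hxy
  have hcyc := isCyclicVector_range_leftMulMatrix b
  rw [← hgen] at hcyc
  obtain ⟨X, Y, hXY, hX, hY⟩ := E.exists_commute_lift
    ((Commute.all x y).map (Algebra.leftMulMatrix b)) (v := E.ε ∘ b.equivFun 1) (by
      have h := hcyc.map (f := (E.ε : R →+* k)) fun c => ⟨algebraMap k R c, E.ε.commutes c⟩
      rwa [Set.image_pair, Set.image_pair] at h)
  obtain ⟨v, hv⟩ := E.surjective.comp_left (b.equivFun 1)
  have himage : Algebra.leftMulMatrix b '' {x, y} = (E.π : R' →+* R).mapMatrix '' {X, Y} := by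
    rw [Set.image_pair, Set.image_pair, ← hX, ← hY]; rfl
  rw [himage, ← hv] at hcyc
  exact ⟨X, Y, v, hXY, .of_map E.surjective E.ker_le_jacobson_bot hcyc, himage ▸ hgen⟩

/-- `C'` is a finite free deformation over `R'` of the `R`-algebra `C`, with reduction map `p`. -/
structure IsDeformation {C C' : Type*} [CommRing C] [CommRing C'] [Algebra R C] [Algebra R' C']
    (p : C' →+* C) : Prop where
  free : Module.Free R' C'
  finite : Module.Finite R' C'
  surjective : Function.Surjective p
  map_algebraMap : ∀ r, p (algebraMap R' C' r) = algebraMap R C (E.π r)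
  exists_eq_mul : ∀ z, p z = 0 → ∃ w, z = algebraMap R' C' E.e * w

open scoped IsMulCommutative in
theorem exists_isDeformation [CharZero k] [Module.Free R C] [Module.Finite R C] {x y : C}
    (hxy : Algebra.adjoin R {x, y} = ⊤) :
    ∃ (C' : Type u) (_ : CommRing C') (_ : Algebra R' C') (p : C' →+* C), E.IsDeformation p := by
  classical
  let b := Module.Free.chooseBasis R C
  obtain ⟨X, Y, v, hXY, hv, hgen⟩ := E.exists_commute_lift_leftMulMatrix b hxy
  let S := Algebra.adjoin R' {X, Y}
  have hcomm : S ≤ Subalgebra.centralizer R' (S : Set _) := adjoin_pair_le_centralizer hXY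
  have : IsMulCommutative S := .of_setLike_mul_comm fun _ hM _ hN => hcomm hN _ hM
  have hrange (M) : M ∈ (Algebra.leftMulMatrix b).range ↔
      ∃ N ∈ S, (E.π : R' →+* R).mapMatrix N = M := by
    rw [← hgen]
    exact mem_adjoin_image_mapMatrix_iff (f := (E.π : R' →+* R)) E.surjective
  obtain ⟨p, hp⟩ := exists_ringHom_leftMulMatrix_eq b fun M hM => (hrange _).2 ⟨M, hM, rfl⟩
  refine ⟨S, inferInstance, inferInstance, p, .of_equiv (hv.evalEquiv hcomm).symm,
    .equiv (hv.evalEquiv hcomm).symm, fun z => ?_, fun r => ?_, fun M hM => ?_⟩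
  · obtain ⟨N, hN, hNz⟩ := (hrange _).1 ⟨z, rfl⟩
    exact ⟨⟨N, hN⟩, Algebra.leftMulMatrix_injective b ((hp _).trans hNz)⟩
  · refine Algebra.leftMulMatrix_injective b ?_
    rw [hp, AlgHom.commutes]
    ext i j
    simp [Matrix.algebraMap_matrix_apply, apply_ite E.π]
  · obtain ⟨N, hN⟩ := E.exists_eq_e_smul hv hcomm ((hp M).symm.trans (by rw [hM, map_zero]))
    exact ⟨N, hN.trans (Algebra.smul_def _ _)⟩

namespace IsDeformation

variable {E} {C C' : Type*} [CommRing C] [CommRing C'] [Algebra R C] [Algebra R' C'] {p : C' →+* C}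
  (hp : E.IsDeformation p)

include hp

theorem ker_sq_eq_bot : RingHom.ker p ^ 2 = ⊥ := by
  rw [pow_two, eq_bot_iff, Ideal.mul_le]
  intro a ha b hb
  obtain ⟨v, rfl⟩ := hp.exists_eq_mul a ha
  obtain ⟨w, rfl⟩ := hp.exists_eq_mul b hb
  rw [Ideal.mem_bot, mul_mul_mul_comm, ← map_mul, E.mul_e _ (by simp [E.π_e]), map_zero, zero_mul]

theorem ker_le_nilradical : RingHom.ker p ≤ nilradical C' := fun a ha =>
  ⟨2, by simpa [hp.ker_sq_eq_bot] using Ideal.pow_mem_pow ha 2⟩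

theorem map_algebraMap_e : p (algebraMap R' C' E.e) = 0 := by
  rw [hp.map_algebraMap, E.π_e, map_zero]

theorem adjoin_eq_top {s : Set C'} (hs : Algebra.adjoin R (p '' s) = ⊤) :
    Algebra.adjoin R' s = ⊤ := by
  refine subalgebra_eq_top_of_isNilpotent _ ⟨2, hp.ker_sq_eq_bot⟩ (fun b => ?_) fun z hz => ?_
  · obtain ⟨a, ha, hab⟩ :=
      (mem_adjoin_image_iff E.surjective hp.map_algebraMap).1 (hs ▸ Algebra.mem_top : p b ∈ _)
    exact ⟨a, ha, by rw [RingHom.mem_ker, map_sub, hab, sub_self]⟩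
  · obtain ⟨w, rfl⟩ := hp.exists_eq_mul z hz
    exact Ideal.mem_sup_left (Ideal.mul_mem_right _ _ (Ideal.subset_span
      ⟨Subalgebra.algebraMap_mem _ _, hp.map_algebraMap_e⟩))

end IsDeformation

theorem isDeformation_of_pi {ι : Type*} [Finite ι] {C : Type*} [CommRing C] [Algebra R C]
    {F F' : ι → Type*} [∀ j, CommRing (F j)] [∀ j, Algebra R (F j)] [∀ j, CommRing (F' j)]
    [∀ j, Algebra R' (F' j)] (e : C ≃ₐ[R] ∀ j, F j) {p : ∀ j, F' j →+* F j}
    (hp : ∀ j, E.IsDeformation (p j)) :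
    E.IsDeformation ((e.symm : (∀ j, F j) →+* C).comp
      (RingHom.pi fun j => (p j).comp (Pi.evalRingHom F' j))) where
  free := have := fun j => (hp j).free; inferInstance
  finite := have := fun j => (hp j).finite; inferInstance
  surjective := e.symm.surjective.comp fun c => by
    choose z hz using fun j => (hp j).surjective (c j)
    exact ⟨z, funext hz⟩
  map_algebraMap r := by
    rw [← e.symm.commutes]
    exact congrArg e.symm (funext fun j => (hp j).map_algebraMap r)
  exists_eq_mul z hz := by
    have hz' := congr_fun ((map_eq_zero_iff e.symm e.symm.injective).1 hz)
    choose w hw using fun j => (hp j).exists_eq_mul (z j) (hz' j)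
    exact ⟨w, funext hw⟩

end Algebra

end SmallExtension

end SmallExtensions

theorem LiftsTrunc.of_formallySmooth (k : Type*) [CommRing k] (A : Type*) [CommRing A] [Algebra k A]
    [Algebra.FormallySmooth k A] (σ : Type*) [DecidableEq σ] : LiftsTrunc k A σ := by
  intro S s h0 _ _ _ φ
  have hn : IsNilpotent (RingHom.ker (TruncAlg.proj (k := k) (Finset.subset_insert s S))) := by
    obtain ⟨n, hn⟩ := TruncAlg.isNilpotent_ker_aug (k := k) (Finset.mem_insert_of_mem (b := s) h0)
    refine ⟨n, eq_bot_iff.2 ((Ideal.pow_right_mono (fun a ha => ?_) n).trans hn.le)⟩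
    rw [RingHom.mem_ker] at ha ⊢
    rw [← TruncAlg.aug_proj h0 (Finset.subset_insert s S), ha, map_zero]
  exact ⟨Algebra.FormallySmooth.liftOfSurjective φ _ (TruncAlg.proj_surjective _) hn,
    Algebra.FormallySmooth.comp_liftOfSurjective _ _ _ _⟩

/-- The projection of truncated polynomial rings that forgets one monomial, as a small
extension. -/
def SmallExtension.trunc (k : Type*) [Field k] {σ : Type*} [DecidableEq σ] {S : Finset (σ →₀ ℕ)}
    {s : σ →₀ ℕ} (h0 : 0 ∈ S) (hS : IsLowerSet (S : Set (σ →₀ ℕ)))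
    (hS' : IsLowerSet ((insert s S : Finset (σ →₀ ℕ)) : Set (σ →₀ ℕ))) (hs : s ∉ S) :
    SmallExtension k (TruncAlg k (insert s S)) (TruncAlg k S) where
  π := TruncAlg.proj (Finset.subset_insert s S)
  surjective := TruncAlg.proj_surjective _
  ε := TruncAlg.aug h0
  e := TruncAlg.mono k _ s
  π_e := by rw [TruncAlg.mono, TruncAlg.proj_mk, ← TruncAlg.mono, TruncAlg.mono_eq_zero hs]
  exists_smul _ ha := TruncAlg.exists_smul_mono_of_proj_eq_zero hS hS' ha
  mul_e a ha := by
    rw [TruncAlg.aug_proj] at ha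
    refine TruncAlg.mul_mono_eq_zero_of_aug_eq_zero _ (fun t ht hst => ?_) ha
    exact (Finset.mem_insert.1 ht).resolve_right fun h => hs (hS hst h)

section Generators

variable {k R C D : Type*} [CommRing k] [CommRing R] [CommRing C] [CommRing D] [Algebra k R]
  [Algebra k C] [Algebra k D] [Algebra R C] [IsScalarTower k R C]

omit [Algebra k R] [IsScalarTower k R C] in
theorem sub_algebraMap_mem_of_mem_adjoin {s : Set C} {J : Ideal C} {ε : C →ₐ[k] k}
    (hs : ∀ c ∈ s, c - algebraMap k C (ε c) ∈ J)
    (hR : ∀ r : R, algebraMap R C r - algebraMap k C (ε (algebraMap R C r)) ∈ J) {c : C}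
    (hc : c ∈ Algebra.adjoin R s) : c - algebraMap k C (ε c) ∈ J := by
  let E : Subring C := RingHom.eqLocus (Ideal.Quotient.mk J)
    ((Ideal.Quotient.mk J).comp ((algebraMap k C).comp (ε : C →+* k)))
  have mem_E (c) : c ∈ E ↔ c - algebraMap k C (ε c) ∈ J := Ideal.Quotient.eq
  rw [← mem_E]
  rw [← Subalgebra.mem_toSubring, Algebra.adjoin_eq_ring_closure] at hc
  refine Subring.closure_le.2 (Set.union_subset ?_ fun c hc => (mem_E c).2 (hs c hc)) hc
  rintro _ ⟨r, rfl⟩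
  exact (mem_E _).2 (hR r)

theorem adjoin_range_comp_eq_top {ι : Type*} {εD : D →ₐ[k] k} {y : ι → D} (hy : ∀ i, εD (y i) = 0)
    (hgen : RingHom.ker εD ≤ Ideal.span (Set.range y) ⊔ RingHom.ker εD ^ 2) (g : D →ₐ[k] C)
    {ε : C →ₐ[k] k} (hε : ∀ d, ε (g d) = εD d) (hn : IsNilpotent (RingHom.ker ε))
    (hg : Algebra.adjoin R (Set.range g) = ⊤) :
    Algebra.adjoin R (Set.range (g ∘ y)) = ⊤ := by
  set S := Algebra.adjoin R (Set.range (g ∘ y))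
  have algebraMap_mem (c : k) : algebraMap k C c ∈ S :=
    IsScalarTower.algebraMap_apply k R C c ▸ S.algebraMap_mem _
  refine subalgebra_eq_top_of_isNilpotent S hn (fun b => ⟨_, algebraMap_mem (ε b), ?_⟩) ?_
  · simp [RingHom.mem_ker]
  set J := Ideal.span ((S : Set C) ∩ RingHom.ker ε) ⊔ RingHom.ker ε ^ 2
  have map_le : Ideal.map g (RingHom.ker εD) ≤ J := by
    refine (Ideal.map_mono hgen).trans ?_
    rw [Ideal.map_sup, Ideal.map_pow, Ideal.map_span]
    refine sup_le_sup (Ideal.span_mono ?_) (Ideal.pow_right_mono ?_ 2)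
    · rintro _ ⟨_, ⟨i, rfl⟩, rfl⟩
      exact ⟨Algebra.subset_adjoin ⟨i, rfl⟩, (hε _).trans (hy i)⟩
    · exact Ideal.map_le_iff_le_comap.2 fun d hd => (hε d).trans hd
  intro b hb
  suffices b - algebraMap k C (ε b) ∈ J by rwa [RingHom.mem_ker.1 hb, map_zero, sub_zero] at this
  refine sub_algebraMap_mem_of_mem_adjoin (R := R) ?_ (fun r => ?_) (hg ▸ Algebra.mem_top)
  · rintro _ ⟨d, rfl⟩
    rw [hε, ← g.commutes, ← map_sub]
    exact map_le (Ideal.mem_map_of_mem g (by simp [RingHom.mem_ker]))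
  · exact Ideal.mem_sup_left (Ideal.subset_span
      ⟨sub_mem (S.algebraMap_mem r) (algebraMap_mem _), by simp [RingHom.mem_ker]⟩)

end Generators

theorem exists_algHom_ker_eq_maximalIdeal (k : Type*) [Field k] [IsAlgClosed k] (C : Type*)
    [CommRing C] [Algebra k C] [Module.Finite k C] [IsLocalRing C] :
    ∃ ε : C →ₐ[k] k, RingHom.ker ε = IsLocalRing.maximalIdeal C ∧
      IsNilpotent (RingHom.ker ε) := by
  have hb : Function.Bijective (algebraMap k (IsLocalRing.ResidueField C)) :=
    IsAlgClosed.algebraMap_bijective_of_isIntegral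
  let e : k ≃ₐ[k] IsLocalRing.ResidueField C := AlgEquiv.ofBijective (Algebra.ofId _ _) hb
  let ε : C →ₐ[k] k := (e.symm : IsLocalRing.ResidueField C →ₐ[k] k).comp
    (IsScalarTower.toAlgHom k C (IsLocalRing.ResidueField C))
  have hker : RingHom.ker ε = IsLocalRing.maximalIdeal C := by
    ext c
    rw [RingHom.mem_ker, ← IsLocalRing.residue_eq_zero_iff]
    exact map_eq_zero_iff e.symm e.symm.injective
  refine ⟨ε, hker, ?_⟩
  have : IsArtinianRing C := IsArtinianRing.of_finite k C
  rw [hker, ← IsLocalRing.jacobson_eq_maximalIdeal ⊥ bot_ne_top]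
  exact IsArtinianRing.isNilpotent_jacobson_bot

theorem exists_smooth_chart {k : Type u} [Field k] {X : Scheme.{u}} (f : X ⟶ Spec (.of k)) (n : ℕ)
    [SmoothOfRelativeDimension n f] (x : X) :
    ∃ (D : Type u) (_ : CommRing D) (_ : Algebra k D) (i : Spec (.of D) ⟶ X),
      IsOpenImmersion i ∧ x ∈ Set.range i ∧
      i ≫ f = Spec.map (CommRingCat.ofHom (algebraMap k D)) ∧
      Algebra.IsStandardSmoothOfRelativeDimension n k D := by
  obtain ⟨U, hU, V, hV, hxV, e, h⟩ :=
    SmoothOfRelativeDimension.exists_isStandardSmoothOfRelativeDimension (n := n) (f := f) x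
  obtain rfl : U = ⊤ := by
    ext y
    simp only [TopologicalSpace.Opens.coe_top, Set.mem_univ, iff_true]
    have hy : y = f x := Subsingleton.elim (α := PrimeSpectrum k) _ _
    exact hy ▸ e hxV
  let φ := (Scheme.ΓSpecIso (.of k)).inv ≫ f.appLE ⊤ V e
  let : Algebra k Γ(X, V) := φ.hom.toAlgebra
  refine ⟨Γ(X, V), inferInstance, inferInstance, hV.fromSpec, inferInstance, ?_, ?_,
    (RingHom.isStandardSmoothOfRelativeDimension_respectsIso (n := n)).2 _
      (Scheme.ΓSpecIso (.of k)).symm.commRingCatIsoToRingEquiv h⟩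
  · rw [hV.range_fromSpec]
    exact hxV
  · change _ = Spec.map φ
    rw [Spec.map_comp, ← Scheme.isoSpec_Spec_inv, ← IsAffineOpen.fromSpec_top,
      IsAffineOpen.SpecMap_appLE_fromSpec]

theorem isClosedImmersion_SpecMap_iff {R S : CommRingCat.{u}} {φ : R ⟶ S} :
    IsClosedImmersion (Spec.map φ) ↔ Function.Surjective φ := by
  refine ⟨fun h => ?_, IsClosedImmersion.spec_of_surjective φ⟩
  have hΓ := (IsClosedImmersion.isAffine_surjective_of_isAffine (Spec.map φ)).2
  have hφ : φ = (Scheme.ΓSpecIso R).inv ≫ (Spec.map φ).appTop ≫ (Scheme.ΓSpecIso S).hom := by simp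
  rw [hφ]
  exact ((ConcreteCategory.bijective_of_isIso (Scheme.ΓSpecIso S).hom).2.comp hΓ).comp
    (ConcreteCategory.bijective_of_isIso (Scheme.ΓSpecIso R).inv).2

section Chart

variable {k R C D : Type u} [CommRing k] [CommRing R] [CommRing C] [CommRing D] [Algebra k R]
  [Algebra k C] [Algebra k D] [Algebra R C] [IsScalarTower k R C] (g : D →ₐ[k] C)

theorem productMap_toAlgHom_surjective_iff :
    Function.Surjective (Algebra.TensorProduct.productMap g (IsScalarTower.toAlgHom k R C)) ↔
      Algebra.adjoin R (Set.range g) = ⊤ := by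
  rw [← AlgHom.range_eq_top, Algebra.TensorProduct.productMap_range]
  constructor <;> intro h
  · have hle : g.range ⊔ (IsScalarTower.toAlgHom k R C).range ≤
        (Algebra.adjoin R (Set.range g)).restrictScalars k := by
      refine sup_le (fun c hc => ?_) ?_
      · rw [Subalgebra.mem_restrictScalars]
        exact Algebra.subset_adjoin hc
      · rintro _ ⟨r, rfl⟩
        exact Subalgebra.algebraMap_mem _ r
    exact eq_top_iff.2 fun c _ => hle (h ▸ Algebra.mem_top)
  · let T : Subalgebra R C :=
      { (g.range ⊔ (IsScalarTower.toAlgHom k R C).range).toSubsemiring with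
        algebraMap_mem' r :=
          (le_sup_right : (IsScalarTower.toAlgHom k R C).range ≤ g.range ⊔ _) ⟨r, rfl⟩ }
    have hle : Algebra.adjoin R (Set.range g) ≤ T :=
      Algebra.adjoin_le (le_sup_left : g.range ≤ _ ⊔ (IsScalarTower.toAlgHom k R C).range)
    exact eq_top_iff.2 fun c _ => hle (h ▸ Algebra.mem_top)

theorem chart_comm : Spec.map (CommRingCat.ofHom g.toRingHom) ≫
      Spec.map (CommRingCat.ofHom (algebraMap k D)) =
    Spec.map (CommRingCat.ofHom (algebraMap R C)) ≫
      Spec.map (CommRingCat.ofHom (algebraMap k R)) := by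
  rw [← Spec.map_comp, ← Spec.map_comp, ← CommRingCat.ofHom_comp, ← CommRingCat.ofHom_comp]
  congr 2
  rw [← IsScalarTower.algebraMap_eq k R C]
  exact g.comp_algebraMap

theorem pullback_lift_chart_comp_pullbackSpecIso_hom :
    pullback.lift _ _ (chart_comm (R := R) g) ≫ (pullbackSpecIso k D R).hom =
      Spec.map (CommRingCat.ofHom
        (Algebra.TensorProduct.productMap g (IsScalarTower.toAlgHom k R C)).toRingHom) := by
  rw [← Iso.eq_comp_inv]
  apply pullback.hom_ext
  · rw [pullback.lift_fst, Category.assoc, pullbackSpecIso_inv_fst, ← Spec.map_comp,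
      ← CommRingCat.ofHom_comp]
    congr 2
    ext d
    simp
  · rw [pullback.lift_snd, Category.assoc, pullbackSpecIso_inv_snd, ← Spec.map_comp,
      ← CommRingCat.ofHom_comp]
    congr 2
    ext d
    simp

theorem isClosedImmersion_chart_iff :
    IsClosedImmersion (pullback.lift _ _ (chart_comm (R := R) g)) ↔
      Algebra.adjoin R (Set.range g) = ⊤ := by
  rw [← productMap_toAlgHom_surjective_iff,
    ← MorphismProperty.cancel_right_of_respectsIso @IsClosedImmersion _ (pullbackSpecIso k D R).hom,
    pullback_lift_chart_comp_pullbackSpecIso_hom, isClosedImmersion_SpecMap_iff]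
  rfl

end Chart

theorem range_subset_of_closedPoint_mem {C : Type u} [CommRing C] [IsLocalRing C] {X U : Scheme.{u}}
    (q : Spec (.of C) ⟶ X) (i : U ⟶ X) [IsOpenImmersion i]
    (h : q (IsLocalRing.closedPoint C) ∈ Set.range i) : Set.range q ⊆ Set.range i := by
  rintro _ ⟨y, rfl⟩
  have hy : y ⤳ IsLocalRing.closedPoint C := IsLocalRing.specializes_closedPoint y
  exact (hy.map q.continuous).mem_open i.isOpenEmbedding.isOpen_range h

theorem exists_chart_factorization {k : Type u} [Field k] {X : Scheme.{u}}
    (f : X ⟶ Spec (.of k)) (n : ℕ) [SmoothOfRelativeDimension n f] {C : Type u} [CommRing C]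
    [IsLocalRing C] [Algebra k C] (q : Spec (.of C) ⟶ X)
    (hq : q ≫ f = Spec.map (CommRingCat.ofHom (algebraMap k C))) :
    ∃ (D : Type u) (_ : CommRing D) (_ : Algebra k D) (i : Spec (.of D) ⟶ X) (g : D →ₐ[k] C),
      IsOpenImmersion i ∧ i ≫ f = Spec.map (CommRingCat.ofHom (algebraMap k D)) ∧
      Algebra.IsStandardSmoothOfRelativeDimension n k D ∧
      Spec.map (CommRingCat.ofHom g.toRingHom) ≫ i = q := by
  obtain ⟨D, _, _, i, hi, hx, hif, hD⟩ := exists_smooth_chart f n (q (IsLocalRing.closedPoint C))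
  let j := IsOpenImmersion.lift i q (range_subset_of_closedPoint_mem q i hx)
  have hj : j ≫ i = q := IsOpenImmersion.lift_fac _ _ _
  obtain ⟨φ, hφ⟩ := Spec.map_surjective j
  have hc : CommRingCat.ofHom (algebraMap k D) ≫ φ = CommRingCat.ofHom (algebraMap k C) := by
    apply Spec.map_injective
    rw [Spec.map_comp, hφ, ← hif, ← hq, ← hj, Category.assoc]
  let g : D →ₐ[k] C := { φ.hom with commutes' := fun a => congr($hc a) }
  refine ⟨D, inferInstance, inferInstance, i, g, hi, hif, hD, ?_⟩
  rw [← hj, ← hφ]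
  rfl

/-- The basis of the cotangent space at a `k`-point of a standard smooth algebra given by a basis
of its differentials. -/
def cotangentBasisOfStandardSmooth {k D : Type u} [Field k] [CommRing D] [Algebra k D] (n : ℕ)
    [Algebra.IsStandardSmoothOfRelativeDimension n k D] (ε : D →ₐ[k] k) :
    Module.Basis (Fin n) k (RingHom.ker ε).Cotangent :=
  have : Nontrivial D := ε.toRingHom.domain_nontrivial
  have : Algebra.IsStandardSmooth k D :=
    Algebra.IsStandardSmoothOfRelativeDimension.isStandardSmooth n
  have hrank : Module.finrank D (Ω[D⁄k]) = n := by
    rw [Module.finrank,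
      Algebra.IsStandardSmoothOfRelativeDimension.rank_kaehlerDifferential (R := k) (S := D) n]
    simp
  cotangentBasisOfKaehler (Module.finBasisOfFinrankEq D (Ω[D⁄k]) hrank) ε

theorem pullback_lift_comp_map_left {W U X T S : Scheme.{u}} {a : W ⟶ U} {b : W ⟶ T} {u : U ⟶ S}
    {t : T ⟶ S} (h : a ≫ u = b ≫ t) {f : X ⟶ S} {i : U ⟶ X}
    {c : W ⟶ X} (hc : a ≫ i = c) (h' : c ≫ f = b ≫ t) (e₁ e₂) :
    pullback.lift a b h ≫ pullback.map u t f t i (𝟙 T) (𝟙 S) e₁ e₂ = pullback.lift c b h' := by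
  apply pullback.hom_ext
  · rw [Category.assoc, pullback.map, pullback.lift_fst, pullback.lift_fst,
      pullback.lift_fst_assoc, hc]
  · rw [Category.assoc, pullback.map, pullback.lift_snd, pullback.lift_snd,
      pullback.lift_snd_assoc, Category.comp_id]

theorem pullback_lift_comp_map_right {W X T T' S S' : Scheme.{u}} {f : X ⟶ S} {t : T ⟶ S}
    {a : W ⟶ X} {b : W ⟶ T} (h : a ≫ f = b ≫ t) {t' : T' ⟶ S'} {i : T ⟶ T'} {s : S ⟶ S'}
    {f' : X ⟶ S'} {c : W ⟶ T'} (hc : b ≫ i = c) (h' : a ≫ f' = c ≫ t') (e₁ e₂) :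
    pullback.lift a b h ≫ pullback.map f t f' t' (𝟙 X) i s e₁ e₂ = pullback.lift a c h' := by
  apply pullback.hom_ext
  · rw [Category.assoc, pullback.map, pullback.lift_fst, pullback.lift_fst,
      pullback.lift_fst_assoc, Category.comp_id]
  · rw [Category.assoc, pullback.map, pullback.lift_snd, pullback.lift_snd,
      pullback.lift_snd_assoc, hc]

theorem isClosedImmersion_pullback_map {X T T' S : Scheme.{u}} {f : X ⟶ S} {t : T ⟶ S}
    {t' : T' ⟶ S} {i : T ⟶ T'} [IsClosedImmersion i] (e₁) (e₂ : t ≫ 𝟙 S = i ≫ t') :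
    IsClosedImmersion (pullback.map f t f t' (𝟙 X) i (𝟙 S) e₁ e₂) := by
  have : MorphismProperty.IsStableUnderComposition (@IsClosedImmersion.{u}) :=
    { comp_mem := fun _ _ _ _ => IsClosedImmersion.comp _ _ }
  exact MorphismProperty.pullbackMap (P := @IsClosedImmersion.{u}) inferInstance ‹_›
    (Category.id_comp f).symm (by rw [← e₂, Category.comp_id])

/-- The structure morphism `Spec C ⟶ Spec R` of an `R`-algebra `C`. -/
abbrev specHom (R C : Type u) [CommRing R] [CommRing C] [Algebra R C] :
    Spec (.of C) ⟶ Spec (.of R) :=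
  Spec.map (CommRingCat.ofHom (algebraMap R C))

theorem SpecMap_comp_specHom {R C F : Type u} [CommRing R] [CommRing C] [CommRing F] [Algebra R C]
    [Algebra R F] (φ : C →ₐ[R] F) :
    Spec.map (CommRingCat.ofHom φ.toRingHom) ≫ specHom R C = specHom R F := by
  rw [← Spec.map_comp, ← CommRingCat.ofHom_comp]
  exact congr(Spec.map (CommRingCat.ofHom $(φ.comp_algebraMap)))

namespace SmallExtension

variable {k : Type u} [Field k] {R' R : Type u} [CommRing R'] [CommRing R]
  [Algebra k R'] [Algebra k R] (E : SmallExtension k R' R)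

theorem surjective_SpecMap_π : Function.Surjective (Spec.map (CommRingCat.ofHom E.π.toRingHom)) :=
  (PrimeSpectrum.isHomeomorph_comap E.π.toRingHom
    (fun x => ⟨1, one_pos, by simpa using E.surjective x⟩) E.ker_le_nilradical).surjective

section Local

variable [IsAlgClosed k] [CharZero k] {C : Type u} [CommRing C] [Algebra k C] [Algebra R C]
  [IsScalarTower k R C] [Module.Free R C] [Module.Finite R C] [Module.Finite k C] [IsLocalRing C]

theorem exists_lift_chart {D : Type u} [CommRing D] [Algebra k D]
    [Algebra.IsStandardSmoothOfRelativeDimension 2 k D]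
    (g : D →ₐ[k] C) (hg : Algebra.adjoin R (Set.range g) = ⊤) :
    ∃ (C' : Type u) (_ : CommRing C') (_ : Algebra k C') (_ : Algebra R' C')
      (_ : IsScalarTower k R' C') (p : C' →ₐ[k] C) (g' : D →ₐ[k] C'),
      E.IsDeformation (p : C' →+* C) ∧ p.comp g' = g ∧ Algebra.adjoin R' (Set.range g') = ⊤ := by
  obtain ⟨ε, -, hε⟩ := exists_algHom_ker_eq_maximalIdeal k C
  obtain ⟨y, hy, -, hgen⟩ :=
    exists_cotangent_generators (cotangentBasisOfStandardSmooth 2 (ε.comp g))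
  have hadj := adjoin_range_comp_eq_top (R := R) hy hgen g (fun _ => rfl) hε hg
  have hpair : Set.range (g ∘ y) = {g (y 0), g (y 1)} := by
    ext c
    simp [Set.mem_range, Fin.exists_fin_two, eq_comm]
  rw [hpair] at hadj
  obtain ⟨C', _, _, p, hp⟩ := E.exists_isDeformation hadj
  let _ : Algebra k C' := ((algebraMap R' C').comp (algebraMap k R')).toAlgebra
  have : IsScalarTower k R' C' := .of_algebraMap_eq fun _ => rfl
  let p' : C' →ₐ[k] C := { p with
    commutes' := fun a => by
      change p (algebraMap R' C' (algebraMap k R' a)) = _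
      rw [hp.map_algebraMap, AlgHom.commutes, ← IsScalarTower.algebraMap_apply] }
  have : Algebra.IsStandardSmooth k D :=
    Algebra.IsStandardSmoothOfRelativeDimension.isStandardSmooth 2
  have hnil : IsNilpotent (RingHom.ker p') := ⟨2, hp.ker_sq_eq_bot⟩
  let g' : D →ₐ[k] C' := Algebra.FormallySmooth.liftOfSurjective g p' hp.surjective hnil
  have hg' : p'.comp g' = g := Algebra.FormallySmooth.comp_liftOfSurjective g p' hp.surjective hnil
  refine ⟨C', _, _, _, inferInstance, p', g', hp, hg', hp.adjoin_eq_top ?_⟩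
  rw [← hg, ← Set.range_comp, ← hg']
  rfl

theorem exists_lift_family_of_isLocalRing {X : Scheme.{u}} (f : X ⟶ Spec (.of k))
    [SmoothOfRelativeDimension 2 f] (q : Spec (.of C) ⟶ X)
    (hq : q ≫ f = specHom R C ≫ specHom k R)
    (hcl : IsClosedImmersion (pullback.lift q (specHom R C) hq)) :
    ∃ (C' : Type u) (_ : CommRing C') (_ : Algebra R' C') (p : C' →+* C) (q' : Spec (.of C') ⟶ X)
      (hq' : q' ≫ f = specHom R' C' ≫ specHom k R'),
      E.IsDeformation p ∧ Spec.map (CommRingCat.ofHom p) ≫ q' = q ∧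
      SurjectiveOnStalks (pullback.lift q' (specHom R' C') hq') := by
  obtain ⟨D, _, _, i, g, hi, hif, hD, hgq⟩ := exists_chart_factorization f 2 q
    (by rw [hq, ← Spec.map_comp, ← CommRingCat.ofHom_comp, ← IsScalarTower.algebraMap_eq])
  let j (S : Type u) [CommRing S] [Algebra k S] :
      pullback (specHom k D) (specHom k S) ⟶ pullback f (specHom k S) :=
    pullback.map _ _ _ _ i (𝟙 _) (𝟙 _) (by simpa using hif.symm) (by simp)
  have hj (S : Type u) [CommRing S] [Algebra k S] : IsOpenImmersion (j S) := by
    dsimp only [j]; infer_instance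
  have hadj : Algebra.adjoin R (Set.range g) = ⊤ := by
    rw [← isClosedImmersion_chart_iff]
    have : IsClosedImmersion (pullback.lift _ _ (chart_comm (R := R) g) ≫ j R) := by
      convert hcl
      exact pullback_lift_comp_map_left _ hgq _ _ _
    exact .of_comp _ (j R)
  obtain ⟨C', _, _, _, _, p, g', hp, rfl, hadj'⟩ := E.exists_lift_chart g hadj
  have hc := (isClosedImmersion_chart_iff (R := R') g').2 hadj'
  have hq' : (Spec.map (CommRingCat.ofHom g'.toRingHom) ≫ i) ≫ f =
      specHom R' C' ≫ specHom k R' := by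
    rw [Category.assoc, hif]
    exact chart_comm (R := R') g'
  refine ⟨C', _, _, p, Spec.map (CommRingCat.ofHom g'.toRingHom) ≫ i, hq', hp, ?_, ?_⟩
  · rw [← hgq, ← Category.assoc, ← Spec.map_comp, ← CommRingCat.ofHom_comp]
    rfl
  · rw [← pullback_lift_comp_map_left (chart_comm (R := R') g') rfl hq'
      (by simpa using hif.symm) (by simp)]
    change SurjectiveOnStalks (_ ≫ j R')
    infer_instance

end Local

namespace IsDeformation

variable {E} {C C' : Type u} [CommRing C] [CommRing C'] [Algebra R C] [Algebra R' C'] {p : C' →+* C}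
  (hp : E.IsDeformation p)

include hp

theorem isPullback_specHom :
    IsPullback (Spec.map (CommRingCat.ofHom p)) (specHom R C) (specHom R' C')
      (Spec.map (CommRingCat.ofHom E.π.toRingHom)) := by
  apply isPullback_SpecMap_of_isPushout
  have hw : CommRingCat.ofHom (algebraMap R' C') ≫ CommRingCat.ofHom p =
      CommRingCat.ofHom E.π.toRingHom ≫ CommRingCat.ofHom (algebraMap R C) := by
    ext r; exact hp.map_algebraMap r
  have lift_apply {A : Type u} [CommRing A] (g : {g : C' →+* A // RingHom.ker p ≤ RingHom.ker g})
      (z : C') : p.liftOfSurjective hp.surjective g (p z) = g.1 z :=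
    RingHom.liftOfRightInverse_comp_apply _ _ (Function.rightInverse_surjInv hp.surjective) _ z
  refine ⟨⟨hw⟩, ⟨PushoutCocone.IsColimit.mk _ (fun s => CommRingCat.ofHom
    (p.liftOfSurjective hp.surjective ⟨s.inl.hom, ?_⟩)) ?_ ?_ ?_⟩⟩
  · intro z hz
    obtain ⟨w, rfl⟩ := hp.exists_eq_mul z hz
    have he : s.inl.hom (algebraMap R' C' E.e) = s.inr.hom (E.π E.e) := congr($(s.condition) E.e)
    rw [RingHom.mem_ker, map_mul, he, E.π_e, map_zero, zero_mul]
  · intro s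
    ext z
    exact lift_apply _ z
  · intro s
    ext r
    obtain ⟨r', rfl⟩ := E.surjective r
    have hr : s.inl.hom (algebraMap R' C' r') = s.inr.hom (E.π r') := congr($(s.condition) r')
    refine Eq.trans ?_ hr
    change (p.liftOfSurjective hp.surjective _) (algebraMap R C (E.π r')) = _
    rw [← hp.map_algebraMap]
    exact lift_apply _ _
  · intro s m hm _
    ext c
    obtain ⟨z, rfl⟩ := hp.surjective c
    exact (congr($hm z) : m.hom (p z) = s.inl.hom z).trans (lift_apply ⟨s.inl.hom, _⟩ z).symm

theorem surjective_SpecMap : Function.Surjective (Spec.map (CommRingCat.ofHom p)) :=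
  (PrimeSpectrum.isHomeomorph_comap p (fun x => ⟨1, one_pos, by simpa using hp.surjective x⟩)
    hp.ker_le_nilradical).surjective

theorem isClosedImmersion_lift {X : Scheme.{u}} {f : X ⟶ Spec (.of k)} [IsSeparated f]
    {q : Spec (.of C) ⟶ X} {hq : q ≫ f = specHom R C ≫ specHom k R}
    (hcl : IsClosedImmersion (pullback.lift q (specHom R C) hq)) {q' : Spec (.of C') ⟶ X}
    {hq' : q' ≫ f = specHom R' C' ≫ specHom k R'} (hpq : Spec.map (CommRingCat.ofHom p) ≫ q' = q)
    (hst : SurjectiveOnStalks (pullback.lift q' (specHom R' C') hq')) :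
    IsClosedImmersion (pullback.lift q' (specHom R' C') hq') := by
  have := hp.finite
  have hfin : IsFinite (specHom R' C') :=
    (IsFinite.SpecMap_iff _).2 (RingHom.finite_algebraMap.2 inferInstance)
  rw [IsClosedImmersion.iff_isFinite_and_mono]
  refine ⟨?_, SurjectiveOnStalks.mono_of_injective ?_⟩
  · have : IsFinite (pullback.lift _ _ hq' ≫ pullback.snd f (specHom k R')) := by
      rwa [pullback.lift_snd]
    exact .of_comp _ (pullback.snd f (specHom k R'))
  let π := Spec.map (CommRingCat.ofHom E.π.toRingHom)
  have hπ : IsClosedImmersion π := isClosedImmersion_SpecMap_iff.2 E.surjective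
  have hπk : specHom k R ≫ 𝟙 _ = π ≫ specHom k R' := by
    rw [Category.comp_id, SpecMap_comp_specHom]
  let Q := pullback.map f (specHom k R) f (specHom k R') (𝟙 _) π (𝟙 _) (by simp) hπk
  have hQ : IsClosedImmersion Q := isClosedImmersion_pullback_map _ _
  have hcomm : Spec.map (CommRingCat.ofHom p) ≫ pullback.lift _ _ hq' =
      pullback.lift _ _ hq ≫ Q := by
    subst hpq
    rw [pullback_lift_comp_map_right hq hp.isPullback_specHom.w.symm
      (by rw [Category.assoc, hq', Category.assoc])]
    apply pullback.hom_ext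
    · rw [Category.assoc, pullback.lift_fst, pullback.lift_fst]
    · rw [Category.assoc, pullback.lift_snd, pullback.lift_snd]
  have hinj : Function.Injective (pullback.lift _ _ hq ≫ Q) :=
    (pullback.lift _ _ hq ≫ Q).isClosedEmbedding.injective
  rw [← hcomm] at hinj
  exact .of_comp_right hinj hp.surjective_SpecMap

end IsDeformation

end SmallExtension

section Pi

variable {ι : Type u} [Finite ι] {C : Type u} [CommRing C] {F : ι → Type u} [∀ j, CommRing (F j)]
  {φ : ∀ j, C →+* F j} (hφ : Function.Bijective (RingHom.pi φ)) {X : Scheme.{u}}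

/-- The spectrum of a finite product is the coproduct of the spectra. -/
def sigmaIsoSpec : (∐ fun j => Spec (.of (F j))) ≅ Spec (.of C) :=
  asIso (sigmaSpec fun j => .of (F j)) ≪≫
    Scheme.Spec.mapIso (RingEquiv.ofBijective _ hφ).toCommRingCatIso.op

theorem ι_sigmaIsoSpec (j : ι) :
    Sigma.ι (fun j => Spec (.of (F j))) j ≫ (sigmaIsoSpec hφ).hom =
    Spec.map (CommRingCat.ofHom (φ j)) := by
  rw [sigmaIsoSpec, Iso.trans_hom, asIso_hom, ι_sigmaSpec_assoc]
  exact (Spec.map_comp _ _).symm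

include hφ

theorem Spec_hom_ext_pi {a b : Spec (.of C) ⟶ X}
    (hab : ∀ j, Spec.map (CommRingCat.ofHom (φ j)) ≫ a = Spec.map (CommRingCat.ofHom (φ j)) ≫ b) :
    a = b := by
  rw [← cancel_epi (sigmaIsoSpec hφ).hom]
  apply Sigma.hom_ext
  intro j
  rw [← Category.assoc, ← Category.assoc, ι_sigmaIsoSpec]
  exact hab j

theorem exists_Spec_desc_pi (q : ∀ j, Spec (.of (F j)) ⟶ X) :
    ∃ a : Spec (.of C) ⟶ X, ∀ j, Spec.map (CommRingCat.ofHom (φ j)) ≫ a = q j := by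
  refine ⟨(sigmaIsoSpec hφ).inv ≫ Sigma.desc q, fun j => ?_⟩
  rw [← ι_sigmaIsoSpec hφ, Category.assoc, Iso.hom_inv_id_assoc, Sigma.ι_desc]

theorem surjectiveOnStalks_of_pi (a : Spec (.of C) ⟶ X)
    (ha : ∀ j, SurjectiveOnStalks (Spec.map (CommRingCat.ofHom (φ j)) ≫ a)) :
    SurjectiveOnStalks a := by
  have hdesc : (sigmaIsoSpec hφ).hom ≫ a =
      Sigma.desc fun j => Spec.map (CommRingCat.ofHom (φ j)) ≫ a := by
    apply Sigma.hom_ext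
    intro j
    rw [← Category.assoc, ι_sigmaIsoSpec, Sigma.ι_desc]
  have : SurjectiveOnStalks ((sigmaIsoSpec hφ).hom ≫ a) :=
    hdesc ▸ IsZariskiLocalAtSource.sigmaDesc ha
  rw [← Iso.inv_hom_id_assoc (sigmaIsoSpec hφ) a]
  infer_instance

end Pi

section LiftFamily

variable {k : Type u} [Field k] {R' R : Type u} [CommRing R'] [CommRing R] [Algebra k R']
  [Algebra k R] {X : Scheme.{u}} {f : X ⟶ Spec (.of k)}
  {C : Type u} [CommRing C] [Algebra R C]

theorem SpecMap_comp_eq_specHom {F : Type u} [CommRing F] [Algebra R F] (φ : C →ₐ[R] F)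
    {q : Spec (.of C) ⟶ X} (hq : q ≫ f = specHom R C ≫ specHom k R) :
    (Spec.map (CommRingCat.ofHom φ.toRingHom) ≫ q) ≫ f = specHom R F ≫ specHom k R := by
  rw [Category.assoc, hq, ← SpecMap_comp_specHom φ, Category.assoc]

theorem SpecMap_comp_lift {F : Type u} [CommRing F] [Algebra R F] (φ : C →ₐ[R] F)
    {q : Spec (.of C) ⟶ X} (hq : q ≫ f = specHom R C ≫ specHom k R) :
    Spec.map (CommRingCat.ofHom φ.toRingHom) ≫ pullback.lift q (specHom R C) hq =
      pullback.lift _ (specHom R F) (SpecMap_comp_eq_specHom φ hq) := by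
  apply pullback.hom_ext
  · rw [Category.assoc, pullback.lift_fst, pullback.lift_fst]
  · rw [Category.assoc, pullback.lift_snd, pullback.lift_snd, SpecMap_comp_specHom]

theorem SmallExtension.exists_lift_family_of_pi (E : SmallExtension k R' R) [IsSeparated f]
    {q : Spec (.of C) ⟶ X} {hq : q ≫ f = specHom R C ≫ specHom k R}
    (hcl : IsClosedImmersion (pullback.lift q (specHom R C) hq))
    {ι : Type u} [Finite ι] {F : ι → Type u} [∀ j, CommRing (F j)] [∀ j, Algebra R (F j)]
    (e : C ≃ₐ[R] ∀ j, F j) {F' : ι → Type u} [∀ j, CommRing (F' j)] [∀ j, Algebra R' (F' j)]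
    {p : ∀ j, F' j →+* F j} (hp : ∀ j, E.IsDeformation (p j)) {q' : ∀ j, Spec (.of (F' j)) ⟶ X}
    {hq' : ∀ j, q' j ≫ f = specHom R' (F' j) ≫ specHom k R'}
    (hpq : ∀ j, Spec.map (CommRingCat.ofHom (p j)) ≫ q' j =
      Spec.map (CommRingCat.ofHom ((Pi.evalAlgHom R F j).comp e.toAlgHom).toRingHom) ≫ q)
    (hst : ∀ j, SurjectiveOnStalks (pullback.lift (q' j) (specHom R' (F' j)) (hq' j))) :
    ∃ (C' : Type u) (_ : CommRing C') (_ : Algebra R' C') (p : C' →+* C) (q' : Spec (.of C') ⟶ X)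
      (hq' : q' ≫ f = specHom R' C' ≫ specHom k R'),
      E.IsDeformation p ∧ Spec.map (CommRingCat.ofHom p) ≫ q' = q ∧
      IsClosedImmersion (pullback.lift q' (specHom R' C') hq') := by
  have hP := E.isDeformation_of_pi e hp
  set P := (e.symm : (∀ j, F j) →+* C).comp (RingHom.pi fun j => (p j).comp (Pi.evalRingHom F' j))
  let ev (j) : (∀ j, F' j) →ₐ[R'] F' j := Pi.evalAlgHom R' F' j
  have hev : Function.Bijective (RingHom.pi fun j => (ev j).toRingHom) := Function.bijective_id
  let ev₀ (j) : C →ₐ[R] F j := (Pi.evalAlgHom R F j).comp e.toAlgHom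
  have hev₀ : Function.Bijective (RingHom.pi fun j => (ev₀ j).toRingHom) := e.bijective
  have hPev (j) : (ev₀ j).toRingHom.comp P = (p j).comp (ev j).toRingHom :=
    RingHom.ext fun z => congr_fun (e.apply_symm_apply fun j => p j (z j)) j
  obtain ⟨Q, hQ⟩ := exists_Spec_desc_pi hev q'
  have hQf : Q ≫ f = specHom R' (∀ j, F' j) ≫ specHom k R' := by
    refine Spec_hom_ext_pi hev fun j => ?_
    rw [← Category.assoc, hQ, hq', ← Category.assoc, SpecMap_comp_specHom]
  have hPQ : Spec.map (CommRingCat.ofHom P) ≫ Q = q := by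
    refine Spec_hom_ext_pi hev₀ fun j => ?_
    rw [← Category.assoc, ← Spec.map_comp, ← CommRingCat.ofHom_comp, hPev,
      CommRingCat.ofHom_comp, Spec.map_comp, Category.assoc, hQ, hpq]
  refine ⟨_, _, _, P, Q, hQf, hP, hPQ, hP.isClosedImmersion_lift hcl hPQ ?_⟩
  refine surjectiveOnStalks_of_pi hev _ fun j => ?_
  rw [SpecMap_comp_lift]
  convert hst j
  exact hQ j

theorem SmallExtension.exists_lift_family [IsAlgClosed k] [CharZero k] (E : SmallExtension k R' R)
    [IsLocalRing R] [Module.Finite k R] [SmoothOfRelativeDimension 2 f] [IsSeparated f]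
    [Module.Flat R C] [Module.Finite R C] {q : Spec (.of C) ⟶ X}
    {hq : q ≫ f = specHom R C ≫ specHom k R}
    (hcl : IsClosedImmersion (pullback.lift q (specHom R C) hq)) :
    ∃ (C' : Type u) (_ : CommRing C') (_ : Algebra R' C') (p : C' →+* C) (q' : Spec (.of C') ⟶ X)
      (hq' : q' ≫ f = specHom R' C' ≫ specHom k R'),
      E.IsDeformation p ∧ Spec.map (CommRingCat.ofHom p) ≫ q' = q ∧
      IsClosedImmersion (pullback.lift q' (specHom R' C') hq') := by
  let _ : Algebra k C := Algebra.compHom C (algebraMap k R)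
  have : IsScalarTower k R C := .of_algebraMap_eq fun _ => rfl
  have : Module.Finite k C := .trans R C
  have : IsArtinianRing C := IsArtinianRing.of_finite k C
  let F (j : PrimeSpectrum C) := Localization j.asIdeal.primeCompl
  let φ (j) : C →ₐ[R] F j := IsScalarTower.toAlgHom R C (F j)
  have hφs (j) : Function.Surjective (φ j) :=
    IsArtinianRing.localization_surjective j.asIdeal.primeCompl (F j)
  let e : C ≃ₐ[R] ∀ j, F j :=
    AlgEquiv.ofBijective (AlgHom.pi φ) PrimeSpectrum.toPiLocalization_bijective
  have hflat (j) : Module.Flat R (F j) := .trans R C (F j)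
  have hfinite (j) : Module.Finite R (F j) := .of_surjective (φ j).toLinearMap (hφs j)
  have hfiniteDim (j) : Module.Finite k (F j) := .trans R (F j)
  have hfree (j) : Module.Free R (F j) := Module.free_of_flat_of_isLocalRing
  have hloc (j) : IsLocalRing (F j) := Localization.AtPrime.isLocalRing j.asIdeal
  have hclj (j) : IsClosedImmersion (pullback.lift _ _ (SpecMap_comp_eq_specHom (φ j) hq)) := by
    have : IsClosedImmersion (Spec.map (CommRingCat.ofHom (φ j).toRingHom)) :=
      isClosedImmersion_SpecMap_iff.2 (hφs j)
    rw [← SpecMap_comp_lift (φ j) hq]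
    infer_instance
  choose F' i₁ i₂ p q' hq' hp hpq hst using
    fun j => E.exists_lift_family_of_isLocalRing f _ (SpecMap_comp_eq_specHom (φ j) hq) (hclj j)
  exact E.exists_lift_family_of_pi hcl e hp hpq hst

end LiftFamily

theorem IsFamily.baseChange {k : Type u} [Field k] {X : Scheme.{u}} {f : X ⟶ Spec (.of k)} {n : ℕ}
    {T W T' W' : Scheme.{u}} {t : T ⟶ Spec (.of k)} {q : W ⟶ X} {π : W ⟶ T}
    (hF : IsFamily f n t q π) {u : T' ⟶ T} {g : W' ⟶ W} {π' : W' ⟶ T'} (hp : IsPullback g π' π u) :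
    IsFamily f n (u ≫ t) (g ≫ q) π' where
  comm := by rw [Category.assoc, hF.comm, ← Category.assoc, hp.w, Category.assoc]
  isClosedImmersion := by
    let Q : pullback f (u ≫ t) ⟶ pullback f t :=
      pullback.lift (pullback.fst _ _) (pullback.snd _ _ ≫ u)
        (by rw [pullback.condition, Category.assoc])
    have hQ : IsPullback Q (pullback.snd f (u ≫ t)) (pullback.snd f t) u := by
      refine IsPullback.of_right ?_ (pullback.lift_snd _ _ _) (IsPullback.of_hasPullback f t)
      rw [pullback.lift_fst]
      exact IsPullback.of_hasPullback f (u ≫ t)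
    have hc : (g ≫ q) ≫ f = π' ≫ u ≫ t := by
      rw [Category.assoc, hF.comm, ← Category.assoc, hp.w, Category.assoc]
    have hg : IsPullback g (pullback.lift _ _ hc) (pullback.lift q π hF.comm) Q := by
      refine (IsPullback.of_right ?_ ?_ hQ.flip).flip
      · rw [pullback.lift_snd, pullback.lift_snd]
        exact hp.flip
      · apply pullback.hom_ext
        · rw [Category.assoc, Category.assoc, pullback.lift_fst, pullback.lift_fst,
            pullback.lift_fst]
        · rw [Category.assoc, Category.assoc, pullback.lift_snd, pullback.lift_snd,
            pullback.lift_snd_assoc, hp.w]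
    exact MorphismProperty.of_isPullback (P := @IsClosedImmersion) hg hF.isClosedImmersion
  isFinite := MorphismProperty.of_isPullback (P := @IsFinite) hp hF.isFinite
  flat := MorphismProperty.of_isPullback (P := @Flat) hp hF.flat
  locallyOfFinitePresentation :=
    MorphismProperty.of_isPullback (P := @LocallyOfFinitePresentation) hp
      hF.locallyOfFinitePresentation
  rank s := by
    have := hF.isFinite
    have := hF.flat
    have := hF.locallyOfFinitePresentation
    rw [Scheme.Hom.finrank_of_isPullback _ _ _ _ hp, hF.rank]

theorem exists_isPullback_specHom {Z H : Scheme.{u}} (π : Z ⟶ H) [IsAffineHom π] {R : Type u}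
    [CommRing R] (u : Spec (.of R) ⟶ H) :
    ∃ (C : Type u) (_ : CommRing C) (_ : Algebra R C) (g : Spec (.of C) ⟶ Z),
      IsPullback g (specHom R C) π u := by
  have : IsAffine (pullback π u) := isAffine_of_isAffineHom (pullback.snd π u)
  let W := pullback π u
  obtain ⟨ψ, hψ⟩ := Spec.map_surjective (W.isoSpec.inv ≫ pullback.snd π u)
  let _ : Algebra R Γ(W, ⊤) := ψ.hom.toAlgebra
  refine ⟨Γ(W, ⊤), inferInstance, inferInstance, W.isoSpec.inv ≫ pullback.fst π u, ?_⟩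
  have : specHom R Γ(W, ⊤) = W.isoSpec.inv ≫ pullback.snd π u := hψ
  rw [this]
  exact IsPullback.of_iso (IsPullback.of_hasPullback π u) W.isoSpec (Iso.refl _) (Iso.refl _)
    (Iso.refl _) (by simp) (by simp) (by simp) (by simp)

theorem IsFamily.of_specHom {k : Type u} [Field k] {X : Scheme.{u}} {f : X ⟶ Spec (.of k)} {n : ℕ}
    {A C : Type u} [CommRing A] [CommRing C] [Algebra A C] {t : Spec (.of A) ⟶ Spec (.of k)}
    {q : Spec (.of C) ⟶ X} (hF : IsFamily f n t q (specHom A C)) :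
    Module.Finite A C ∧ Module.Flat A C ∧ ∀ p, Module.rankAtStalk (R := A) C p = n := by
  have hfin : Module.Finite A C :=
    RingHom.finite_algebraMap.1 ((IsFinite.SpecMap_iff _).1 hF.isFinite)
  have hflat : Module.Flat A C := RingHom.flat_algebraMap_iff.1 (Flat.SpecMap_iff.1 hF.flat)
  exact ⟨hfin, hflat, fun p => by
    rw [← Scheme.Hom.finrank_SpecMap_algebraMap]; exact hF.rank p⟩

theorem isFamily_specHom {k : Type u} [Field k] {X : Scheme.{u}} {f : X ⟶ Spec (.of k)} {n : ℕ}
    {R C : Type u} [CommRing R] [Algebra k R] [CommRing C] [Algebra R C] [IsNoetherianRing R]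
    [Module.Finite R C] [Module.Flat R C] {q : Spec (.of C) ⟶ X}
    {hq : q ≫ f = specHom R C ≫ specHom k R}
    (hcl : IsClosedImmersion (pullback.lift q (specHom R C) hq))
    (hn : ∀ s, (specHom R C).finrank s = n) :
    IsFamily f n (specHom k R) q (specHom R C) where
  comm := hq
  isClosedImmersion := hcl
  isFinite := (IsFinite.SpecMap_iff _).2 (RingHom.finite_algebraMap.2 inferInstance)
  flat := Flat.SpecMap_iff.2 (RingHom.flat_algebraMap_iff.2 inferInstance)
  locallyOfFinitePresentation :=
    (HasRingHomProperty.Spec_iff (P := @LocallyOfFinitePresentation)).2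
      (RingHom.finitePresentation_algebraMap.2
        (Algebra.FinitePresentation.of_finiteType.1 inferInstance))
  rank := hn

theorem locallyOfFiniteType_specHom (R C : Type u) [CommRing R] [CommRing C] [Algebra R C]
    [Algebra.FiniteType R C] : LocallyOfFiniteType (specHom R C) :=
  (HasRingHomProperty.Spec_iff (P := @LocallyOfFiniteType)).2
    (RingHom.finiteType_algebraMap.2 inferInstance)

namespace SmallExtension

variable {k : Type u} [Field k] {R' R : Type u} [CommRing R'] [CommRing R] [Algebra k R']
  [Algebra k R] (E : SmallExtension k R' R)

theorem IsDeformation.isFamily {E : SmallExtension k R' R} [IsNoetherianRing R']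
    {X : Scheme.{u}} {f : X ⟶ Spec (.of k)} {n : ℕ} {C C' : Type u} [CommRing C] [CommRing C']
    [Algebra R C] [Algebra R' C'] {p : C' →+* C} (hp : E.IsDeformation p)
    {q' : Spec (.of C') ⟶ X} {hq' : q' ≫ f = specHom R' C' ≫ specHom k R'}
    (hcl : IsClosedImmersion (pullback.lift q' (specHom R' C') hq'))
    (hn : ∀ s, (specHom R C).finrank s = n) :
    IsFamily f n (specHom k R') q' (specHom R' C') := by
  have := hp.finite
  have := hp.free
  refine isFamily_specHom hcl fun s => ?_
  obtain ⟨s, rfl⟩ := E.surjective_SpecMap_π s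
  have : IsFinite (specHom R' C') :=
    (IsFinite.SpecMap_iff _).2 (RingHom.finite_algebraMap.2 inferInstance)
  have : Flat (specHom R' C') := Flat.SpecMap_iff.2 (RingHom.flat_algebraMap_iff.2 inferInstance)
  rw [← Scheme.Hom.finrank_of_isPullback _ _ _ _ hp.isPullback_specHom, hn]

/-- Morphisms to an open subset of `H` extend along nilpotent thickenings as soon as they do so
as morphisms to `H`, because the extension has the same topological image. -/
theorem exists_algHom_comp_eq {H : Scheme.{u}} {A : Type u} [CommRing A] [Algebra k A]
    {h : H ⟶ Spec (.of k)} (i : Spec (.of A) ⟶ H) [IsOpenImmersion i] (hi : i ≫ h = specHom k A)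
    {φ : A →ₐ[k] R} {v : Spec (.of R') ⟶ H} (hv : v ≫ h = specHom k R')
    (hvφ : Spec.map (CommRingCat.ofHom E.π.toRingHom) ≫ v =
      Spec.map (CommRingCat.ofHom φ.toRingHom) ≫ i) :
    ∃ ψ : A →ₐ[k] R', E.π.comp ψ = φ := by
  have hrange : Set.range v ⊆ Set.range i := by
    rintro _ ⟨x, rfl⟩
    obtain ⟨x, rfl⟩ := E.surjective_SpecMap_π x
    rw [← Scheme.Hom.comp_apply, hvφ]
    exact ⟨_, (Scheme.Hom.comp_apply _ _ _).symm⟩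
  obtain ⟨ψ, hψ⟩ := Spec.map_surjective (IsOpenImmersion.lift i v hrange)
  have hψi : Spec.map ψ ≫ i = v := by rw [hψ]; exact IsOpenImmersion.lift_fac _ _ _
  have hψk : CommRingCat.ofHom (algebraMap k A) ≫ ψ = CommRingCat.ofHom (algebraMap k R') := by
    apply Spec.map_injective
    rw [Spec.map_comp]
    refine Eq.trans ?_ hv
    rw [← hψi, Category.assoc, hi]
  have hψφ : ψ ≫ CommRingCat.ofHom E.π.toRingHom = CommRingCat.ofHom φ.toRingHom := by
    apply Spec.map_injective
    rw [← cancel_mono i, Spec.map_comp, Category.assoc, hψi, hvφ]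
  exact ⟨{ ψ.hom with commutes' := fun a => congr($hψk a) }, AlgHom.ext fun a => congr($hψφ a)⟩

end SmallExtension

section HilbertScheme

variable {k : Type u} [Field k] [IsAlgClosed k] [CharZero k] {X : Scheme.{u}}
  {f : X ⟶ Spec (.of k)} [SmoothOfRelativeDimension 2 f] [IsSeparated f] {n : ℕ}
  {H Z : Scheme.{u}} {h : H ⟶ Spec (.of k)} {q : Z ⟶ X} {π : Z ⟶ H}
  (hH : IsHilbertScheme f n h q π)

include hH

theorem IsHilbertScheme.exists_SpecMap_comp_eq {R' R : Type u} [CommRing R'] [CommRing R]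
    [Algebra k R'] [Algebra k R] (E : SmallExtension k R' R) [IsLocalRing R] [Module.Finite k R]
    [Module.Finite k R'] (u : Spec (.of R) ⟶ H) (hu : u ≫ h = specHom k R) :
    ∃ v : Spec (.of R') ⟶ H, v ≫ h = specHom k R' ∧
      Spec.map (CommRingCat.ofHom E.π.toRingHom) ≫ v = u := by
  have : IsFinite π := hH.isFamily.isFinite
  have : IsNoetherianRing R' := IsNoetherianRing.of_finite k R'
  obtain ⟨C, _, _, g, hg⟩ := exists_isPullback_specHom π u
  have hF := hH.isFamily.baseChange hg
  rw [hu] at hF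
  obtain ⟨_, _, -⟩ := hF.of_specHom
  obtain ⟨C', _, _, p, q', hq', hp, hpq, hcl⟩ := E.exists_lift_family hF.isClosedImmersion
  obtain ⟨v, ⟨hv, g', hgq', hg'⟩, -⟩ :=
    hH.existsUnique _ _ _ (locallyOfFiniteType_specHom k R') (hp.isFamily hcl hF.rank)
  refine ⟨v, hv, (hH.existsUnique _ _ _ (locallyOfFiniteType_specHom k R) hF).unique
    ⟨?_, _, ?_, hp.isPullback_specHom.paste_horiz hg'⟩ ⟨hu, g, rfl, hg⟩⟩
  · rw [Category.assoc, hv, SpecMap_comp_specHom]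
  · rw [Category.assoc, hgq', hpq]

theorem IsHilbertScheme.liftsTrunc {A : Type u} [CommRing A] [Algebra k A] (i : Spec (.of A) ⟶ H)
    [IsOpenImmersion i] (hi : i ≫ h = specHom k A) (σ : Type)
    [DecidableEq σ] : LiftsTrunc k A σ := by
  intro S s h0 hS hS' hs φ
  have := TruncAlg.isLocalRing (k := k) h0
  have := TruncAlg.finite (k := k) hS
  have := TruncAlg.finite (k := k) hS'
  let E := SmallExtension.trunc k h0 hS hS' hs
  obtain ⟨v, hv, hvφ⟩ := hH.exists_SpecMap_comp_eq E
    (Spec.map (CommRingCat.ofHom φ.toRingHom) ≫ i)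
    (by rw [Category.assoc, hi, SpecMap_comp_specHom])
  exact E.exists_algHom_comp_eq i hi hv hvφ

end HilbertScheme

theorem TruncAlg.degLT_zero (σ : Type*) [Finite σ] : degLT σ 0 = ∅ :=
  Finset.eq_empty_iff_forall_notMem.2 fun _ hs => Nat.not_lt_zero _ (mem_degLT.1 hs)

theorem TruncAlg.card_degLT_succ (σ : Type*) [Finite σ] (t : ℕ) :
    (degLT σ (t + 1)).card = (t + Nat.card σ).choose (Nat.card σ) := by
  classical
  have := Fintype.ofFinite σ
  have hdeg : degLT σ (t + 1) =
      (Finset.range (t + 1)).biUnion fun d => Finset.finsuppAntidiag Finset.univ d := by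
    ext s
    simp [mem_degLT, Finset.mem_finsuppAntidiag, Finsupp.degree_eq_sum]
  rw [hdeg, Finset.card_biUnion, ← Nat.sum_range_multichoose]
  · refine Finset.sum_congr rfl fun d _ => ?_
    rw [Finset.card_finsuppAntidiag_nat_eq_multichoose, Finset.card_univ, Nat.card_eq_fintype_card]
  · intro a _ b _ hab
    rw [Function.onFun, Finset.disjoint_left]
    intro s hs hs'
    rw [Finset.mem_finsuppAntidiag] at hs hs'
    exact hab (hs.1.symm.trans hs'.1)

theorem TruncAlg.card_degLT_fin_two (t : ℕ) : (degLT (Fin 2) t).card = t * (t + 1) / 2 := by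
  cases t with
  | zero => simp [degLT_zero]
  | succ t =>
    rw [card_degLT_succ, Nat.card_fin, Nat.choose_two_right, mul_comm]
    rfl

section Socle

variable {k : Type*} [Field k] {A : Type*} [CommRing A] [Algebra k A]

/-- The socle of a `k`-algebra at the point given by an augmentation. -/
def augSocle (ε : A →ₐ[k] k) : Ideal A :=
  (RingHom.ker ε).annihilator

theorem mem_augSocle {ε : A →ₐ[k] k} {a : A} : a ∈ augSocle ε ↔ ∀ b, ε b = 0 → b * a = 0 := by
  simp [augSocle, Submodule.mem_annihilator, RingHom.mem_ker, mul_comm]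

theorem mul_eq_smul_of_mem_augSocle {ε : A →ₐ[k] k} {a : A} (ha : a ∈ augSocle ε) (b : A) :
    b * a = ε b • a := by
  have h := mem_augSocle.1 ha (b - algebraMap k A (ε b)) (by simp)
  rwa [sub_mul, sub_eq_zero, ← Algebra.smul_def] at h

theorem finrank_augSocle_le_finrank_quotient [Module.Finite k A] (ε : A →ₐ[k] k) {l : A}
    (hl : ε l = 0) : Module.finrank k (augSocle ε) ≤ Module.finrank k (A ⧸ Ideal.span {l}) := by
  let μ : A →ₗ[k] A := LinearMap.mulLeft k l
  have hker : (augSocle ε).restrictScalars k ≤ LinearMap.ker μ := fun a ha => mem_augSocle.1 ha l hl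
  have hrange : (Ideal.span {l}).restrictScalars k = LinearMap.range μ := by
    ext a
    rw [Submodule.restrictScalars_mem, Ideal.mem_span_singleton', LinearMap.mem_range]
    simp [μ, mul_comm]
  have hquot : Module.finrank k (A ⧸ Ideal.span {l}) + Module.finrank k (LinearMap.range μ) =
      Module.finrank k A :=
    hrange ▸ Submodule.finrank_quotient_add_finrank ((Ideal.span {l}).restrictScalars k)
  have hsum := LinearMap.finrank_range_add_finrank_ker μ
  calc Module.finrank k (augSocle ε) ≤ Module.finrank k (LinearMap.ker μ) :=
        Submodule.finrank_mono hker
    _ = Module.finrank k (A ⧸ Ideal.span {l}) := by omega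

end Socle

/-- Homomorphisms `R ⧸ I → M` correspond to the elements of `M` killed by `I`. -/
def quotientHomEquiv {R : Type*} [CommRing R] (I : Ideal R) (M : Type*) [AddCommGroup M]
    [Module R M] : ((R ⧸ I) →ₗ[R] M) ≃ₗ[R] Submodule.torsionBySet R M (I : Set R) where
  toFun f := ⟨f 1, (Submodule.mem_torsionBySet_iff _ _).2 fun r => by
    have hr : (r : R) • (1 : R ⧸ I) = 0 := by
      rw [Algebra.smul_def, mul_one]
      exact Ideal.Quotient.eq_zero_iff_mem.2 r.2
    rw [← map_smul, hr, map_zero]⟩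
  map_add' _ _ := rfl
  map_smul' _ _ := rfl
  invFun x := I.liftQ (LinearMap.toSpanSingleton R M x) fun r hr =>
    (Submodule.mem_torsionBySet_iff _ _).1 x.2 ⟨r, hr⟩
  left_inv f := by
    ext
    exact one_smul R _
  right_inv x := Subtype.ext (one_smul R _)

theorem socleDim_eq_finrank {k : Type u} [Field k] {R A : Type u} [CommRing R] [IsLocalRing R]
    [CommRing A] [Algebra k A] [Module.Finite k A] (φ : R →+* A) (hφ : Function.Surjective φ)
    (ε : A →ₐ[k] k) : socleDim φ = Module.finrank k (augSocle ε) := by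
  let _ : Algebra R A := φ.toAlgebra
  let εR : R →+* k := ε.toRingHom.comp φ
  have hε : Function.Surjective ε := fun c => ⟨algebraMap k A c, by simp⟩
  have hεR : Function.Surjective εR := hε.comp hφ
  have hker : RingHom.ker εR = IsLocalRing.maximalIdeal R :=
    IsLocalRing.eq_maximalIdeal (RingHom.ker_isMaximal_of_surjective _ hεR)
  let _ : Algebra R k := εR.toAlgebra
  have : IsScalarTower R k (augSocle ε) := ⟨fun r c m => Subtype.ext <| by
    change (ε (φ r) * c) • (m : A) = φ r * (c • (m : A))
    rw [mul_smul_comm, mul_eq_smul_of_mem_augSocle m.2, smul_smul, mul_comm]⟩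
  have htorsion : Submodule.torsionBySet R A (IsLocalRing.maximalIdeal R : Set R) =
      (augSocle ε).restrictScalars R := by
    ext a
    rw [← hker, Submodule.mem_torsionBySet_iff, Submodule.restrictScalars_mem, mem_augSocle,
      Subtype.forall, hφ.forall]
    rfl
  calc socleDim φ = Module.length R (augSocle ε) :=
        ((quotientHomEquiv _ A).trans (LinearEquiv.ofEq _ _ htorsion)).length_eq
    _ = Module.length k (augSocle ε) := Module.length_eq_of_surjective hεR
    _ = Module.finrank k (augSocle ε) := Module.length_eq_finrank ..

section HomogeneousRelation

open MvPolynomial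

variable {k : Type*} [Field k] {σ : Type*}

theorem aeval_smul_of_isHomogeneous {B : Type*} [CommRing B] [Algebra k B] {P : MvPolynomial σ k}
    {r : ℕ} (hP : P.IsHomogeneous r) (c : σ → k) (z : B) :
    aeval (fun i => c i • z) P = eval c P • z ^ r := by
  rw [aeval_def, eval₂_eq, eval_eq, Finset.sum_smul]
  refine Finset.sum_congr rfl fun d hd => ?_
  have hdeg : ∑ i ∈ d.support, d i = r := by
    rw [← Finsupp.degree_apply, Finsupp.degree_eq_weight_one]
    exact hP (mem_support_iff.1 hd)
  simp_rw [smul_pow]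
  rw [Finset.prod_smul, Finset.prod_pow_eq_pow_sum, hdeg, ← Algebra.smul_def, smul_smul]

theorem eval_mem_pow_succ_of_isHomogeneous {D : Type*} [CommRing D] {p : Ideal D} {y : σ → D}
    (hy : ∀ i, y i ∈ p) {Q : MvPolynomial σ D} {r : ℕ} (hQ : Q.IsHomogeneous r)
    (hcoeff : ∀ d, Q.coeff d ∈ p) : eval y Q ∈ p ^ (r + 1) := by
  rw [eval_eq]
  refine sum_mem fun d hd => ?_
  have hdeg : ∑ i ∈ d.support, d i = r := by
    rw [← Finsupp.degree_apply, Finsupp.degree_eq_weight_one]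
    exact hQ (mem_support_iff.1 hd)
  rw [pow_succ', ← hdeg, ← Finset.prod_pow_eq_pow_sum]
  exact Ideal.mul_mem_mul (hcoeff d) (Ideal.prod_mem_prod fun i _ => Ideal.pow_mem_pow (hy i) _)

theorem ideal_pow_le_pow_sup_pow_succ {D : Type*} [CommRing D] {p J : Ideal D} (hJ : J ≤ p)
    (h : p ≤ J ⊔ p ^ 2) (r : ℕ) : p ^ r ≤ J ^ r ⊔ p ^ (r + 1) := by
  induction r with
  | zero => simp
  | succ r ih =>
    calc p ^ (r + 1) ≤ (J ^ r ⊔ p ^ (r + 1)) * (J ⊔ p ^ 2) :=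
          (pow_succ p r).le.trans (Ideal.mul_mono ih h)
      _ = J ^ (r + 1) ⊔ p ^ (r + 1) * J ⊔ (J ^ r * p ^ 2 ⊔ p ^ (r + 1) * p ^ 2) := by
        rw [Ideal.mul_sup, Ideal.sup_mul, Ideal.sup_mul, pow_succ J]
      _ ≤ J ^ (r + 1) ⊔ p ^ (r + 1 + 1) := by
        refine sup_le (sup_le le_sup_left (le_sup_of_le_right ?_))
          (le_sup_of_le_right (sup_le ?_ ?_))
        · exact (Ideal.mul_mono_right hJ).trans (pow_succ p (r + 1)).ge
        · exact (Ideal.mul_mono_left (Ideal.pow_right_mono hJ r)).trans (pow_add p r 2).ge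
        · exact (pow_add p (r + 1) 2).ge.trans (Ideal.pow_le_pow_right (by omega))

theorem exists_isHomogeneous_sub_aeval_mem_pow_succ {D : Type*} [CommRing D] [Algebra k D]
    {ε : D →ₐ[k] k} {y : σ → D} (hy : ∀ i, ε (y i) = 0)
    (hgen : RingHom.ker ε ≤ Ideal.span (Set.range y) ⊔ RingHom.ker ε ^ 2) {r : ℕ} {f : D}
    (hf : f ∈ RingHom.ker ε ^ r) :
    ∃ P : MvPolynomial σ k, P.IsHomogeneous r ∧ f - aeval y P ∈ RingHom.ker ε ^ (r + 1) := by
  have hspan : Ideal.span (Set.range y) ≤ RingHom.ker ε := Ideal.span_le.2 (by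
    rintro _ ⟨i, rfl⟩
    exact hy i)
  obtain ⟨f₁, hf₁, f₂, hf₂, rfl⟩ :=
    Submodule.mem_sup.1 (ideal_pow_le_pow_sup_pow_succ hspan hgen r hf)
  obtain ⟨Q, hQ, rfl⟩ := (Ideal.mem_span_pow_iff_exists_isHomogeneous _ _).1 hf₁
  let P : MvPolynomial σ k := map (ε : D →+* k) Q
  have hdiff : eval y (Q - map (algebraMap k D) P) ∈ RingHom.ker ε ^ (r + 1) :=
    eval_mem_pow_succ_of_isHomogeneous hy (hQ.sub ((hQ.map _).map _)) fun d => by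
      simp [P, coeff_map, RingHom.mem_ker]
  refine ⟨P, hQ.map _, ?_⟩
  rw [map_sub, MvPolynomial.eval_map, ← MvPolynomial.aeval_def] at hdiff
  rw [add_sub_right_comm]
  exact add_mem hdiff hf₂

/-- Restricted to the line through `c`, a homogeneous relation of degree `r` that does not vanish
at `c` becomes `z ^ r ∈ (z) ^ (r + 1)`. -/
theorem pow_eq_zero_of_aeval_mem_pow_succ {B : Type*} [CommRing B] [Algebra k B] {J : Ideal B}
    (hJ : IsNilpotent J) {c : σ → k} {z : B} (hz : z ∈ J)
    (hgen : J ≤ Ideal.span (Set.range fun i => c i • z) ⊔ J ^ 2) {P : MvPolynomial σ k} {r : ℕ}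
    (hP : P.IsHomogeneous r) (hc : eval c P ≠ 0)
    (hPJ : aeval (fun i => c i • z) P ∈ J ^ (r + 1)) : J ≤ Ideal.span {z} ∧ z ^ r = 0 := by
  have hJz : J ≤ Ideal.span {z} := by
    refine (ideal_le_of_le_sup_sq_of_isNilpotent hJ hgen).trans (Ideal.span_le.2 ?_)
    rintro _ ⟨i, rfl⟩
    exact Submodule.smul_of_tower_mem _ _ (Ideal.mem_span_singleton_self z)
  refine ⟨hJz, ?_⟩
  rw [aeval_smul_of_isHomogeneous hP] at hPJ
  have hzr : z ^ r ∈ Ideal.span {z ^ (r + 1)} := by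
    rw [← Ideal.span_singleton_pow]
    refine Ideal.pow_right_mono hJz _ ?_
    rw [← inv_smul_smul₀ hc (z ^ r)]
    exact Submodule.smul_of_tower_mem _ _ hPJ
  obtain ⟨b, hb⟩ := Ideal.mem_span_singleton.1 hzr
  have hzb : IsNilpotent (z * b) := by
    obtain ⟨m, hm⟩ := hJ
    exact ⟨m, by simpa [hm] using Ideal.pow_mem_pow (J.mul_mem_right b hz) m⟩
  refine hzb.isUnit_one_sub.mul_left_eq_zero.1 ?_
  linear_combination hb

theorem finrank_le_of_pow_eq_zero {B : Type*} [CommRing B] [Algebra k B] {z : B} {r : ℕ}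
    (hB : ∀ b : B, ∃ c : k, b - algebraMap k B c ∈ Ideal.span {z}) (hz : z ^ r = 0) :
    Module.finrank k B ≤ r := by
  let V : Submodule k B := Submodule.span k (Set.range fun j : Fin r => z ^ (j : ℕ))
  have pow_mul_mem (m i : ℕ) (him : i + m = r) (b : B) : z ^ i * b ∈ V := by
    induction m generalizing i b with
    | zero =>
      obtain rfl : i = r := him
      rw [hz, zero_mul]
      exact zero_mem _
    | succ m ih =>
      obtain ⟨c, hc⟩ := hB b
      obtain ⟨b', hb'⟩ := Ideal.mem_span_singleton.1 hc
      rw [sub_eq_iff_eq_add.1 hb', mul_add, ← mul_assoc, ← pow_succ, mul_comm (z ^ i),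
        ← Algebra.smul_def]
      exact add_mem (ih (i + 1) (by omega) b')
        (Submodule.smul_mem _ _ (Submodule.subset_span ⟨⟨i, by omega⟩, rfl⟩))
  have htop : V = ⊤ := eq_top_iff.2 fun b _ => by simpa using pow_mul_mem r 0 (zero_add r) b
  calc Module.finrank k B = Module.finrank k V := by rw [htop, finrank_top]
    _ ≤ r := (finrank_range_le_card _).trans_eq (Fintype.card_fin r)

theorem exists_eq_smul_of_smul_eq_smul {M : Type*} [AddCommGroup M] [Module k M] {c : Fin 2 → k}
    (hc : c ≠ 0) {x : Fin 2 → M} (h : c 1 • x 0 = c 0 • x 1) : ∃ z, ∀ i, x i = c i • z := by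
  rcases eq_or_ne (c 0) 0 with h0 | h0
  · have h1 : c 1 ≠ 0 := fun h1 => hc (by ext i; fin_cases i <;> assumption)
    refine ⟨(c 1)⁻¹ • x 1, Fin.forall_fin_two.2 ⟨?_, (smul_inv_smul₀ h1 _).symm⟩⟩
    rw [smul_comm, ← h, inv_smul_smul₀ h1]
  · refine ⟨(c 0)⁻¹ • x 0, Fin.forall_fin_two.2 ⟨(smul_inv_smul₀ h0 _).symm, ?_⟩⟩
    rw [smul_comm, h, inv_smul_smul₀ h0]

end HomogeneousRelation

section SocleBound

variable {k : Type*} [Field k] {A D : Type*} [CommRing A] [CommRing D] [Algebra k A] [Algebra k D]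

theorem finrank_le_of_sub_aeval_mem_pow_succ {σ : Type*} {θ : D →ₐ[k] A}
    (hθ : Function.Surjective θ) {δ : D →ₐ[k] k} (hδ : IsNilpotent ((RingHom.ker δ).map θ))
    {y : σ → D} (hy : ∀ i, δ (y i) = 0)
    (hgen : RingHom.ker δ ≤ Ideal.span (Set.range y) ⊔ RingHom.ker δ ^ 2) {c : σ → k} {z : A}
    (hc0 : c ≠ 0) (hz : ∀ i, θ (y i) = c i • z) {f : D} (hf : θ f = 0) {P : MvPolynomial σ k}
    {r : ℕ} (hP : P.IsHomogeneous r) (hc : MvPolynomial.eval c P ≠ 0)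
    (hfP : f - MvPolynomial.aeval y P ∈ RingHom.ker δ ^ (r + 1)) :
    Module.finrank k A ≤ r := by
  set J := (RingHom.ker δ).map θ with hJ
  have hzJ : z ∈ J := by
    obtain ⟨i, hi⟩ := Function.ne_iff.1 hc0
    rw [← inv_smul_smul₀ hi z, ← hz]
    exact Submodule.smul_of_tower_mem _ _ (Ideal.mem_map_of_mem θ (hy i))
  have hθy : (fun i => θ (y i)) = fun i => c i • z := funext hz
  have hgenJ : J ≤ Ideal.span (Set.range fun i => c i • z) ⊔ J ^ 2 := by
    have h := Ideal.map_mono (f := θ) hgen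
    rwa [Ideal.map_sup, Ideal.map_pow, Ideal.map_span, ← hJ, ← Set.range_comp, Function.comp_def,
      hθy] at h
  have hPJ : MvPolynomial.aeval (fun i => c i • z) P ∈ J ^ (r + 1) := by
    have h := Ideal.mem_map_of_mem θ (neg_mem hfP)
    rwa [Ideal.map_pow, ← hJ, neg_sub, map_sub, hf, sub_zero, ← AlgHom.comp_apply,
      MvPolynomial.comp_aeval, hθy] at h
  obtain ⟨hJz, hzr⟩ := pow_eq_zero_of_aeval_mem_pow_succ hδ hzJ hgenJ hP hc hPJ
  refine finrank_le_of_pow_eq_zero (fun b => ?_) hzr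
  obtain ⟨d, rfl⟩ := hθ b
  refine ⟨δ d, hJz ?_⟩
  have hd : d - algebraMap k D (δ d) ∈ RingHom.ker δ := by simp [RingHom.mem_ker]
  simpa using Ideal.mem_map_of_mem θ hd

variable {g : D →ₐ[k] A} (hg : Function.Surjective g) {ε : A →ₐ[k] k}

include hg

/-- The quotient of `A` by the linear form vanishing at a point `c` outside the zero locus of the
leading form of `f` has dimension at most `r`, and the socle is no larger. -/
theorem finrank_augSocle_le_of_mem_pow [Infinite k] [Module.Finite k A]
    (hε : IsNilpotent (RingHom.ker ε)) {y : Fin 2 → D} (hy : ∀ i, ε (g (y i)) = 0)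
    (hgen : RingHom.ker (ε.comp g) ≤ Ideal.span (Set.range y) ⊔ RingHom.ker (ε.comp g) ^ 2)
    {f : D} (hf : g f = 0) {r : ℕ} (hr : r ≠ 0) (hfr : f ∈ RingHom.ker (ε.comp g) ^ r)
    (hfr' : f ∉ RingHom.ker (ε.comp g) ^ (r + 1)) :
    Module.finrank k (augSocle ε) ≤ r := by
  obtain ⟨P, hP, hfP⟩ := exists_isHomogeneous_sub_aeval_mem_pow_succ (ε := ε.comp g) hy hgen hfr
  obtain ⟨c, hc⟩ : ∃ c : Fin 2 → k, MvPolynomial.eval c P ≠ 0 := by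
    by_contra! h
    obtain rfl : P = 0 := MvPolynomial.funext fun c => by rw [h, map_zero]
    exact hfr' (by simpa using hfP)
  have hc0 : c ≠ 0 := by
    rintro rfl
    have h := aeval_smul_of_isHomogeneous hP (0 : Fin 2 → k) (0 : k)
    simp_all [zero_pow hr]
  let l : A := c 1 • g (y 0) - c 0 • g (y 1)
  have hl : ε l = 0 := by simp [l, hy]
  let q : A →ₐ[k] A ⧸ Ideal.span {l} := Ideal.Quotient.mkₐ k _
  have hnil : IsNilpotent ((RingHom.ker (ε.comp g)).map (q.comp g)) := by
    have hmap : (RingHom.ker (ε.comp g)).map g = RingHom.ker ε :=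
      Ideal.map_comap_of_surjective g hg (RingHom.ker ε)
    obtain ⟨m, hm⟩ := hε
    refine ⟨m, ?_⟩
    rw [← Ideal.map_mapₐ, hmap, ← Ideal.map_pow, hm]
    exact Ideal.map_bot
  obtain ⟨z, hz⟩ := exists_eq_smul_of_smul_eq_smul hc0 (x := fun i => q (g (y i))) (by
    rw [← sub_eq_zero, ← map_smul q, ← map_smul q, ← map_sub]
    exact Ideal.Quotient.eq_zero_iff_mem.2 (Ideal.mem_span_singleton_self _))
  have hqf : q.comp g f = 0 := by rw [AlgHom.comp_apply, hf, map_zero]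
  have hqg : Function.Surjective (q.comp g) := (Ideal.Quotient.mkₐ_surjective k _).comp hg
  exact (finrank_augSocle_le_finrank_quotient ε hl).trans
    (finrank_le_of_sub_aeval_mem_pow_succ hqg hnil hy hgen hc0 hz hqf hP hc hfP)

/-- `D` surjects onto the truncated polynomial ring of order `t`, through `A` if `ker g` has order
at least `t`. -/
theorem card_degLT_le_finrank [Module.Finite k A] {σ : Type*} [Finite σ] [DecidableEq σ]
    (hD : LiftsTrunc k D σ) (b : Module.Basis σ k (RingHom.ker (ε.comp g)).Cotangent) {t : ℕ}
    (ht : RingHom.ker g ≤ RingHom.ker (ε.comp g) ^ t) :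
    (TruncAlg.degLT σ t).card ≤ Module.finrank k A := by
  rcases t.eq_zero_or_pos with rfl | htpos
  · simp [TruncAlg.degLT_zero]
  obtain ⟨ψ, hψ, hψε⟩ :=
    hD.exists_surjective b (TruncAlg.isLowerSet_degLT t) (TruncAlg.zero_mem_degLT htpos)
  have hle : RingHom.ker (ε.comp g) ≤ (RingHom.ker (TruncAlg.aug (k := k)
      (TruncAlg.zero_mem_degLT (σ := σ) htpos))).comap ψ := fun d hd => (hψε d).trans hd
  have hker : RingHom.ker g ≤ RingHom.ker ψ := fun d hd => by
    have h := Ideal.le_comap_pow ψ t (Ideal.pow_right_mono hle t (ht hd))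
    rwa [TruncAlg.ker_aug_pow_eq_bot _ fun s hs => TruncAlg.mem_degLT.1 hs] at h
  let Ψ : A →ₐ[k] TruncAlg k (TruncAlg.degLT σ t) := AlgHom.liftOfSurjective g hg ψ hker
  have hΨ : Function.Surjective Ψ := fun a =>
    (hψ a).imp' g fun d hd => (AlgHom.liftOfSurjective_apply g hg ψ hker d).trans hd
  calc (TruncAlg.degLT σ t).card = Module.finrank k (TruncAlg k (TruncAlg.degLT σ t)) :=
        (TruncAlg.finrank (TruncAlg.isLowerSet_degLT t)).symm
    _ ≤ Module.finrank k A := LinearMap.finrank_le_finrank_of_surjective (f := Ψ.toLinearMap) hΨ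

theorem exists_finrank_augSocle_le [Infinite k] [Module.Finite k A]
    (hε : IsNilpotent (RingHom.ker ε)) (hD : LiftsTrunc k D (Fin 2))
    (b : Module.Basis (Fin 2) k (RingHom.ker (ε.comp g)).Cotangent) :
    ∃ r : ℕ, r * (r + 1) / 2 ≤ Module.finrank k A ∧ Module.finrank k (augSocle ε) ≤ r := by
  classical
  have hcard (t : ℕ) (ht : RingHom.ker g ≤ RingHom.ker (ε.comp g) ^ t) :
      t * (t + 1) / 2 ≤ Module.finrank k A :=
    (TruncAlg.card_degLT_fin_two t).ge.trans (card_degLT_le_finrank hg hD b ht)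
  have hex : ∃ t, ¬ RingHom.ker g ≤ RingHom.ker (ε.comp g) ^ (t + 1) := by
    by_contra! h
    have hle := hcard _ (h (2 * Module.finrank k A))
    rw [Nat.div_le_iff_le_mul_add_pred two_pos] at hle
    have hlt : 2 * Module.finrank k A + 1 <
        (2 * Module.finrank k A + 1) * (2 * Module.finrank k A + 1 + 1) :=
      lt_mul_of_one_lt_right (by omega) (by omega)
    omega
  let r := Nat.find hex
  have hr : r ≠ 0 := fun h0 => Nat.find_spec hex (by
    rw [show Nat.find hex = 0 from h0, zero_add, pow_one]
    exact fun d hd => (congrArg ε hd).trans (map_zero ε))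
  have hle : RingHom.ker g ≤ RingHom.ker (ε.comp g) ^ r := by
    have h := Nat.find_min hex (m := r - 1) (by omega)
    rwa [not_not, Nat.sub_add_cancel (Nat.one_le_iff_ne_zero.2 hr)] at h
  obtain ⟨f, hf, hfr⟩ := SetLike.not_le_iff_exists.1 (Nat.find_spec hex)
  obtain ⟨y, hy, -, hgen⟩ := exists_cotangent_generators b
  exact ⟨r, hcard r hle, finrank_augSocle_le_of_mem_pow hg hε hy hgen hf hr (hle hf) hfr⟩

end SocleBound

theorem triangular_le_iff_le_floor (r n : ℕ) :
    r * (r + 1) / 2 ≤ n ↔ r ≤ ⌊(Real.sqrt (1 + 8 * (n : ℝ)) - 1) / 2⌋₊ := by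
  have hsqrt : 1 ≤ Real.sqrt (1 + 8 * n) :=
    Real.one_le_sqrt.2 (le_add_of_nonneg_right (by positivity))
  have heven := Nat.div_mul_cancel (Nat.even_mul_succ_self r).two_dvd
  calc r * (r + 1) / 2 ≤ n ↔ r * (r + 1) ≤ 2 * n := by omega
    _ ↔ (r : ℝ) * (r + 1) ≤ 2 * n := by exact_mod_cast Iff.rfl
    _ ↔ (2 * (r : ℝ) + 1) ^ 2 ≤ 1 + 8 * n := by constructor <;> intro h <;> linarith
    _ ↔ 2 * (r : ℝ) + 1 ≤ Real.sqrt (1 + 8 * n) := (Real.le_sqrt' (by positivity)).symm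
    _ ↔ (r : ℝ) ≤ (Real.sqrt (1 + 8 * n) - 1) / 2 := by constructor <;> intro h <;> linarith
    _ ↔ r ≤ ⌊(Real.sqrt (1 + 8 * n) - 1) / 2⌋₊ := (Nat.le_floor_iff (by linarith)).symm

theorem socleDim_ringEquiv_comp {R A A' : Type u} [CommRing R] [IsLocalRing R] [CommRing A]
    [CommRing A'] (φ : R →+* A) (e : A ≃+* A') : socleDim (e.toRingHom.comp φ) = socleDim φ := by
  let _ : Algebra R A := φ.toAlgebra
  let _ : Algebra R A' := (e.toRingHom.comp φ).toAlgebra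
  let e' : A ≃ₐ[R] A' := AlgEquiv.ofRingEquiv (f := e) fun _ => rfl
  exact (e'.toLinearEquiv.congrRight (M := IsLocalRing.ResidueField R)).length_eq.symm

section Points

variable {k : Type u} [Field k]

theorem fromSpecStalk_comp_eq_SpecMap {ξ : Scheme.{u}} (s : ξ ⟶ Spec (.of k)) (p : ξ) :
    ξ.fromSpecStalk p ≫ s = Spec.map (((Scheme.ΓSpecIso (.of k)).inv ≫ s.appTop) ≫
      ξ.presheaf.germ ⊤ p trivial) := by
  rw [Spec.map_comp, Spec.map_comp, ← Scheme.fromSpecStalk_toSpecΓ, Category.assoc,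
    ← Scheme.toSpecΓ_naturality_assoc, toSpecΓ_SpecMap_ΓSpecIso_inv, Category.comp_id]

theorem germ_top_surjective {ξ : Scheme.{u}} [IsAffine ξ] [IsArtinianRing Γ(ξ, ⊤)] (p : ξ) :
    Function.Surjective (ξ.presheaf.germ ⊤ p trivial) := by
  let _ : Algebra Γ(ξ, ⊤) (ξ.presheaf.stalk p) := (ξ.presheaf.germ ⊤ p trivial).hom.toAlgebra
  have := (isAffineOpen_top ξ).isLocalization_stalk ⟨p, trivial⟩
  exact IsArtinianRing.localization_surjective
    ((isAffineOpen_top ξ).primeIdealOf ⟨p, trivial⟩).asIdeal.primeCompl (ξ.presheaf.stalk p)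

theorem isClosedImmersion_fromSpecStalk {ξ : Scheme.{u}} [IsAffine ξ] [IsArtinianRing Γ(ξ, ⊤)]
    (p : ξ) : IsClosedImmersion (ξ.fromSpecStalk p) := by
  rw [← (isAffineOpen_top ξ).fromSpecStalk_eq_fromSpecStalk (x := p) trivial]
  change IsClosedImmersion (Spec.map _ ≫ (isAffineOpen_top ξ).fromSpec)
  rw [IsAffineOpen.fromSpec_top]
  have : IsClosedImmersion (Spec.map (ξ.presheaf.germ ⊤ p trivial)) :=
    isClosedImmersion_SpecMap_iff.2 (germ_top_surjective p)
  infer_instance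

theorem exists_finrank_augSocle_le_of_isClosedImmersion [Infinite k] {X : Scheme.{u}}
    (f : X ⟶ Spec (.of k)) [SmoothOfRelativeDimension 2 f] {A : Type u} [CommRing A]
    [IsLocalRing A] [Algebra k A] [Module.Finite k A] {q : Spec (.of A) ⟶ X} [IsClosedImmersion q]
    (hq : q ≫ f = specHom k A) (ε : A →ₐ[k] k) (hε : IsNilpotent (RingHom.ker ε)) :
    ∃ r : ℕ, r * (r + 1) / 2 ≤ Module.finrank k A ∧ Module.finrank k (augSocle ε) ≤ r := by
  obtain ⟨D, _, _, j, g, _, -, hD, rfl⟩ := exists_chart_factorization f 2 q hq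
  have hg : Function.Surjective g := isClosedImmersion_SpecMap_iff.1
    (IsClosedImmersion.of_comp (Spec.map (CommRingCat.ofHom g.toRingHom)) j)
  have : Algebra.IsStandardSmooth k D :=
    Algebra.IsStandardSmoothOfRelativeDimension.isStandardSmooth 2
  exact exists_finrank_augSocle_le hg hε (.of_formallySmooth k D (Fin 2))
    (cotangentBasisOfStandardSmooth 2 (ε.comp g))

theorem socleDimAt_le [IsAlgClosed k] {X : Scheme.{u}} (f : X ⟶ Spec (.of k))
    [SmoothOfRelativeDimension 2 f] {n : ℕ} {ξ : Scheme.{u}} (i : ξ ⟶ X)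
    (hi : IsClosedSubschemeOfLength f n i) (p : ξ) :
    socleDimAt i p ≤ (⌊(Real.sqrt (1 + 8 * (n : ℝ)) - 1) / 2⌋₊ : ℕ∞) := by
  obtain ⟨hcl, hfin, hlen⟩ := hi
  let C := Γ(ξ, ⊤)
  let A := ξ.presheaf.stalk p
  let _ : Algebra k C := ((Scheme.ΓSpecIso (.of k)).inv ≫ (i ≫ f).appTop).hom.toAlgebra
  let _ : Algebra k A := (((Scheme.ΓSpecIso (.of k)).inv ≫ (i ≫ f).appTop) ≫
    ξ.presheaf.germ ⊤ p trivial).hom.toAlgebra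
  have : IsAffine ξ := isAffine_of_isAffineHom (i ≫ f)
  have hiso : ((Scheme.ΓSpecIso (.of k)).inv.hom).Finite :=
    .of_surjective _ (Scheme.ΓSpecIso (.of k)).symm.commRingCatIsoToRingEquiv.surjective
  have : Module.Finite k C := RingHom.finite_algebraMap.1 ((i ≫ f).finite_appTop.comp hiso)
  have : IsArtinianRing C := IsArtinianRing.of_finite k C
  let π : C →ₐ[k] A := { (ξ.presheaf.germ ⊤ p trivial).hom with commutes' := fun _ => rfl }
  have hπ : Function.Surjective π := germ_top_surjective p
  have : Module.Finite k A := .of_surjective π.toLinearMap hπ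
  have hA : Module.finrank k A ≤ n :=
    (LinearMap.finrank_le_finrank_of_surjective (f := π.toLinearMap) hπ).trans_eq hlen
  obtain ⟨ε, -, hε⟩ := exists_algHom_ker_eq_maximalIdeal k A
  let q : Spec (.of A) ⟶ X := ξ.fromSpecStalk p ≫ i
  have hq : q ≫ f = specHom k A := by
    rw [Category.assoc, fromSpecStalk_comp_eq_SpecMap]
    rfl
  have := isClosedImmersion_fromSpecStalk p
  have : IsClosedImmersion q := inferInstanceAs (IsClosedImmersion (ξ.fromSpecStalk p ≫ i))
  obtain ⟨r, hr, hsr⟩ := exists_finrank_augSocle_le_of_isClosedImmersion f hq ε hε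
  rw [socleDimAt, socleDim_eq_finrank _ (i.stalkMap_surjective p) ε]
  exact_mod_cast hsr.trans ((triangular_le_iff_le_floor r n).1 (hr.trans hA))

end Points

/-- The exponents of the monomials under the staircase of `b` steps with the first step raised
by `e`; they span an algebra of length `b * (b + 1) / 2 + e` with socle of dimension `b`. -/
def staircase (b e : ℕ) : Finset (Fin 2 →₀ ℕ) :=
  TruncAlg.degLT (Fin 2) b ∪ (Finset.Ico b (b + e)).image (Finsupp.single 1)

theorem mem_staircase {b e : ℕ} {s : Fin 2 →₀ ℕ} :
    s ∈ staircase b e ↔ s 0 + s 1 < b ∨ s 0 = 0 ∧ b ≤ s 1 ∧ s 1 < b + e := by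
  rw [staircase, Finset.mem_union, TruncAlg.mem_degLT, Finsupp.degree_eq_sum, Fin.sum_univ_two,
    Finset.mem_image]
  refine or_congr_right ⟨?_, fun ⟨h0, h1⟩ => ⟨s 1, Finset.mem_Ico.2 h1, ?_⟩⟩
  · rintro ⟨j, hj, rfl⟩
    simpa using hj
  · ext i
    fin_cases i <;> simp [h0]

theorem zero_mem_staircase {b : ℕ} (hb : 0 < b) (e : ℕ) : 0 ∈ staircase b e :=
  mem_staircase.2 (.inl hb)

theorem isLowerSet_staircase (b e : ℕ) : IsLowerSet (staircase b e : Set (Fin 2 →₀ ℕ)) := by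
  intro s t hts hs
  rw [Finset.mem_coe, mem_staircase] at *
  have h0 := hts 0
  have h1 := hts 1
  omega

theorem card_staircase (b e : ℕ) : (staircase b e).card = b * (b + 1) / 2 + e := by
  rw [staircase, Finset.card_union_of_disjoint, TruncAlg.card_degLT_fin_two,
    Finset.card_image_of_injective _ (Finsupp.single_injective 1), Nat.card_Ico,
    Nat.add_sub_cancel_left]
  rw [Finset.disjoint_left]
  intro s hs hs'
  obtain ⟨j, hj, rfl⟩ := Finset.mem_image.1 hs'
  rw [TruncAlg.mem_degLT, Finsupp.degree_single] at hs
  exact (Finset.mem_Ico.1 hj).1.not_gt hs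

theorem le_finrank_augSocle_staircase {k : Type*} [Field k] {b e : ℕ} (h0 : 0 ∈ staircase b e) :
    b ≤ Module.finrank k (augSocle (TruncAlg.aug (k := k) h0)) := by
  let corner (j : Fin b) : Fin 2 →₀ ℕ := Finsupp.single 0 (j : ℕ) +
    Finsupp.single 1 (if (j : ℕ) = 0 then b + e - 1 else b - 1 - j)
  have corner_zero (j) : corner j 0 = j := by simp [corner]
  have corner_one (j) : corner j 1 = if (j : ℕ) = 0 then b + e - 1 else b - 1 - j := by
    simp [corner]
  have corner_mem (j) : corner j ∈ staircase b e := by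
    rw [mem_staircase, corner_zero, corner_one]
    have := j.2
    split_ifs <;> omega
  have corner_maximal (j) (t) (ht : t ∈ staircase b e) (hjt : corner j ≤ t) : t = corner j := by
    have h0 := hjt 0
    have h1 := hjt 1
    rw [mem_staircase] at ht
    rw [corner_zero] at h0
    rw [corner_one] at h1
    have := j.2
    ext i
    fin_cases i
    · simp only [Fin.zero_eta, corner_zero]
      split_ifs at h1 <;> omega
    · simp only [Fin.mk_one, corner_one]
      split_ifs at h1 ⊢ <;> omega
  let v (j : Fin b) : augSocle (TruncAlg.aug (k := k) h0) :=
    ⟨TruncAlg.mono k _ (corner j), mem_augSocle.2 fun _ ha =>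
      TruncAlg.mul_mono_eq_zero_of_aug_eq_zero h0 (corner_maximal j) ha⟩
  have hS := isLowerSet_staircase b e
  have hv : LinearIndependent k v := by
    refine .of_comp ((augSocle (TruncAlg.aug (k := k) h0)).subtype.restrictScalars k)
      ((TruncAlg.mono_linearIndependent hS).comp (fun j => ⟨corner j, corner_mem j⟩)
        fun i j hij => ?_)
    have hij0 := DFunLike.congr_fun (congrArg Subtype.val hij) 0
    simpa only [corner_zero, Fin.val_inj] using hij0
  have := TruncAlg.finite (k := k) hS
  simpa using hv.fintype_card_le_finrank

section Existence

variable {k : Type u} [Field k]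

theorem finrank_Γ_Spec {T : Type u} [CommRing T] [Algebra k T] {s : Spec (.of T) ⟶ Spec (.of k)}
    (hs : s = specHom k T) :
    letI : Algebra k Γ(Spec (.of T), ⊤) :=
      ((Scheme.ΓSpecIso (.of k)).inv ≫ s.appTop).hom.toAlgebra
    Module.finrank k Γ(Spec (.of T), ⊤) = Module.finrank k T := by
  subst hs
  let _ : Algebra k Γ(Spec (.of T), ⊤) :=
    ((Scheme.ΓSpecIso (.of k)).inv ≫ (specHom k T).appTop).hom.toAlgebra
  let e : T ≃+* Γ(Spec (.of T), ⊤) := (Scheme.ΓSpecIso (.of T)).symm.commRingCatIsoToRingEquiv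
  have he : ∀ c : k, e (algebraMap k T c) = algebraMap k Γ(Spec (.of T), ⊤) c := fun c =>
    congr($(Scheme.ΓSpecIso_inv_naturality (CommRingCat.ofHom (algebraMap k T))) c)
  exact (AlgEquiv.ofRingEquiv he).toLinearEquiv.finrank_eq.symm

theorem nonempty_algHom_of_finiteType (k D : Type*) [Field k] [IsAlgClosed k] [CommRing D]
    [Nontrivial D] [Algebra k D] [Algebra.FiniteType k D] : Nonempty (D →ₐ[k] k) := by
  obtain ⟨m, hm⟩ := Ideal.exists_maximal D
  let _ : Field (D ⧸ m) := Ideal.Quotient.field m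
  have : Module.Finite k (D ⧸ m) := finite_of_finite_type_of_isJacobsonRing k (D ⧸ m)
  have hb : Function.Bijective (algebraMap k (D ⧸ m)) :=
    IsAlgClosed.algebraMap_bijective_of_isIntegral
  exact ⟨((AlgEquiv.ofBijective (Algebra.ofId k (D ⧸ m)) hb).symm : D ⧸ m →ₐ[k] k).comp
    (Ideal.Quotient.mkₐ k m)⟩

theorem exists_isClosedImmersion_truncAlg [IsAlgClosed k] {X : Scheme.{u}} [Nonempty X]
    (f : X ⟶ Spec (.of k)) {n : ℕ} [SmoothOfRelativeDimension n f] [IsSeparated f]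
    {S : Finset (Fin n →₀ ℕ)} (hS : IsLowerSet (S : Set (Fin n →₀ ℕ))) (h0 : 0 ∈ S) :
    ∃ q : Spec (.of (TruncAlg k S)) ⟶ X, IsClosedImmersion q ∧ q ≫ f = specHom k _ := by
  obtain ⟨x⟩ := ‹Nonempty X›
  obtain ⟨D, _, _, j, hj, ⟨y, -⟩, hjf, hD⟩ := exists_smooth_chart f n x
  have : Nontrivial D := y.nontrivial
  have : Algebra.IsStandardSmooth k D :=
    Algebra.IsStandardSmoothOfRelativeDimension.isStandardSmooth n
  obtain ⟨ε⟩ := nonempty_algHom_of_finiteType k D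
  obtain ⟨φ, hφ, -⟩ := (LiftsTrunc.of_formallySmooth k D (Fin n)).exists_surjective
    (cotangentBasisOfStandardSmooth n ε) hS h0
  let q : Spec (.of (TruncAlg k S)) ⟶ X := Spec.map (CommRingCat.ofHom φ.toRingHom) ≫ j
  have : IsClosedImmersion (Spec.map (CommRingCat.ofHom φ.toRingHom)) :=
    isClosedImmersion_SpecMap_iff.2 hφ
  have hq : q ≫ f = specHom k (TruncAlg k S) := by
    rw [Category.assoc, hjf, SpecMap_comp_specHom]
  have : IsFinite (q ≫ f) := by
    rw [hq]
    exact (IsFinite.SpecMap_iff _).2 (RingHom.finite_algebraMap.2 (TruncAlg.finite hS))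
  exact ⟨q, (IsClosedImmersion.iff_isFinite_and_mono _).2 ⟨.of_comp _ f, inferInstance⟩, hq⟩

theorem isClosedSubschemeOfLength_finrank {X : Scheme.{u}} {f : X ⟶ Spec (.of k)} {T : Type u}
    [CommRing T] [Algebra k T] [Module.Finite k T] {q : Spec (.of T) ⟶ X}
    (hcl : IsClosedImmersion q) (hq : q ≫ f = specHom k T) :
    IsClosedSubschemeOfLength f (Module.finrank k T) q := by
  refine ⟨hcl, ?_, finrank_Γ_Spec hq⟩
  rw [hq]
  exact (IsFinite.SpecMap_iff _).2 (RingHom.finite_algebraMap.2 inferInstance)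

theorem socleDimAt_closedPoint {X : Scheme.{u}} {T : Type u} [CommRing T] [IsLocalRing T]
    [Algebra k T] [Module.Finite k T] (q : Spec (.of T) ⟶ X) [IsClosedImmersion q]
    (ε : T →ₐ[k] k) :
    socleDimAt q (IsLocalRing.closedPoint T) = Module.finrank k (augSocle ε) := by
  let e : (Spec (.of T)).presheaf.stalk (IsLocalRing.closedPoint T) ≃+* T :=
    (stalkClosedPointIso (.of T)).commRingCatIsoToRingEquiv
  exact (socleDim_ringEquiv_comp _ e).symm.trans
    (socleDim_eq_finrank _ (e.surjective.comp (q.stalkMap_surjective _)) ε)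

theorem exists_le_socleDimAt [IsAlgClosed k] {X : Scheme.{u}} [Nonempty X]
    (f : X ⟶ Spec (.of k)) [SmoothOfRelativeDimension 2 f] [IsSeparated f] {b : ℕ} (hb : 0 < b)
    (e : ℕ) : ∃ (ξ : Scheme.{u}) (i : ξ ⟶ X), IsClosedSubschemeOfLength f (b * (b + 1) / 2 + e) i ∧
      ∃ p : ξ, (b : ℕ∞) ≤ socleDimAt i p := by
  have hS := isLowerSet_staircase b e
  have h0 := zero_mem_staircase hb e
  obtain ⟨q, hcl, hq⟩ := exists_isClosedImmersion_truncAlg f hS h0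
  have : IsLocalRing (TruncAlg k (staircase b e)) := TruncAlg.isLocalRing h0
  have : Module.Finite k (TruncAlg k (staircase b e)) := TruncAlg.finite hS
  refine ⟨_, q, ?_, IsLocalRing.closedPoint _, ?_⟩
  · rw [← card_staircase, ← TruncAlg.finrank (k := k) hS]
    exact isClosedSubschemeOfLength_finrank hcl hq
  · rw [socleDimAt_closedPoint q (TruncAlg.aug h0)]
    exact_mod_cast le_finrank_augSocle_staircase h0

end Existence

section HilbertFunctions

open Filter

/-- A sequence of natural numbers given by a polynomial from some point on, as Hilbert–Samuel
functions are. -/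
def IsEventuallyPolynomial (h : ℕ → ℕ) : Prop :=
  ∃ P : Polynomial ℝ, ∀ᶠ t in atTop, (h t : ℝ) = P.eval (t : ℝ)

namespace IsEventuallyPolynomial

theorem zero : IsEventuallyPolynomial fun _ => 0 :=
  ⟨0, by simp⟩

theorem of_add_eq {a b c d : ℕ → ℕ} (ha : IsEventuallyPolynomial a) (hb : IsEventuallyPolynomial b)
    (hc : IsEventuallyPolynomial c) (h : ∀ t, a t + b t = c t + d t) :
    IsEventuallyPolynomial d := by
  obtain ⟨P, hP⟩ := ha
  obtain ⟨Q, hQ⟩ := hb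
  obtain ⟨R, hR⟩ := hc
  refine ⟨P + Q - R, ?_⟩
  filter_upwards [hP, hQ, hR] with t hPt hQt hRt
  rw [Polynomial.eval_sub, Polynomial.eval_add, ← hPt, ← hQt, ← hRt, eq_sub_iff_add_eq']
  exact_mod_cast (h t).symm

theorem degree_le_of_eventually_div_pow_le {h : ℕ → ℕ} {P : Polynomial ℝ}
    (hP : ∀ᶠ t in atTop, (h t : ℝ) = P.eval (t : ℝ)) {d : ℕ} {B : ℝ}
    (hB : ∀ᶠ t : ℕ in atTop, (h t : ℝ) / (t : ℝ) ^ d ≤ B) : P.degree ≤ d := by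
  by_contra! hlt
  rw [← Polynomial.degree_X_pow (R := ℝ) d] at hlt
  have htop := (P.abs_div_tendsto_atTop_atTop_of_degree_gt _ hlt
    (pow_ne_zero _ Polynomial.X_ne_zero)).comp (tendsto_natCast_atTop_atTop (R := ℝ))
  obtain ⟨t, hgt, hle, heq⟩ := ((htop.eventually_gt_atTop B).and (hB.and hP)).exists
  rw [Function.comp_apply, Polynomial.eval_pow, Polynomial.eval_X, ← heq,
    abs_of_nonneg (by positivity)] at hgt
  exact hle.not_gt hgt

theorem exists_tendsto_div_pow {h : ℕ → ℕ} (hh : IsEventuallyPolynomial h) {d : ℕ} {B : ℝ}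
    (hB : ∀ᶠ t : ℕ in atTop, (h t : ℝ) / (t : ℝ) ^ d ≤ B) :
    ∃ μ : ℝ, Tendsto (fun t : ℕ => (h t : ℝ) / (t : ℝ) ^ d) atTop (nhds μ) := by
  obtain ⟨P, hP⟩ := hh
  have hdeg := degree_le_of_eventually_div_pow_le hP hB
  rw [← Polynomial.degree_X_pow (R := ℝ) d] at hdeg
  obtain ⟨μ, hμ⟩ : ∃ μ : ℝ, Tendsto
      (fun x : ℝ => P.eval x / (Polynomial.X ^ d : Polynomial ℝ).eval x) atTop (nhds μ) := by
    obtain hlt | heq := hdeg.lt_or_eq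
    · exact ⟨0, P.div_tendsto_atTop_zero_of_degree_lt _ hlt⟩
    · exact ⟨_, P.div_tendsto_atTop_leadingCoeff_div_of_degree_eq _ heq⟩
  refine ⟨μ, (hμ.comp tendsto_natCast_atTop_atTop).congr' ?_⟩
  filter_upwards [hP] with t ht
  rw [Function.comp_apply, Polynomial.eval_pow, Polynomial.eval_X, ht]

end IsEventuallyPolynomial

section MonomialCount

variable {σ : Type*} [Finite σ]

theorem isEventuallyPolynomial_card_degLT_sub (σ : Type*) [Finite σ] (c : ℕ) :
    IsEventuallyPolynomial fun t => (TruncAlg.degLT σ (t - c)).card := by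
  refine ⟨Polynomial.C (((Nat.card σ).factorial : ℝ)⁻¹) * (descPochhammer ℝ (Nat.card σ)).comp
    (Polynomial.X + Polynomial.C ((Nat.card σ : ℝ) - 1 - c)), ?_⟩
  filter_upwards [eventually_ge_atTop (c + 1)] with t ht
  obtain ⟨r, rfl⟩ := Nat.exists_eq_add_of_le ht
  rw [show c + 1 + r - c = r + 1 by omega, TruncAlg.card_degLT_succ,
    Nat.cast_choose_eq_descPochhammer_div ℝ, div_eq_inv_mul]
  simp only [Polynomial.eval_mul, Polynomial.eval_C, Polynomial.eval_comp, Polynomial.eval_add,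
    Polynomial.eval_X]
  congr 2
  push_cast
  ring

theorem card_filter_le_degLT [DecidableLE (σ →₀ ℕ)] (g : σ →₀ ℕ) (t : ℕ) :
    ((TruncAlg.degLT σ t).filter (g ≤ ·)).card = (TruncAlg.degLT σ (t - g.degree)).card := by
  symm
  refine Finset.card_bij (fun s _ => g + s) (fun s hs => ?_) (fun a _ b _ h => add_left_cancel h)
    fun s hs => ?_
  · rw [TruncAlg.mem_degLT] at hs
    rw [Finset.mem_filter, TruncAlg.mem_degLT, map_add]
    exact ⟨by omega, le_self_add⟩
  · obtain ⟨hst, hgs⟩ := Finset.mem_filter.1 hs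
    obtain ⟨r, rfl⟩ := exists_add_of_le hgs
    rw [TruncAlg.mem_degLT, map_add] at hst
    exact ⟨r, TruncAlg.mem_degLT.2 (by omega), rfl⟩

open Classical in
theorem isEventuallyPolynomial_card_filter_exists_le (G : Finset (σ →₀ ℕ)) :
    IsEventuallyPolynomial fun t =>
      ((TruncAlg.degLT σ t).filter fun s => ∃ g ∈ G, g ≤ s).card := by
  induction hn : G.card using Nat.strong_induction_on generalizing G with
  | _ n ih =>
    induction G using Finset.induction_on with
    | empty => simpa using IsEventuallyPolynomial.zero
    | insert g G hg _ =>
      rw [Finset.card_insert_of_notMem hg] at hn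
      have hG := ih G.card (by omega) G rfl
      have hinter := ih _ ((Finset.card_image_le (s := G) (f := (g ⊔ ·))).trans_lt (by omega))
        (G.image (g ⊔ ·)) rfl
      refine (isEventuallyPolynomial_card_degLT_sub σ g.degree).of_add_eq hG hinter fun t => ?_
      rw [← card_filter_le_degLT, ← Finset.card_union_add_card_inter, add_comm]
      congr 2
      · ext s
        simp only [Finset.mem_inter, Finset.mem_filter, Finset.mem_image]
        constructor
        · rintro ⟨⟨hs, h⟩, -, g', hg', h'⟩
          exact ⟨hs, _, ⟨g', hg', rfl⟩, sup_le h h'⟩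
        · rintro ⟨hs, _, ⟨g', hg', rfl⟩, h'⟩
          exact ⟨⟨hs, le_sup_left.trans h'⟩, hs, g', hg', le_sup_right.trans h'⟩
      · ext s
        simp only [Finset.mem_union, Finset.mem_filter, Finset.mem_insert, exists_eq_or_imp]
        tauto

theorem exists_finset_mem_iff_of_isUpperSet {α : Type*} [PartialOrder α] [WellQuasiOrderedLE α]
    {U : Set α} (hU : IsUpperSet U) : ∃ G : Finset α, ∀ s, s ∈ U ↔ ∃ g ∈ G, g ≤ s := by
  have hfin : {s | Minimal (· ∈ U) s}.Finite :=
    (setOfPred_minimal_antichain _).finite_of_partiallyWellOrderedOn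
      (Set.isPWO_of_wellQuasiOrderedLE _)
  refine ⟨hfin.toFinset, fun s => ⟨fun hs => ?_, ?_⟩⟩
  · obtain ⟨g, hg, hmin⟩ := exists_minimal_le_of_wellFoundedLT (· ∈ U) s hs
    exact ⟨g, hfin.mem_toFinset.2 hmin, hg⟩
  · rintro ⟨g, hg, hgs⟩
    exact hU hgs (hfin.mem_toFinset.1 hg).prop

open Classical in
theorem isEventuallyPolynomial_card_of_isLowerSet {L : Set (σ →₀ ℕ)} (hL : IsLowerSet L) :
    IsEventuallyPolynomial fun t => ((TruncAlg.degLT σ t).filter (· ∈ L)).card := by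
  obtain ⟨G, hG⟩ := exists_finset_mem_iff_of_isUpperSet hL.compl
  refine (isEventuallyPolynomial_card_degLT_sub σ 0).of_add_eq .zero
    (isEventuallyPolynomial_card_filter_exists_le G) fun t => ?_
  simp only [← hG, Set.mem_compl_iff]
  rw [add_zero, Nat.sub_zero, add_comm, Finset.card_filter_add_card_filter_not]

theorem factorial_mul_card_degLT_le {d : ℕ} (hd : Nat.card σ ≤ d) (t : ℕ) :
    d.factorial * (TruncAlg.degLT σ t).card ≤ (t + d) ^ d := by
  obtain _ | r := t
  · simp [TruncAlg.degLT_zero]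
  calc d.factorial * (TruncAlg.degLT σ (r + 1)).card
      ≤ d.factorial * (r + d).choose d := by
        rw [TruncAlg.card_degLT_succ, ← Nat.choose_symm_add, ← Nat.choose_symm_add]
        gcongr
    _ = (r + d).descFactorial d := (Nat.descFactorial_eq_factorial_mul_choose ..).symm
    _ ≤ (r + d) ^ d := Nat.descFactorial_le_pow ..
    _ ≤ (r + 1 + d) ^ d := by gcongr; omega

theorem IsEventuallyPolynomial.exists_tendsto_factorial_mul_div_pow {h : ℕ → ℕ}
    (hh : IsEventuallyPolynomial h) {n d : ℕ} (hd : Nat.card σ ≤ d)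
    (hle : ∀ t, h t ≤ n * (TruncAlg.degLT σ t).card) :
    ∃ μ : ℝ, Tendsto (fun t : ℕ => (d.factorial : ℝ) * (h t : ℝ) / (t : ℝ) ^ d) atTop (nhds μ) ∧
      μ ≤ n := by
  have hbound : ∀ᶠ t : ℕ in atTop,
      (d.factorial : ℝ) * (h t : ℝ) / (t : ℝ) ^ d ≤ n * (1 + (d : ℝ) / t) ^ d := by
    filter_upwards [eventually_gt_atTop 0] with t ht
    have hdh : d.factorial * h t ≤ n * (t + d) ^ d := calc
      d.factorial * h t ≤ d.factorial * (n * (TruncAlg.degLT σ t).card) := by gcongr; exact hle t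
      _ = n * (d.factorial * (TruncAlg.degLT σ t).card) := mul_left_comm ..
      _ ≤ n * (t + d) ^ d := by gcongr; exact factorial_mul_card_degLT_le hd t
    have : (0 : ℝ) < t := by exact_mod_cast ht
    rw [div_le_iff₀ (by positivity), mul_assoc, ← mul_pow,
      show (1 + (d : ℝ) / t) * t = t + d by field_simp]
    exact_mod_cast hdh
  have hlim : Tendsto (fun t : ℕ => (n : ℝ) * (1 + (d : ℝ) / t) ^ d) atTop (nhds n) := by
    simpa using (((tendsto_const_div_atTop_nhds_zero_nat (d : ℝ)).const_add 1).pow d).const_mul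
      (n : ℝ)
  have hB : ∀ᶠ t : ℕ in atTop, (h t : ℝ) / (t : ℝ) ^ d ≤ n + 1 := by
    filter_upwards [hbound, hlim.eventually_lt_const (lt_add_one _)] with t hle hlt
    have hfac : (1 : ℝ) ≤ d.factorial := by exact_mod_cast d.factorial_pos
    calc (h t : ℝ) / (t : ℝ) ^ d ≤ d.factorial * ((h t : ℝ) / (t : ℝ) ^ d) :=
          le_mul_of_one_le_left (by positivity) hfac
      _ ≤ n + 1 := by rw [← mul_div_assoc]; exact hle.trans hlt.le
  obtain ⟨μ, hμ⟩ := hh.exists_tendsto_div_pow hB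
  have hμ' := hμ.const_mul (d.factorial : ℝ)
  simp only [← mul_div_assoc] at hμ'
  exact ⟨_, hμ', le_of_tendsto_of_tendsto hμ' hlim hbound⟩

end MonomialCount

end HilbertFunctions

section Monomials

variable {k B σ : Type*} [Field k] [CommRing B] [Algebra k B]

/-- The monomial with exponents `s` in the elements `y` of a commutative ring. -/
def monomialEval (y : σ → B) (s : σ →₀ ℕ) : B := s.prod fun i e => y i ^ e

theorem monomialEval_add (y : σ → B) (s t : σ →₀ ℕ) :
    monomialEval y (s + t) = monomialEval y s * monomialEval y t :=
  Finsupp.prod_add_index' (fun _ => pow_zero _) fun _ _ _ => pow_add ..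

theorem monomialEval_mem_pow {y : σ → B} {Q : Ideal B} (hy : ∀ i, y i ∈ Q) (s : σ →₀ ℕ) :
    monomialEval y s ∈ Q ^ s.degree := by
  rw [Finsupp.degree_apply, ← Finset.prod_pow_eq_pow_sum]
  exact Ideal.prod_mem_prod fun i _ => Ideal.pow_mem_pow (hy i) _

theorem mul_mem_span_of_forall_mem_span {S T : Set B} {x z : B} (hx : x ∈ Submodule.span k S)
    (h : ∀ b ∈ S, b * z ∈ Submodule.span k T) : x * z ∈ Submodule.span k T := by
  induction hx using Submodule.span_induction with
  | mem b hb => exact h b hb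
  | zero => simp only [zero_mul, zero_mem]
  | add a b _ _ ha hb => rw [add_mul]; exact add_mem ha hb
  | smul c b _ hb => rw [smul_mul_assoc]; exact Submodule.smul_mem _ _ hb

theorem span_image_quotientMk_eq_top {I : Ideal B} {S : Set B}
    (h : Submodule.span k S ⊔ I.restrictScalars k = ⊤) :
    Submodule.span k (Ideal.Quotient.mk I '' S) = ⊤ := by
  refine eq_top_iff.2 fun b _ => ?_
  obtain ⟨b, rfl⟩ := Ideal.Quotient.mk_surjective b
  obtain ⟨a, ha, c, hc, rfl⟩ := Submodule.mem_sup.1 (h ▸ Submodule.mem_top : b ∈ _)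
  rw [map_add, Ideal.Quotient.eq_zero_iff_mem.2 hc, add_zero]
  have hmem := Submodule.mem_map_of_mem (f := (Ideal.Quotient.mkₐ k I).toLinearMap) ha
  rwa [Submodule.map_span] at hmem

section Spanning

variable {ι : Type*} {y : σ → B} {Q : Ideal B} {v : ι → B}

theorem pow_le_span_sup_pow_succ (hy : ∀ i, y i ∈ Q) (hQ : Q ≤ Ideal.span (Set.range y) ⊔ Q ^ 2)
    (hv : Submodule.span k (Set.range v) ⊔ Q.restrictScalars k = ⊤) (r : ℕ) :
    (Q ^ r).restrictScalars k ≤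
      Submodule.span k {b | ∃ j s, s.degree = r ∧ b = v j * monomialEval y s} ⊔
        (Q ^ (r + 1)).restrictScalars k := by
  intro b hb
  have hJ : Ideal.span (Set.range y) ≤ Q := Ideal.span_le.2 (Set.range_subset_iff.2 hy)
  obtain ⟨b₁, hb₁, b₂, hb₂, rfl⟩ := Submodule.mem_sup.1 (ideal_pow_le_pow_sup_pow_succ hJ hQ r hb)
  refine add_mem ?_ (Submodule.mem_sup_right hb₂)
  obtain ⟨P, hP, rfl⟩ := (Ideal.mem_span_pow_iff_exists_isHomogeneous _ _).1 hb₁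
  rw [MvPolynomial.eval_eq]
  refine sum_mem fun s hs => ?_
  have hsr : s.degree = r := by
    by_contra hne
    exact MvPolynomial.mem_support_iff.1 hs (hP.coeff_eq_zero hne)
  obtain ⟨c, hc, q, hq, hcq⟩ :=
    Submodule.mem_sup.1 (hv ▸ Submodule.mem_top : P.coeff s ∈ _)
  rw [← hcq, add_mul]
  refine add_mem (Submodule.mem_sup_left (mul_mem_span_of_forall_mem_span hc ?_))
    (Submodule.mem_sup_right ?_)
  · rintro _ ⟨j, rfl⟩
    exact Submodule.subset_span ⟨j, s, hsr, rfl⟩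
  · change q * monomialEval y s ∈ Q ^ (r + 1)
    rw [pow_succ', ← hsr]
    exact Ideal.mul_mem_mul hq (monomialEval_mem_pow hy s)

theorem pow_le_span_sup_pow (hy : ∀ i, y i ∈ Q) (hQ : Q ≤ Ideal.span (Set.range y) ⊔ Q ^ 2)
    (hv : Submodule.span k (Set.range v) ⊔ Q.restrictScalars k = ⊤) (r t : ℕ) :
    (Q ^ r).restrictScalars k ≤
      Submodule.span k {b | ∃ j s, r ≤ s.degree ∧ s.degree < t ∧ b = v j * monomialEval y s} ⊔
        (Q ^ t).restrictScalars k := by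
  induction t with
  | zero => simp
  | succ t ih =>
    obtain htr | hrt := lt_or_ge t r
    · exact le_sup_of_le_right (Ideal.pow_le_pow_right htr)
    refine ih.trans (sup_le (le_sup_of_le_left (Submodule.span_mono ?_))
      ((pow_le_span_sup_pow_succ hy hQ hv t).trans (sup_le_sup_right (Submodule.span_mono ?_) _)))
    · rintro b ⟨j, s, hrs, hst, rfl⟩
      exact ⟨j, s, hrs, hst.trans t.lt_succ_self, rfl⟩
    · rintro b ⟨j, s, rfl, rfl⟩
      exact ⟨j, s, hrt, s.degree.lt_succ_self, rfl⟩

theorem finite_and_finrank_quotient_pow_le [Finite σ] [Finite ι] (hy : ∀ i, y i ∈ Q)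
    (hQ : Q ≤ Ideal.span (Set.range y) ⊔ Q ^ 2)
    (hv : Submodule.span k (Set.range v) ⊔ Q.restrictScalars k = ⊤) (t : ℕ) :
    Module.Finite k (B ⧸ Q ^ t) ∧
      Module.finrank k (B ⧸ Q ^ t) ≤ Nat.card ι * (TruncAlg.degLT σ t).card := by
  have := Fintype.ofFinite ι
  let w (x : ι × TruncAlg.degLT σ t) : B ⧸ Q ^ t :=
    Ideal.Quotient.mk _ (v x.1 * monomialEval y x.2)
  have htop : (⊤ : Submodule k B) ≤ (Q ^ 0).restrictScalars k := by simp
  have hw : Submodule.span k (Set.range w) = ⊤ := by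
    refine eq_top_iff.2 ((span_image_quotientMk_eq_top (top_le_iff.1
      (htop.trans (pow_le_span_sup_pow hy hQ hv 0 t)))).ge.trans (Submodule.span_mono ?_))
    rintro _ ⟨_, ⟨j, s, -, hst, rfl⟩, rfl⟩
    exact ⟨(j, ⟨s, TruncAlg.mem_degLT.2 hst⟩), rfl⟩
  refine ⟨⟨hw ▸ Submodule.fg_span (Set.finite_range w)⟩, ?_⟩
  have hcard := finrank_range_le_card (R := k) w
  rw [Set.finrank, hw, finrank_top] at hcard
  simpa using hcard

theorem pow_le_span_monomialEval_sup_pow {m : Ideal B} (hm : m = Ideal.span (Set.range y))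
    (hk : ∀ b : B, ∃ c : k, b - algebraMap k B c ∈ m) (r t : ℕ) :
    (m ^ r).restrictScalars k ≤
      Submodule.span k (monomialEval y '' {s | r ≤ s.degree ∧ s.degree < t}) ⊔
        (m ^ t).restrictScalars k := by
  have hy : ∀ i, y i ∈ m := fun i => hm ▸ Ideal.subset_span ⟨i, rfl⟩
  have hone : Submodule.span k (Set.range fun _ : Unit => (1 : B)) ⊔ m.restrictScalars k = ⊤ := by
    refine eq_top_iff.2 fun b _ => ?_
    obtain ⟨c, hc⟩ := hk b
    rw [← add_sub_cancel (algebraMap k B c) b]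
    refine Submodule.add_mem_sup ?_ hc
    rw [Algebra.algebraMap_eq_smul_one]
    exact Submodule.smul_mem _ _ (Submodule.subset_span ⟨(), rfl⟩)
  refine (pow_le_span_sup_pow hy (le_sup_of_le_left hm.le) hone r t).trans
    (sup_le_sup_right (Submodule.span_mono ?_) _)
  rintro _ ⟨-, s, hrs, hst, rfl⟩
  exact ⟨s, ⟨hrs, hst⟩, (one_mul _).symm⟩

end Spanning

section StandardMonomials

variable [LinearOrder σ]

/-- The exponents of the standard monomials in `y` for the tangent cone of `m`: those not
congruent, modulo the appropriate power of `m`, to a combination of larger monomials in the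
degree-lexicographic order. -/
def standardMonomials (k : Type*) [Field k] [Algebra k B] (y : σ → B) (m : Ideal B) :
    Set (σ →₀ ℕ) :=
  {s | monomialEval y s ∉ Submodule.span k (monomialEval y '' {s' | toDegLex s < toDegLex s'}) ⊔
    (m ^ (s.degree + 1)).restrictScalars k}

theorem isLowerSet_standardMonomials {y : σ → B} {m : Ideal B} (hy : ∀ i, y i ∈ m) :
    IsLowerSet (standardMonomials k y m) := by
  intro a b hba ha hb
  obtain ⟨c, rfl⟩ := exists_add_of_le hba
  refine ha ?_
  obtain ⟨x, hx, z, hz, hxz⟩ := Submodule.mem_sup.1 hb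
  rw [monomialEval_add, ← hxz, add_mul]
  refine add_mem (Submodule.mem_sup_left (mul_mem_span_of_forall_mem_span hx ?_))
    (Submodule.mem_sup_right ?_)
  · rintro _ ⟨s, hs, rfl⟩
    refine Submodule.subset_span ⟨s + c, ?_, monomialEval_add y s c⟩
    exact add_lt_add_left (α := DegLex (σ →₀ ℕ)) hs (toDegLex c)
  · change z * monomialEval y c ∈ m ^ ((b + c).degree + 1)
    rw [map_add, add_right_comm, pow_add]
    exact Ideal.mul_mem_mul hz (monomialEval_mem_pow hy c)

variable {y : σ → B} {m : Ideal B}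

theorem monomialEval_mem_of_notMem_standardMonomials (hm : m = Ideal.span (Set.range y))
    (hk : ∀ b : B, ∃ c : k, b - algebraMap k B c ∈ m) {t : ℕ} {s : σ →₀ ℕ}
    (hs : s ∉ standardMonomials k y m) :
    monomialEval y s ∈ Submodule.span k
      (monomialEval y '' {s' | toDegLex s < toDegLex s' ∧ s'.degree < t}) ⊔
        (m ^ t).restrictScalars k := by
  have hy : ∀ i, y i ∈ m := fun i => hm ▸ Ideal.subset_span ⟨i, rfl⟩
  refine SetLike.le_def.1 (sup_le (Submodule.span_le.2 ?_) ?_) (not_not.1 hs)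
  · rintro _ ⟨s', hs', rfl⟩
    obtain hlt | hle := lt_or_ge s'.degree t
    · exact Submodule.mem_sup_left (Submodule.subset_span ⟨s', ⟨hs', hlt⟩, rfl⟩)
    · exact Submodule.mem_sup_right (Ideal.pow_le_pow_right hle (monomialEval_mem_pow hy s'))
  · refine (pow_le_span_monomialEval_sup_pow hm hk _ t).trans
      (sup_le_sup_right (Submodule.span_mono (Set.image_mono ?_)) _)
    exact fun s' ⟨hss', hst⟩ => ⟨Finsupp.DegLex.lt_iff.2 (.inl hss'), hst⟩

theorem monomialEval_mem_span_standardMonomials_sup [Finite σ]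
    (hm : m = Ideal.span (Set.range y)) (hk : ∀ b : B, ∃ c : k, b - algebraMap k B c ∈ m)
    {t : ℕ} {s : σ →₀ ℕ} (hs : s.degree < t) :
    monomialEval y s ∈ Submodule.span k
      (monomialEval y '' {s | s ∈ standardMonomials k y m ∧ s.degree < t}) ⊔
        (m ^ t).restrictScalars k := by
  have hfin : (TruncAlg.degLT σ t : Set (σ →₀ ℕ)).WellFoundedOn fun a b =>
      toDegLex b < toDegLex a := by
    have : IsStrictOrder (σ →₀ ℕ) fun a b => toDegLex b < toDegLex a :=
      { irrefl := fun a => lt_irrefl _, trans := fun a b c hab hbc => hbc.trans hab }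
    exact (TruncAlg.degLT σ t).finite_toSet.wellFoundedOn
  refine hfin.induction (P := fun s => monomialEval y s ∈ Submodule.span k
    (monomialEval y '' {s | s ∈ standardMonomials k y m ∧ s.degree < t}) ⊔
      (m ^ t).restrictScalars k) (TruncAlg.mem_degLT.2 hs) fun s hst ih => ?_
  by_cases hstd : s ∈ standardMonomials k y m
  · exact Submodule.mem_sup_left
      (Submodule.subset_span ⟨s, ⟨hstd, TruncAlg.mem_degLT.1 hst⟩, rfl⟩)
  refine SetLike.le_def.1 (sup_le (Submodule.span_le.2 ?_) le_sup_right)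
    (monomialEval_mem_of_notMem_standardMonomials hm hk (t := t) hstd)
  rintro _ ⟨s', ⟨hlt, hst'⟩, rfl⟩
  exact ih s' (TruncAlg.mem_degLT.2 hst') hlt

theorem span_standardMonomials_sup_pow_eq_top [Finite σ] (hm : m = Ideal.span (Set.range y))
    (hk : ∀ b : B, ∃ c : k, b - algebraMap k B c ∈ m) (t : ℕ) :
    Submodule.span k (monomialEval y '' {s | s ∈ standardMonomials k y m ∧ s.degree < t}) ⊔
      (m ^ t).restrictScalars k = ⊤ := by
  have htop : (⊤ : Submodule k B) ≤ (m ^ 0).restrictScalars k := by simp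
  refine eq_top_iff.2 (htop.trans ((pow_le_span_monomialEval_sup_pow hm hk 0 t).trans
    (sup_le (Submodule.span_le.2 ?_) le_sup_right)))
  rintro _ ⟨s, ⟨-, hs⟩, rfl⟩
  exact monomialEval_mem_span_standardMonomials_sup hm hk hs

theorem linearIndependent_standardMonomials {t : ℕ} {S : Finset (σ →₀ ℕ)}
    (hS : ∀ s ∈ S, s ∈ standardMonomials k y m ∧ s.degree < t) :
    LinearIndependent k fun s : S => Ideal.Quotient.mk (m ^ t) (monomialEval y s.1) := by
  classical
  rw [Fintype.linearIndependent_iff]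
  intro c hc
  by_contra! hne
  obtain ⟨s, hs, hmin⟩ := (Finset.univ.filter fun s : S => c s ≠ 0).exists_min_image
    (fun s => toDegLex s.1) (hne.imp fun s hs => Finset.mem_filter.2 ⟨Finset.mem_univ s, hs⟩)
  obtain ⟨hstd, hst⟩ := hS s s.2
  refine hstd ((Submodule.smul_mem_iff _ (Finset.mem_filter.1 hs).2).1 ?_)
  have hsum : ∑ x : S, c x • monomialEval y x.1 ∈ m ^ t := by
    rw [← Ideal.Quotient.eq_zero_iff_mem, ← hc, map_sum]
    rfl
  rw [← Finset.add_sum_erase _ _ (Finset.mem_univ s)] at hsum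
  rw [← add_sub_cancel_right (c s • monomialEval y s.1)
    (∑ x ∈ Finset.univ.erase s, c x • monomialEval y x.1)]
  refine sub_mem (Submodule.mem_sup_right (Ideal.pow_le_pow_right hst hsum))
    (Submodule.mem_sup_left (sum_mem fun x hx => ?_))
  by_cases hx0 : c x = 0
  · rw [hx0, zero_smul]
    exact zero_mem _
  refine Submodule.smul_mem _ _ (Submodule.subset_span ⟨x, ?_, rfl⟩)
  refine lt_of_le_of_ne (hmin x (Finset.mem_filter.2 ⟨Finset.mem_univ x, hx0⟩)) fun h => ?_
  exact (Finset.mem_erase.1 hx).1 (Subtype.ext (toDegLex_injective h).symm)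

open Classical in
theorem finrank_quotient_pow_eq_card_standardMonomials [Finite σ]
    (hm : m = Ideal.span (Set.range y)) (hk : ∀ b : B, ∃ c : k, b - algebraMap k B c ∈ m)
    (t : ℕ) :
    Module.finrank k (B ⧸ m ^ t) =
      ((TruncAlg.degLT σ t).filter (· ∈ standardMonomials k y m)).card := by
  let S := (TruncAlg.degLT σ t).filter (· ∈ standardMonomials k y m)
  have hS (s) : s ∈ S ↔ s ∈ standardMonomials k y m ∧ s.degree < t := by
    rw [Finset.mem_filter, TruncAlg.mem_degLT, and_comm]
  have hli := linearIndependent_standardMonomials fun s hs => (hS s).1 hs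
  have hspan := span_image_quotientMk_eq_top (span_standardMonomials_sup_pow_eq_top hm hk t)
  rw [Set.image_image, ← Set.ext fun s => hS s, Set.image_eq_range] at hspan
  rw [Module.finrank_eq_card_basis (Module.Basis.mk hli hspan.ge), Fintype.card_coe]

end StandardMonomials

theorem isEventuallyPolynomial_finrank_quotient_pow [IsNoetherianRing B] {m : Ideal B}
    (hk : ∀ b : B, ∃ c : k, b - algebraMap k B c ∈ m) :
    IsEventuallyPolynomial fun t => Module.finrank k (B ⧸ m ^ t) := by
  obtain ⟨M, y, hy⟩ := Submodule.fg_iff_exists_fin_generating_family.1 (IsNoetherian.noetherian m)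
  simp only [finrank_quotient_pow_eq_card_standardMonomials hy.symm hk]
  exact isEventuallyPolynomial_card_of_isLowerSet
    (isLowerSet_standardMonomials fun i => hy ▸ Submodule.subset_span ⟨i, rfl⟩)

end Monomials

section SamuelMultiplicity

open TruncAlg Filter

section KPoint

variable {k : Type*} [Field k] {A : Type*} [CommRing A] [Algebra k A]

theorem finite_cotangent_ker [IsNoetherianRing A] (ε : A →ₐ[k] k) :
    Module.Finite k (RingHom.ker ε).Cotangent := by
  obtain ⟨s, hs⟩ := Module.finite_def.1
    (Module.Finite.of_surjective _ (RingHom.ker ε).toCotangent_surjective)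
  refine ⟨⟨s, eq_top_iff.2 fun x _ => ?_⟩⟩
  have hx : x ∈ Submodule.span A (s : Set (RingHom.ker ε).Cotangent) := hs ▸ Submodule.mem_top
  induction hx using Submodule.span_induction with
  | mem x hx => exact Submodule.subset_span hx
  | zero => exact zero_mem _
  | add a b _ _ ha hb => exact add_mem (ha trivial) (hb trivial)
  | smul a b _ hb =>
    rw [smul_cotangent_ker]
    exact Submodule.smul_mem _ _ (hb trivial)

theorem finite_quotient_ker_pow [IsNoetherianRing A] (ε : A →ₐ[k] k) (e : ℕ) :
    Module.Finite k (A ⧸ RingHom.ker ε ^ e) := by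
  obtain ⟨M, y, hy⟩ := Submodule.fg_iff_exists_fin_generating_family.1
    (IsNoetherian.noetherian (RingHom.ker ε))
  refine (finite_and_finrank_quotient_pow_le (k := k) (v := fun _ : Unit => (1 : A))
    (fun i => hy ▸ Submodule.subset_span ⟨i, rfl⟩) (le_sup_of_le_left hy.ge) ?_ e).1
  refine eq_top_iff.2 fun b _ => ?_
  rw [← add_sub_cancel (ε b • (1 : A)) b]
  refine Submodule.add_mem_sup (Submodule.smul_mem _ _ (Submodule.subset_span ⟨(), rfl⟩)) ?_
  change b - ε b • (1 : A) ∈ RingHom.ker ε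
  simp [RingHom.mem_ker]

theorem exists_finset_card_eq_height_forall_mem_pow {R : Type*} [CommRing R] [IsNoetherianRing R]
    (p : Ideal R) [p.IsPrime] :
    ∃ s : Finset R, s.card = p.height ∧ (s : Set R) ⊆ p ∧
      ∃ e, ∀ a ∈ p ^ e, ∃ u ∉ p, u * a ∈ Ideal.span (s : Set R) := by
  obtain ⟨s, hs, hcard⟩ := p.exists_finset_card_eq_height_of_isNoetherianRing
  let L := Localization.AtPrime p
  let J : Ideal R := ((Ideal.span (s : Set R)).map (algebraMap R L)).comap (algebraMap R L)
  have hrad : p ≤ J.radical := by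
    rw [← Ideal.comap_radical, Ideal.radical_eq_sInf, ← Ideal.map_le_iff_le_comap]
    refine le_sInf fun P ⟨hIP, hP⟩ => Ideal.map_le_iff_le_comap.2 ?_
    refine hs.2 ⟨hP.comap _, Ideal.map_le_iff_le_comap.1 hIP⟩ ?_
    refine le_of_le_of_eq ?_ (IsLocalization.AtPrime.under_maximalIdeal L p)
    exact Ideal.comap_mono (IsLocalRing.le_maximalIdeal hP.ne_top)
  obtain ⟨e, he⟩ := Ideal.exists_pow_le_of_le_radical_of_fg hrad (IsNoetherian.noetherian p)
  exact ⟨s, hcard, Ideal.span_le.1 hs.1.2, e, fun a ha =>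
    (IsLocalization.algebraMap_mem_map_algebraMap_iff p.primeCompl L _ a).1 (he ha)⟩

theorem exists_span_range_sup_ker_eq_top {R M M' ι : Type*} [Ring R] [AddCommGroup M]
    [AddCommGroup M'] [Module R M] [Module R M'] {f : M →ₗ[R] M'} (hf : Function.Surjective f)
    {b : ι → M'} (hb : Submodule.span R (Set.range b) = ⊤) :
    ∃ v : ι → M, Submodule.span R (Set.range v) ⊔ LinearMap.ker f = ⊤ := by
  choose v hv using fun i => hf (b i)
  refine ⟨v, ?_⟩
  rw [← Submodule.comap_map_eq, Submodule.map_span, ← Set.range_comp,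
    show f ∘ v = b from funext hv, hb, Submodule.comap_top]

theorem span_range_comp_sup_eq_top {R M M' ι : Type*} [Semiring R] [AddCommMonoid M]
    [AddCommMonoid M'] [Module R M] [Module R M'] {f : M →ₗ[R] M'} (hf : Function.Surjective f)
    {v : ι → M} {N : Submodule R M} (hv : Submodule.span R (Set.range v) ⊔ N = ⊤)
    {N' : Submodule R M'} (hN : ∀ x ∈ N, f x ∈ N') :
    Submodule.span R (Set.range (f ∘ v)) ⊔ N' = ⊤ := by
  refine eq_top_iff.2 ((LinearMap.range_eq_top.2 hf).ge.trans ?_)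
  rw [← Submodule.map_top, ← hv, Submodule.map_sup, Submodule.map_span, ← Set.range_comp]
  exact sup_le_sup le_rfl (Submodule.map_le_iff_le_comap.2 hN)

theorem card_degLT_le_finrank_mul {ε : A →ₐ[k] k} {σ ι : Type*} [Finite σ] [DecidableEq σ]
    [Finite ι] (hA : LiftsTrunc k A σ) (b : Module.Basis σ k (RingHom.ker ε).Cotangent) {y : ι → A}
    (hy : ∀ i, ε (y i) = 0) {I : Ideal A} [Module.Finite k (A ⧸ I)]
    (hI : ∀ a ∈ I, ∃ u, ε u ≠ 0 ∧ u * a ∈ Ideal.span (Set.range y)) (t : ℕ) :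
    (degLT σ t).card ≤ Module.finrank k (A ⧸ I) * (degLT ι t).card := by
  obtain rfl | ht := t.eq_zero_or_pos
  · simp [degLT_zero]
  have h0 : 0 ∈ degLT σ t := zero_mem_degLT ht
  obtain ⟨φ, hφ, hφε⟩ := hA.exists_surjective b (isLowerSet_degLT t) h0
  have : IsLocalRing (TruncAlg k (degLT σ t)) := isLocalRing h0
  have : (RingHom.ker (aug (k := k) h0)).IsMaximal :=
    RingHom.ker_isMaximal_of_surjective _ (aug_surjective h0)
  let Q : Ideal (TruncAlg k (degLT σ t)) := Ideal.span (Set.range (φ ∘ y))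
  have hQ : Q = (Ideal.span (Set.range y)).map φ := by rw [Ideal.map_span, ← Set.range_comp]
  have hIQ {a : A} (ha : a ∈ I) : φ a ∈ Q := by
    obtain ⟨u, hu, hua⟩ := hI a ha
    have hunit : IsUnit (φ u) := by
      rw [← IsLocalRing.notMem_maximalIdeal, ← IsLocalRing.eq_maximalIdeal this, RingHom.mem_ker,
        hφε]
      exact hu
    rw [← Ideal.unit_mul_mem_iff_mem _ hunit, ← map_mul, hQ]
    exact Ideal.mem_map_of_mem φ hua
  have hQt : Q ^ t = ⊥ := by
    refine le_bot_iff.1 ((Ideal.pow_right_mono (Ideal.span_le.2 ?_) t).trans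
      (ker_aug_pow_eq_bot (k := k) h0 fun _ => mem_degLT.1).le)
    rintro _ ⟨i, rfl⟩
    rw [SetLike.mem_coe, RingHom.mem_ker, Function.comp, hφε, hy]
  obtain ⟨v, hv⟩ := exists_span_range_sup_ker_eq_top (f := (Ideal.Quotient.mkₐ k I).toLinearMap)
    Ideal.Quotient.mk_surjective (Module.finBasis k (A ⧸ I)).span_eq
  have hvQ : Submodule.span k (Set.range (φ ∘ v)) ⊔ Q.restrictScalars k = ⊤ :=
    span_range_comp_sup_eq_top (f := φ.toLinearMap) hφ hv fun _ ha =>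
      hIQ (Ideal.Quotient.eq_zero_iff_mem.1 ha)
  have hle := (finite_and_finrank_quotient_pow_le (k := k) (y := φ ∘ y) (Q := Q)
    (fun i => Ideal.subset_span ⟨i, rfl⟩) le_sup_left hvQ t).2
  rwa [hQt, (AlgEquiv.quotientBot k _).toLinearEquiv.finrank_eq, finrank (isLowerSet_degLT t),
    Nat.card_fin] at hle

theorem card_le_of_forall_card_degLT_le {σ τ : Type*} [Finite σ] [Finite τ] {c : ℕ}
    (h : ∀ t, (degLT σ t).card ≤ c * (degLT τ t).card) : Nat.card σ ≤ Nat.card τ := by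
  by_contra! hlt
  set N := Nat.card σ with hN
  set m := Nat.card τ with hm
  set t := c * (m + 1) with ht
  have hcard := h (t + 1)
  rw [card_degLT_succ, card_degLT_succ, ← hN, ← hm] at hcard
  have hchoose : (t + m + 1).choose (m + 1) ≤ (t + N).choose N := by
    rw [add_assoc, ← Nat.choose_symm_add, ← Nat.choose_symm_add]
    exact Nat.choose_le_choose _ (by omega)
  have hmul : (t + m + 1) * (t + m).choose m ≤ t * (t + m).choose m :=
    calc (t + m + 1) * (t + m).choose m
        = (t + m + 1).choose (m + 1) * (m + 1) := Nat.add_one_mul_choose_eq (t + m) m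
      _ ≤ c * (t + m).choose m * (m + 1) := by gcongr; exact hchoose.trans hcard
      _ = t * (t + m).choose m := by rw [ht]; ring
  have := Nat.le_of_mul_le_mul_right hmul (Nat.choose_pos (by omega))
  omega

theorem card_le_height_ker [IsNoetherianRing A] {ε : A →ₐ[k] k} {σ : Type*} [Finite σ]
    [DecidableEq σ] (hA : LiftsTrunc k A σ) (b : Module.Basis σ k (RingHom.ker ε).Cotangent) :
    (Nat.card σ : ℕ∞) ≤ (RingHom.ker ε).height := by
  have : (RingHom.ker ε).IsPrime := RingHom.ker_isPrime _
  obtain ⟨s, hcard, hs, e, he⟩ := exists_finset_card_eq_height_forall_mem_pow (RingHom.ker ε)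
  rw [← hcard, Nat.cast_le, ← Nat.card_eq_finsetCard s]
  have := finite_quotient_ker_pow ε e
  exact card_le_of_forall_card_degLT_le fun t => card_degLT_le_finrank_mul hA b
    (y := ((↑) : s → A)) (fun i => hs i.2) (I := RingHom.ker ε ^ e) (by simpa using he) t

end KPoint

theorem length_eq_finrank_of_forall_exists_sub_mem {k B : Type*} [Field k] [CommRing B]
    [Algebra k B] [IsLocalRing B]
    (hk : ∀ b : B, ∃ c : k, b - algebraMap k B c ∈ IsLocalRing.maximalIdeal B)
    (M : Type*) [AddCommGroup M] [Module B M] [Module k M] [IsScalarTower k B M]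
    [Module.Finite k M] :
    Module.length B M = Module.finrank k M := by
  have hs : Function.Surjective (algebraMap (IsLocalRing.ResidueField k)
      (IsLocalRing.ResidueField B)) := by
    intro x
    obtain ⟨b, rfl⟩ := IsLocalRing.residue_surjective x
    obtain ⟨c, hc⟩ := hk b
    refine ⟨IsLocalRing.residue k c, ?_⟩
    rw [IsLocalRing.ResidueField.algebraMap_residue, eq_comm, ← sub_eq_zero, ← map_sub]
    exact (IsLocalRing.residue_eq_zero_iff _).2 hc
  rw [← Module.length_eq_finrank, IsLocalRing.length_restrictScalars k B M,
    Module.length_eq_of_surjective (M := IsLocalRing.ResidueField B) hs,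
    Module.length_eq_one (IsLocalRing.ResidueField B) (IsLocalRing.ResidueField B), mul_one]

section Localization

variable {k C B : Type*} [Field k] [CommRing C] [Algebra k C] {P : Ideal C} [P.IsMaximal]
  [CommRing B] [Algebra C B] [Algebra k B] [IsScalarTower k C B] [IsLocalRing B]
  [IsLocalization.AtPrime B P]

theorem exists_sub_algebraMap_mem_maximalIdeal
    (hk : ∀ c : C, ∃ a : k, c - algebraMap k C a ∈ P) (b : B) :
    ∃ a : k, b - algebraMap k B a ∈ IsLocalRing.maximalIdeal B := by
  obtain ⟨x, hx⟩ := (IsLocalization.AtPrime.equivQuotMaximalIdeal P B).surjective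
    (Ideal.Quotient.mk _ b)
  obtain ⟨c, rfl⟩ := Ideal.Quotient.mk_surjective x
  obtain ⟨a, ha⟩ := hk c
  refine ⟨a, ?_⟩
  rw [← Ideal.Quotient.eq_zero_iff_mem, map_sub, sub_eq_zero, ← hx, Ideal.Quotient.eq.2 ha,
    IsScalarTower.algebraMap_apply k C B]
  exact IsLocalization.AtPrime.equivQuotMaximalIdeal_apply_mk P B _

theorem length_quotient_maximalIdeal_pow_eq_finrank
    (hk : ∀ c : C, ∃ a : k, c - algebraMap k C a ∈ P) (t : ℕ) [Module.Finite k (C ⧸ P ^ t)] :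
    Module.length B (B ⧸ IsLocalRing.maximalIdeal B ^ t) = Module.finrank k (C ⧸ P ^ t) := by
  let equiv : (C ⧸ P ^ t) ≃ₗ[k] (B ⧸ IsLocalRing.maximalIdeal B ^ t) :=
    (IsLocalization.AtPrime.equivQuotMaximalIdealPow P B t).toLinearEquiv.restrictScalars k
  have : Module.Finite k (B ⧸ IsLocalRing.maximalIdeal B ^ t) := .equiv equiv
  rw [length_eq_finrank_of_forall_exists_sub_mem (exists_sub_algebraMap_mem_maximalIdeal hk),
    equiv.finrank_eq]

end Localization

section FiniteFree

variable {k A C : Type*} [Field k] [CommRing A] [Algebra k A] [CommRing C] [Algebra k C]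
  [Algebra A C] [IsScalarTower k A C]

open TensorProduct in
theorem exists_span_sup_map_ker_eq_top (ε : A →ₐ[k] k) [Module.Finite A C] [Module.Flat A C] {n : ℕ}
    (hrank : ∀ p, Module.rankAtStalk (R := A) C p = n) :
    ∃ v : Fin n → C, Submodule.span k (Set.range v) ⊔
      ((RingHom.ker ε).map (algebraMap A C)).restrictScalars k = ⊤ := by
  set p := RingHom.ker ε with hp
  have hε (a : A) : a - algebraMap k A (ε a) ∈ p := by simp [hp, RingHom.mem_ker]
  have : p.IsMaximal := RingHom.ker_isMaximal_of_surjective ε fun c => ⟨algebraMap k A c, by simp⟩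
  let _ : Field (A ⧸ p) := Ideal.Quotient.field p
  have hk : Function.Surjective (algebraMap k (A ⧸ p)) := fun x => by
    obtain ⟨a, rfl⟩ := Ideal.Quotient.mk_surjective x
    exact ⟨ε a, (Ideal.Quotient.eq.2 (hε a)).symm⟩
  have hn : Module.finrank (A ⧸ p) ((A ⧸ p) ⊗[A] C) = n := by
    have := Module.rankAtStalk_baseChange (R := A) (M := C) (S := A ⧸ p) ⊥
    rw [hrank, Module.rankAtStalk_eq_finrank_of_free] at this
    simpa using this
  let b := Module.finBasisOfFinrankEq (A ⧸ p) ((A ⧸ p) ⊗[A] C) hn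
  let e := TensorProduct.quotTensorEquivQuotSMul C p
  let f : C →ₗ[k] (A ⧸ p) ⊗[A] C :=
    (e.symm.toLinearMap ∘ₗ (p • (⊤ : Submodule A C)).mkQ).restrictScalars k
  have hf : Function.Surjective f := e.symm.surjective.comp (Submodule.mkQ_surjective _)
  have hb : Submodule.span k (Set.range b) = ⊤ := by
    rw [← Submodule.restrictScalars_span k (A ⧸ p) hk, b.span_eq, Submodule.restrictScalars_top]
  obtain ⟨v, hv⟩ := exists_span_range_sup_ker_eq_top hf hb
  refine ⟨v, hv ▸ congrArg _ (Submodule.ext fun c => ?_)⟩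
  change c ∈ p.map (algebraMap A C) ↔ e.symm (Submodule.Quotient.mk c) = 0
  rw [EmbeddingLike.map_eq_zero_iff, Submodule.Quotient.mk_eq_zero, Ideal.smul_top_eq_map]
  rfl

theorem finite_and_finrank_quotient_pow_le_of_rankAtStalk_eq [Module.Finite A C] [Module.Flat A C]
    {n : ℕ} (hrank : ∀ p, Module.rankAtStalk (R := A) C p = n) {ε : A →ₐ[k] k} {σ : Type*}
    [Finite σ] (b : Module.Basis σ k (RingHom.ker ε).Cotangent) {P : Ideal C}
    (hP : (RingHom.ker ε).map (algebraMap A C) ≤ P) (t : ℕ) :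
    Module.Finite k (C ⧸ P ^ t) ∧ Module.finrank k (C ⧸ P ^ t) ≤ n * (degLT σ t).card := by
  obtain ⟨y, hy, -, hpy⟩ := exists_cotangent_generators b
  obtain ⟨v, hv⟩ := exists_span_sup_map_ker_eq_top (C := C) ε hrank
  set Q := (RingHom.ker ε).map (algebraMap A C)
  have hQ : Q ≤ Ideal.span (Set.range (algebraMap A C ∘ y)) ⊔ Q ^ 2 := by
    rw [Set.range_comp, ← Ideal.map_span, ← Ideal.map_pow, ← Ideal.map_sup]
    exact Ideal.map_mono hpy
  obtain ⟨hfin, hle⟩ := finite_and_finrank_quotient_pow_le (k := k)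
    (fun i => Ideal.mem_map_of_mem (algebraMap A C) (hy i)) hQ hv t
  let f : (C ⧸ Q ^ t) →ₗ[k] (C ⧸ P ^ t) :=
    (Ideal.Quotient.factorₐ k (Ideal.pow_right_mono hP t)).toLinearMap
  have hf : Function.Surjective f := Ideal.Quotient.factor_surjective (Ideal.pow_right_mono hP t)
  rw [Nat.card_fin] at hle
  exact ⟨.of_surjective f hf, (LinearMap.finrank_le_finrank_of_surjective hf).trans hle⟩

theorem exists_hasSamuelMultiplicity_le [IsNoetherianRing A] [Module.Finite A C] [Module.Flat A C]
    {n : ℕ} (hrank : ∀ p, Module.rankAtStalk (R := A) C p = n) {δ : C →ₐ[k] k} {P : Ideal C}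
    [hP : P.IsMaximal] (hδ : RingHom.ker δ = P) {σ : Type*} [Finite σ] [DecidableEq σ]
    (hA : LiftsTrunc k A σ)
    (b : Module.Basis σ k (RingHom.ker (δ.comp (IsScalarTower.toAlgHom k A C))).Cotangent)
    {B : Type*} [CommRing B] [Algebra C B] [IsLocalRing B] [IsLocalization.AtPrime B P] :
    ∃ μ : ℝ, HasSamuelMultiplicity B μ ∧ μ ≤ n := by
  set p := RingHom.ker (δ.comp (IsScalarTower.toAlgHom k A C))
  have : p.IsPrime := RingHom.ker_isPrime _
  have : IsNoetherianRing C := IsNoetherianRing.of_finite A C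
  have hlies : P.LiesOver p := ⟨by ext a; rw [Ideal.mem_under, ← hδ]; rfl⟩
  obtain ⟨d, hd⟩ := ENat.ne_top_iff_exists.1 (Ideal.height_ne_top hP.ne_top)
  have hσd : Nat.card σ ≤ d := by
    rw [← Nat.cast_le (α := ℕ∞), hd, Ideal.height_eq_height_add_of_liesOver_of_hasGoingDown p P]
    exact (card_le_height_ker hA b).trans le_self_add
  have hk (c : C) : ∃ a : k, c - algebraMap k C a ∈ P :=
    ⟨δ c, by rw [← hδ, RingHom.mem_ker]; simp⟩
  have hbound (t : ℕ) := finite_and_finrank_quotient_pow_le_of_rankAtStalk_eq hrank b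
    (P := P) (Ideal.map_le_iff_le_comap.2 hlies.over.le) t
  obtain ⟨μ, hμ, hμn⟩ := (isEventuallyPolynomial_finrank_quotient_pow
    hk).exists_tendsto_factorial_mul_div_pow hσd fun t => (hbound t).2
  let _ : Algebra k B := ((algebraMap C B).comp (algebraMap k C)).toAlgebra
  have : IsScalarTower k C B := .of_algebraMap_eq' rfl
  refine ⟨μ, ⟨IsLocalization.isNoetherianRing P.primeCompl B ‹_›, d, ?_, hμ.congr fun t => ?_⟩, hμn⟩
  · rw [IsLocalization.AtPrime.ringKrullDim_eq_height P B, ← hd]; rfl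
  · have := (hbound t).1
    rw [length_quotient_maximalIdeal_pow_eq_finrank hk, ENat.toNat_natCast]

end FiniteFree

end SamuelMultiplicity

section Charts

theorem exists_algHom_ker_eq (k : Type*) {D : Type*} [Field k] [IsAlgClosed k] [CommRing D]
    [Algebra k D] [Algebra.FiniteType k D] (P : Ideal D) [P.IsMaximal] :
    ∃ δ : D →ₐ[k] k, RingHom.ker δ = P := by
  let _ : Field (D ⧸ P) := Ideal.Quotient.field P
  obtain ⟨ε⟩ := nonempty_algHom_of_finiteType k (D ⧸ P)
  refine ⟨ε.comp (Ideal.Quotient.mkₐ k P), ?_⟩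
  ext x
  rw [RingHom.mem_ker, AlgHom.comp_apply, map_eq_zero_iff ε (RingHom.injective ε.toRingHom)]
  exact Ideal.Quotient.eq_zero_iff_mem

section OpenImmersion

variable {C : Type u} [CommRing C] {Z : Scheme.{u}} (g : Spec (.of C) ⟶ Z) [IsOpenImmersion g]
  (x : PrimeSpectrum C)

theorem isMaximal_asIdeal_of_isClosed_singleton (hx : IsClosed ({g x} : Set Z)) :
    x.asIdeal.IsMaximal := by
  refine (PrimeSpectrum.isClosed_singleton_iff_isMaximal x).1 ?_
  have hpre := hx.preimage g.continuous
  have himage : g '' {x} = {g x} := Set.image_singleton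
  rwa [← himage, g.isOpenEmbedding.injective.preimage_image] at hpre

theorem exists_algebra_isLocalization_stalk :
    ∃ _ : Algebra C (Z.presheaf.stalk (g x)),
      IsLocalization.AtPrime (Z.presheaf.stalk (g x)) x.asIdeal := by
  let S := (Spec (.of C)).presheaf.stalk x
  have hiso (y) : IsIso (g.stalkMap y) := inferInstance
  have := hiso x
  let e : S ≃+* Z.presheaf.stalk (g x) := (asIso (g.stalkMap x)).symm.commRingCatIsoToRingEquiv
  let _ : Algebra C S := StructureSheaf.stalkAlgebra C x
  have : IsLocalization.AtPrime S x.asIdeal := StructureSheaf.IsLocalization.to_stalk C x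
  let algStalk : Algebra C (Z.presheaf.stalk (g x)) :=
    (e.toRingHom.comp (algebraMap C S)).toAlgebra
  exact ⟨algStalk, IsLocalization.isLocalization_of_algEquiv x.asIdeal.primeCompl
    (AlgEquiv.ofRingEquiv (f := e) fun _ => rfl : S ≃ₐ[C] Z.presheaf.stalk (g x))⟩

end OpenImmersion

variable {k : Type u} [Field k]

theorem IsQuasiProjective.isSeparated {X : Scheme.{u}} {f : X ⟶ Spec (.of k)}
    (hf : IsQuasiProjective f) : IsSeparated f := by
  obtain ⟨N, j, hj, -⟩ := hf
  have hproj : IsSeparated (terminal.from (projSpace k N)) :=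
    Scheme.IsSeparated.isSeparated_terminal_from
  have hcomp : f ≫ terminal.from _ = j ≫ terminal.from _ := Subsingleton.elim _ _
  have : IsSeparated (f ≫ terminal.from _) := hcomp ▸ inferInstance
  exact .of_comp f (terminal.from _)

theorem exists_affine_chart {H : Scheme.{u}} (h : H ⟶ Spec (.of k)) [LocallyOfFiniteType h]
    (η : H) : ∃ (A : Type u) (_ : CommRing A) (_ : Algebra k A) (i : Spec (.of A) ⟶ H),
      Algebra.FiniteType k A ∧ IsOpenImmersion i ∧ η ∈ Set.range i ∧ i ≫ h = specHom k A := by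
  obtain ⟨A, i, hi, y, hy⟩ := Scheme.exists_Spec_apply_eq η
  obtain ⟨ψ, hψ⟩ := Spec.map_surjective (i ≫ h)
  let _ : Algebra k A := ψ.hom.toAlgebra
  have : LocallyOfFiniteType (Spec.map ψ) := hψ ▸ inferInstance
  refine ⟨A, inferInstance, inferInstance, i, ?_, hi, ⟨y, hy⟩, hψ.symm⟩
  exact RingHom.finiteType_algebraMap.1
    ((HasRingHomProperty.Spec_iff (P := @LocallyOfFiniteType)).1 this)

theorem IsHilbertScheme.exists_hasSamuelMultiplicity_stalk_le [IsAlgClosed k] [CharZero k]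
    {X : Scheme.{u}} {f : X ⟶ Spec (.of k)} [SmoothOfRelativeDimension 2 f] [IsSeparated f] {n : ℕ}
    {H Z : Scheme.{u}} {h : H ⟶ Spec (.of k)} {q : Z ⟶ X} {π : Z ⟶ H}
    (hH : IsHilbertScheme f n h q π) (ζ : Z) (hζ : IsClosed ({ζ} : Set Z)) :
    ∃ μ : ℝ, HasSamuelMultiplicity (Z.presheaf.stalk ζ) μ ∧ μ ≤ n := by
  have := hH.locallyOfFiniteType
  have := hH.isFamily.isFinite
  obtain ⟨A, _, _, i, hA, hi, ⟨y, hy⟩, hih⟩ := exists_affine_chart h (π ζ)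
  obtain ⟨C, _, _, g, hp⟩ := exists_isPullback_specHom π i
  have : IsOpenImmersion g := MorphismProperty.of_isPullback (P := @IsOpenImmersion) hp.flip hi
  obtain ⟨x, rfl, -⟩ := Scheme.exists_preimage_of_isPullback hp ζ y hy.symm
  obtain ⟨_, _, hrank⟩ := (hH.isFamily.baseChange hp).of_specHom
  have := isMaximal_asIdeal_of_isClosed_singleton g x hζ
  obtain ⟨_, _⟩ := exists_algebra_isLocalization_stalk g x
  let _ : Algebra k C := ((algebraMap A C).comp (algebraMap k A)).toAlgebra
  have : IsScalarTower k A C := .of_algebraMap_eq' rfl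
  have : Algebra.FiniteType k C := .trans (S := A) hA inferInstance
  have : IsNoetherianRing A := Algebra.FiniteType.isNoetherianRing k A
  obtain ⟨δ, hδ⟩ := exists_algHom_ker_eq k x.asIdeal
  have := finite_cotangent_ker (δ.comp (IsScalarTower.toAlgHom k A C))
  exact exists_hasSamuelMultiplicity_le hrank hδ (hH.liftsTrunc i hih _)
    (Module.finBasis k (RingHom.ker (δ.comp (IsScalarTower.toAlgHom k A C))).Cotangent)

theorem exists_socleDimAt_eq [IsAlgClosed k] {X : Scheme.{u}} [Nonempty X]
    (f : X ⟶ Spec (.of k)) [SmoothOfRelativeDimension 2 f] [IsSeparated f] {n : ℕ} (hn : 1 ≤ n) :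
    ∃ (ξ : Scheme.{u}) (i : ξ ⟶ X), IsClosedSubschemeOfLength f n i ∧
      ∃ p : ξ, socleDimAt i p = (⌊(Real.sqrt (1 + 8 * (n : ℝ)) - 1) / 2⌋₊ : ℕ∞) := by
  set b := ⌊(Real.sqrt (1 + 8 * (n : ℝ)) - 1) / 2⌋₊
  have hb0 : 0 < b := (triangular_le_iff_le_floor 1 n).1 hn
  obtain ⟨e, he⟩ := Nat.exists_eq_add_of_le ((triangular_le_iff_le_floor b n).2 le_rfl)
  obtain ⟨ξ, i, hi, p, hp⟩ := exists_le_socleDimAt f hb0 e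
  rw [← he] at hi
  exact ⟨ξ, i, hi, p, le_antisymm (socleDimAt_le f i hi p) hp⟩

end Charts

end

theorem theorem2_general {k : Type u} [Field k] [IsAlgClosed k] [CharZero k]
    {X : Scheme.{u}} [Nonempty X] (f : X ⟶ Spec (.of k)) [IsSeparated f]
    [SmoothOfRelativeDimension 2 f] (n : ℕ) (hn : 1 ≤ n) :
    (∀ {ξ : Scheme.{u}} (i : ξ ⟶ X), IsClosedSubschemeOfLength f n i →
      ∀ p : ξ, socleDimAt i p ≤ (⌊(Real.sqrt (1 + 8 * (n : ℝ)) - 1) / 2⌋₊ : ℕ∞)) ∧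
    (∃ (ξ : Scheme.{u}) (i : ξ ⟶ X), IsClosedSubschemeOfLength f n i ∧
      ∃ p : ξ, socleDimAt i p = (⌊(Real.sqrt (1 + 8 * (n : ℝ)) - 1) / 2⌋₊ : ℕ∞)) ∧
    (∀ {H Z : Scheme.{u}} (h : H ⟶ Spec (.of k)) (q : Z ⟶ X) (π : Z ⟶ H),
      IsHilbertScheme f n h q π → ∀ ζ : Z, IsClosed ({ζ} : Set Z) →
        ∃ μ : ℝ, HasSamuelMultiplicity (Z.presheaf.stalk ζ) μ ∧ μ ≤ n) :=
  ⟨fun i hi p => socleDimAt_le f i hi p, exists_socleDimAt_eq f hn,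
    fun _ _ _ hH ζ hζ => hH.exists_hasSamuelMultiplicity_stalk_le ζ hζ⟩

theorem theorem2 {k : Type u} [Field k] [IsAlgClosed k] [CharZero k]
    {X : Scheme.{u}} [Nonempty X] (f : X ⟶ Spec (.of k))
    (hqp : IsQuasiProjective f) (hsm : SmoothOfRelativeDimension 2 f)
    (n : ℕ) (hn : 1 ≤ n) :
    -- the bound on the socle dimension
    (∀ {ξ : Scheme.{u}} (i : ξ ⟶ X), IsClosedSubschemeOfLength f n i →
      ∀ p : ξ, socleDimAt i p ≤ (⌊(Real.sqrt (1 + 8 * (n : ℝ)) - 1) / 2⌋₊ : ℕ∞)) ∧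
    -- the bound is attained
    (∃ (ξ : Scheme.{u}) (i : ξ ⟶ X), IsClosedSubschemeOfLength f n i ∧
      ∃ p : ξ, socleDimAt i p = (⌊(Real.sqrt (1 + 8 * (n : ℝ)) - 1) / 2⌋₊ : ℕ∞)) ∧
    -- the Samuel multiplicity at every closed point of the universal family is at most `n`
    (∀ {H Z : Scheme.{u}} (h : H ⟶ Spec (.of k)) (q : Z ⟶ X) (π : Z ⟶ H),
      IsHilbertScheme f n h q π → ∀ ζ : Z, IsClosed ({ζ} : Set Z) →
        ∃ μ : ℝ, HasSamuelMultiplicity (Z.presheaf.stalk ζ) μ ∧ μ ≤ n) := by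
  have := hqp.isSeparated
  exact theorem2_general f n hn
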